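/- Let $S$ be a compact connected oriented surface with $\chi(S)<0$, whose (possibly empty) boundary $\partial S$ consists of closed curves $\beta_1,\dots,\beta_n$. Fix an auxiliary hyperbolic metric on $S$ with geodesic boundary, and use it to identify the universal cover $\tilde S$ with a closed convex subset of the hyperbolic plane $\mathbb{H}^2$, bounded by complete geodesics, on which $\pi=\pi_1(S)$ acts by orientation-preserving isometries of $\mathbb{H}^2$. Let $\partial_\infty\tilde S$ be the set of points of the circle at infinity lying in the closure of $\tilde S$, and let $\mathcal{G}(\tilde S)$ be the space of unordered pairs of distinct points of $\partial_\infty\tilde S$ (bi-infinite geodesics). If $\partial S=\emptyset$, a geodesic current on $S$ is a $\pi$-invariant locally finite Borel measure on $\mathcal{G}(\tilde S)$. If $\partial S\neq\emptyset$, let $DS$ be the double of $S$, so that $\mathcal{G}(\tilde S)$ is a closed subset of $\mathcal{G}(\widetilde{DS})$; a geodesic current on $S$ is then a $\pi$-invariant locally finite Borel measure on $\mathcal{G}(\tilde S)$ which is the restriction of a geodesic current on $DS$ that is invariant under the natural involution of $DS$ and whose support does not transversely intersect $\partial S$. Let $\mathscr{C}(S)$ be the set of geodesic currents on $S$, with the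 weak-$*$ topology, i.e. the coarsest topology for which $c\mapsto\int f\,dc$ is continuous for every continuous compactly supported $f:\mathcal{G}(\tilde S)\to\mathbb{R}$. For each $j$, denote again by $\beta_j$ the measure $\sum\delta_{\tilde\beta_j}$ on $\mathcal{G}(\tilde S)$, the sum being over all lifts $\tilde\beta_j$ of $\beta_j$ to $\tilde S$. Let $\mathscr{C}_{\partial S}(S)$ be the set of currents supported on the boundary, that is, those of the form $\sum_{j=1}^n u_j\beta_j$ with all $u_j\ge 0$, and let $\mathscr{C}_0(S)$ be the set of internal currents, that is, the currents $c$ with $c(\{\tilde\beta_j\})=0$ for all $j$ and all lifts $\tilde\beta_j$ of $\beta_j$. Then each $\beta_j$ is a geodesic current on $S$, and $$\mathscr{C}(S)=\mathscr{C}_{\partial S}(S)\oplus\mathscr{C}_0(S),$$ meaning that each $c\in\mathscr{C}(S)$ can be uniquely written as the sum of a current supported on the boundary and an internal current; moreover the coefficients $u_1,\dots,u_n\ge 0$ in $c=\sum_j u_j\beta_j+c_0$, $c_0\in\mathscr{C}_0(S)$, are unique. Furthermore, $\mathscr{C}_{\partial S}(S)$ is a closed subset of $\mathscr{C}(S)$,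 and $\mathscr{C}_0(S)$ is a dense Borel subset of $\mathscr{C}(S)$. -/

import Mathlib

open scoped UpperHalfPlane NNReal
open MeasureTheory Matrix

noncomputable section

namespace GeodesicCurrents

/-- Bi-infinite geodesics of the hyperbolic plane `ℍ`, as unordered pairs of distinct points of the
circle at infinity `∂ℍ = ℝ ∪ {∞}`. -/
def Geodesic : Type := {s : Sym2 (OnePoint ℝ) // ¬ s.IsDiag}

namespace Geodesic

/-- The topology inherited from the quotient `Sym2 (∂ℍ)` of `∂ℍ × ∂ℍ`. -/
instance : TopologicalSpace Geodesic :=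
  inferInstanceAs (TopologicalSpace {s : Sym2 (OnePoint ℝ) // ¬ s.IsDiag})

instance : MeasurableSpace Geodesic := borel Geodesic

instance : BorelSpace Geodesic := ⟨rfl⟩

/-- Isometries of `ℍ` act on geodesics through their action on endpoints. In Mathlib `GL (Fin 2) ℝ`
acts on `ℍ` by all its isometries (the elements of negative determinant reverse the orientation)
and compatibly on `ℝ ∪ {∞}`; the scalar matrices act trivially. -/
instance : SMul (GL (Fin 2) ℝ) Geodesic :=
  ⟨fun g γ => ⟨γ.1.map (g • ·),
    fun hd => γ.2 ((Sym2.isDiag_map (MulAction.injective g)).1 hd)⟩⟩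

/-- The complete geodesic line in `ℍ` with the given endpoints: a vertical half-line or a
half-circle orthogonal to the real axis. -/
def line (γ : Geodesic) : Set ℍ :=
  {z | (∃ a b : ℝ, γ.1 = s((a : OnePoint ℝ), (b : OnePoint ℝ)) ∧
          (z.re - a) * (z.re - b) + z.im ^ 2 = 0) ∨
       (∃ a : ℝ, γ.1 = s((a : OnePoint ℝ), OnePoint.infty) ∧ z.re = a)}

/-- Two geodesics intersect transversely if they are distinct and meet in `ℍ`. -/
def Crosses (γ γ' : Geodesic) : Prop := γ ≠ γ' ∧ (γ.line ∩ γ'.line).Nonempty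

end Geodesic

/-- A measure on the space of geodesics of `ℍ` which is invariant under a group of isometries. -/
def IsInvariant (Δ : Subgroup (GL (Fin 2) ℝ)) (μ : Measure Geodesic) : Prop :=
  ∀ g ∈ Δ, ∀ A : Set Geodesic, MeasurableSet A → μ ((g • ·) ⁻¹' A) = μ A

/-- A hyperbolic metric with geodesic boundary on the oriented surface `S`, given together with the
identification of the universal cover of `S` with a subset of the hyperbolic plane: a closed convex
region `cover` of `ℍ` with nonempty interior, bounded by complete geodesics, and a covering map
`proj : cover → S` whose fibres are the orbits of a group `deck` of orientation-preserving
isometries of `ℍ`. As `cover` is simply connected, `proj` is the universal cover of `S`, and `deck`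
acts on `cover` as the fundamental group of `S`. -/
structure HyperbolicStructure (S : Type*) [TopologicalSpace S] where
  /-- the universal cover of `S`, as a subset of the hyperbolic plane -/
  cover : Set ℍ
  isClosed_cover : IsClosed cover
  interior_nonempty : (interior cover).Nonempty
  /-- `cover` contains the geodesic segment between any two of its points -/
  convex : ∀ z ∈ cover, ∀ w ∈ cover, ∀ p : ℍ, dist z p + dist p w = dist z w → p ∈ cover
  /-- the boundary of `cover` consists of complete geodesics -/
  frontier_geodesic : ∀ z ∈ frontier cover,
    ∃ γ : Geodesic, z ∈ γ.line ∧ γ.line ⊆ frontier cover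
  /-- the group of deck transformations -/
  deck : Subgroup (GL (Fin 2) ℝ)
  deck_det_pos : ∀ g ∈ deck, 0 < (g : Matrix (Fin 2) (Fin 2) ℝ).det
  deck_smul_mem : ∀ g ∈ deck, ∀ z ∈ cover, g • z ∈ cover
  /-- the covering projection -/
  proj : cover → S
  isCoveringMap_proj : IsCoveringMap proj
  surjective_proj : Function.Surjective proj
  proj_eq_iff : ∀ z w : cover, proj z = proj w ↔ ∃ g ∈ deck, g • (z : ℍ) = w

namespace HyperbolicStructure

variable {S : Type*} [TopologicalSpace S] (h : HyperbolicStructure S)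

/-- The ideal boundary of the universal cover: the points of `∂ℍ = ℝ ∪ {∞}` in the closure of
`cover`, taken in the Riemann sphere `ℂ ∪ {∞}`. -/
def idealBoundary : Set (OnePoint ℝ) :=
  {ξ | ξ.map (fun x : ℝ => (x : ℂ)) ∈
    closure ((fun z : ℍ => ((z : ℂ) : OnePoint ℂ)) '' h.cover)}

/-- The geodesics of `ℍ` with both endpoints in the ideal boundary of the universal cover. -/
def geodesicSet : Set Geodesic := {γ | ∀ ξ ∈ γ.1, ξ ∈ h.idealBoundary}

/-- The space of bi-infinite geodesics of the universal cover of `S`. -/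
abbrev Geod : Type := h.geodesicSet

/-- The lifts of the boundary curves of `S`: the geodesics that make up the boundary of `cover`. -/
def boundaryLifts : Set h.Geod := {γ | γ.1.line ⊆ frontier h.cover}

/-- The orbit of a geodesic under the fundamental group. -/
def deckOrbit (γ : h.Geod) : Set h.Geod := {γ' | ∃ g ∈ h.deck, g • γ.1 = γ'.1}

/-- The boundary curves `β₁, …, βₙ` of `S`; each is represented by the set of its lifts. -/
def BoundaryCurve : Type := {O : Set h.Geod // ∃ γ ∈ h.boundaryLifts, O = h.deckOrbit γ}

/-- The measure `∑ δ_β̃` over all lifts `β̃` of the boundary curve `β`. -/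
def curveMeasure (β : h.BoundaryCurve) : Measure h.Geod :=
  Measure.sum fun γ : β.1 => Measure.dirac γ.1

/-- The isometry group of `ℍ` generated by the deck group of `S` and the reflections across the
lifts of `∂S`. It consists of all lifts of the identity and of the natural involution of the double
`DS` of `S` to the universal cover `ℍ` of `DS`; the fundamental group of `DS` is its
orientation-preserving subgroup. -/
def doubleGroup : Subgroup (GL (Fin 2) ℝ) :=
  Subgroup.closure ((h.deck : Set (GL (Fin 2) ℝ)) ∪
    {r | (r : Matrix (Fin 2) (Fin 2) ℝ).det < 0 ∧
      ∃ β ∈ h.boundaryLifts, ∀ z ∈ β.1.line, r • z = z})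

/-- `μ` is a geodesic current on the double `DS`, invariant under the natural involution of `DS`,
whose support does not transversely intersect `∂S`. -/
structure IsDoubleCurrent (μ : Measure Geodesic) : Prop where
  isLocallyFinite : IsLocallyFiniteMeasure μ
  invariant : IsInvariant h.doubleGroup μ
  not_crosses : ∀ γ ∈ μ.support, ∀ g ∈ h.doubleGroup, ∀ β ∈ h.boundaryLifts,
    ¬ γ.Crosses (g • β.1)

/-- Geodesic currents on `S`: locally finite measures on the space of geodesics of the universal
cover which are invariant under the fundamental group and which, if `S` has nonempty boundary, are
restrictions of involution-invariant currents on the double of `S` whose support does not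
transversely intersect `∂S`. -/
structure IsCurrent (c : Measure h.Geod) : Prop where
  isLocallyFinite : IsLocallyFiniteMeasure c
  invariant : IsInvariant h.deck (c.map Subtype.val)
  restriction : h.boundaryLifts.Nonempty →
    ∃ μ : Measure Geodesic, h.IsDoubleCurrent μ ∧ c.map Subtype.val = μ.restrict h.geodesicSet

theorem isLocallyFinite_add {X : Type*} [TopologicalSpace X] [MeasurableSpace X]
    {μ ν : Measure X} (hμ : IsLocallyFiniteMeasure μ) (hν : IsLocallyFiniteMeasure ν) :
    IsLocallyFiniteMeasure (μ + ν) := by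
  refine ⟨fun x => ?_⟩
  obtain ⟨s, hs, hs'⟩ := hμ.finiteAtNhds x
  obtain ⟨t, ht, ht'⟩ := hν.finiteAtNhds x
  refine ⟨s ∩ t, Filter.inter_mem hs ht, ?_⟩
  rw [Measure.add_apply]
  exact ENNReal.add_lt_top.2 ⟨(measure_mono Set.inter_subset_left).trans_lt hs',
    (measure_mono Set.inter_subset_right).trans_lt ht'⟩

theorem isLocallyFinite_smul {X : Type*} [TopologicalSpace X] [MeasurableSpace X]
    {μ : Measure X} (a : ℝ≥0) (hμ : IsLocallyFiniteMeasure μ) :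
    IsLocallyFiniteMeasure (a • μ) := inferInstance

theorem support_smul_subset {X : Type*} [TopologicalSpace X] [MeasurableSpace X]
    {μ : Measure X} (a : ℝ≥0) : (a • μ).support ⊆ μ.support :=
  (Measure.smul_absolutelyContinuous (c := (a : ENNReal))).support_mono

theorem isInvariant_add {Δ : Subgroup (GL (Fin 2) ℝ)} {μ ν : Measure Geodesic}
    (hμ : IsInvariant Δ μ) (hν : IsInvariant Δ ν) : IsInvariant Δ (μ + ν) := by
  intro g hg A hA
  rw [Measure.add_apply, Measure.add_apply, hμ g hg A hA, hν g hg A hA]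

theorem isInvariant_smul {Δ : Subgroup (GL (Fin 2) ℝ)} {μ : Measure Geodesic} (a : ℝ≥0)
    (hμ : IsInvariant Δ μ) : IsInvariant Δ (a • μ) := by
  intro g hg A hA
  rw [Measure.smul_apply, Measure.smul_apply, hμ g hg A hA]

/-- The space `𝒞(S)` of geodesic currents on `S`, with its structure of convex cone. -/
def currents : Submodule ℝ≥0 (Measure h.Geod) where
  carrier := {c | h.IsCurrent c}
  zero_mem' := by
    refine ⟨inferInstance, ?_, fun _ => ⟨0, ⟨inferInstance, ?_, ?_⟩, ?_⟩⟩
    · intro g _ A _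
      simp
    · intro g _ A _
      simp
    · simp
    · simp
  add_mem' := by
    rintro c d ⟨hc, hc', hc''⟩ ⟨hd, hd', hd''⟩
    refine ⟨isLocallyFinite_add hc hd, ?_, fun hb => ?_⟩
    · rw [Measure.map_add _ _ measurable_subtype_coe]
      exact isInvariant_add hc' hd'
    · obtain ⟨μ, hμ, hμc⟩ := hc'' hb
      obtain ⟨ν, hν, hνd⟩ := hd'' hb
      refine ⟨μ + ν, ⟨isLocallyFinite_add hμ.1 hν.1, isInvariant_add hμ.2 hν.2, ?_⟩, ?_⟩
      · intro γ hγ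
        rw [Measure.support_add] at hγ
        exact hγ.elim (hμ.3 γ) (hν.3 γ)
      · rw [Measure.map_add _ _ measurable_subtype_coe, Measure.restrict_add, hμc, hνd]
  smul_mem' := by
    rintro a c ⟨hc, hc', hc''⟩
    refine ⟨isLocallyFinite_smul a hc, ?_, fun hb => ?_⟩
    · rw [Measure.map_smul]
      exact isInvariant_smul a hc'
    · obtain ⟨μ, hμ, hμc⟩ := hc'' hb
      refine ⟨a • μ, ⟨isLocallyFinite_smul a hμ.1, isInvariant_smul a hμ.2,
        fun γ hγ => hμ.3 γ (support_smul_subset a hγ)⟩, ?_⟩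
      rw [Measure.map_smul, Measure.restrict_smul, hμc]

/-- The weak-* topology: the coarsest one for which `c ↦ ∫ f dc` is continuous for all continuous
compactly supported functions `f` on the space of geodesics. -/
instance : TopologicalSpace h.currents :=
  TopologicalSpace.induced
    (fun (c : h.currents) (f : CompactlySupportedContinuousMap h.Geod ℝ) =>
      ∫ γ, f γ ∂(c : Measure h.Geod))
    inferInstance

/-- The currents supported on the boundary of `S`: the linear combinations of the boundary curves
with nonnegative coefficients. -/
def boundaryCurrents : Submodule ℝ≥0 h.currents :=
  (Submodule.span ℝ≥0 (Set.range h.curveMeasure)).comap h.currents.subtype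

/-- The currents internal in `S`: those giving no mass to the lifts of the boundary curves. -/
def internalCurrents : Submodule ℝ≥0 h.currents where
  carrier := {c | ∀ β ∈ h.boundaryLifts, (c : Measure h.Geod) {β} = 0}
  zero_mem' := by
    intro β _
    simp
  add_mem' := by
    intro c d hc hd β hβ
    simp [hc β hβ, hd β hβ]
  smul_mem' := by
    intro a c hc β hβ
    simp [hc β hβ]

end HyperbolicStructure

end GeodesicCurrents

end

/-! Geometry. In the paraboloid model `klein` geodesics are affine chords and half-planes are cut
out by the affine functions `aff T`, so the universal cover becomes a Euclidean convex set. It is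
the intersection of the half-planes bounded by its boundary geodesics (`exists_side_neg`), hence a
geodesic has both ends in the ideal boundary exactly when its line lies in the cover
(`mem_geodesicSet_iff`). Compactness of `S` makes local facts uniform: distinct boundary geodesics
keep a positive distance (`exists_separation`), so only finitely many meet a ball. Therefore the set
`L` of boundary lifts is closed and countable, and there are finitely many boundary curves.

Extension to the double. An element of the double group acts as a reduced word in the reflections
times a deck transformation. As distinct boundary geodesics bound disjoint half-planes, a nonempty
reduced word pushes the cover across its first axis. So a translate of a geodesic of the cover that
meets the cover is already a deck translate (`exists_deck_smul_eq`). It follows that the counting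
measure on a discrete deck-invariant family extends to a current on the double, by counting all
translates.

Decomposition. A current `c` splits into its restrictions to `L` and to the complement. Its atoms on
`L` are constant along deck orbits and supply the coefficients. The second part is again a current,
since its extension to the double can be restricted off the translates of `L`.

Topology. A current is supported on the boundary iff it integrates to `0` every test function
vanishing on `L`: a closed condition. It has no atom at `x` iff for each `k` some test function `f ≥
0` with `f x ≥ 1` has integral below `1 / (k + 1)`; over the countable set `L` this gives a
countable intersection of open sets.

Density. It suffices to approximate each boundary curve. Let `b` translate along a lift `β`, let `a`
be a deck transformation moving `β`, and take the axis of `b ^ n * a`: a closed geodesic running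
about `n` times along `β`, with an excursion of bounded size. Its counting measure has mass `O(n)`
on compact sets, `O(1)` on those missing the orbit of `β`, and at least `n - M` near `β`
(`exists_seq_geod`). Let `ψ` be a bump at `β`. Modulo translates of `ψ`, every test function
vanishes on the orbit of `β` (`exists_decomposition`), so after division by the integral of `ψ` the
measures converge to the boundary curve. -/

noncomputable section

namespace GeodesicCurrents

open UpperHalfPlane

/-! ### Isometries and geodesics in the Klein model -/

/-- The paraboloid version of the Klein model: geodesics become affine chords. -/
def klein (z : ℍ) : ℝ × ℝ := (z.re, z.re ^ 2 + z.im ^ 2)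

/-- The affine function whose sign on `klein z` is the sign of `(T • z).re`. -/
def aff (T : GL (Fin 2) ℝ) (p : ℝ × ℝ) : ℝ :=
  T 0 0 * T 1 0 * p.2 + (T 0 0 * T 1 1 + T 0 1 * T 1 0) * p.1 + T 0 1 * T 1 1

theorem aff_combo (T : GL (Fin 2) ℝ) (p q : ℝ × ℝ) {a b : ℝ} (hab : a + b = 1) :
    aff T (a • p + b • q) = a * aff T p + b * aff T q := by
  obtain rfl : a = 1 - b := by linarith
  simp only [aff, Prod.fst_add, Prod.snd_add, Prod.smul_fst, Prod.smul_snd, smul_eq_mul]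
  ring

theorem continuous_aff (T : GL (Fin 2) ℝ) : Continuous (aff T) := by
  unfold aff; fun_prop

theorem continuous_klein : Continuous klein := by
  have h1 := UpperHalfPlane.continuous_re
  have h2 := UpperHalfPlane.continuous_im
  unfold klein; fun_prop

theorem normSq_denom_pos' (T : GL (Fin 2) ℝ) (z : ℍ) : 0 < Complex.normSq (denom T z) :=
  Complex.normSq_pos.2 (denom_ne_zero T z)

theorem re_smul_eq (T : GL (Fin 2) ℝ) (z : ℍ) :
    (T • z).re = aff T (klein z) / Complex.normSq (denom T z) := by
  have h := normSq_denom_pos' T z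
  rw [UpperHalfPlane.re_smul, Complex.div_re, ← add_div]
  congr 1
  simp only [num, denom, aff, klein, Complex.add_re, Complex.mul_re, Complex.ofReal_re,
    Complex.ofReal_im, Complex.add_im, Complex.mul_im, zero_mul, sub_zero, add_zero,
    UpperHalfPlane.coe_re, UpperHalfPlane.coe_im]
  ring

theorem re_smul_pos {T : GL (Fin 2) ℝ} {z : ℍ} : 0 < (T • z).re ↔ 0 < aff T (klein z) := by
  rw [re_smul_eq, div_pos_iff_of_pos_right (normSq_denom_pos' T z)]

theorem re_smul_nonneg {T : GL (Fin 2) ℝ} {z : ℍ} : 0 ≤ (T • z).re ↔ 0 ≤ aff T (klein z) := by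
  have h := normSq_denom_pos' T z
  rw [re_smul_eq]
  exact ⟨fun h' => by simpa [h.ne'] using mul_nonneg h' h.le, fun h' => div_nonneg h' h.le⟩

theorem re_smul_eq_zero {T : GL (Fin 2) ℝ} {z : ℍ} : (T • z).re = 0 ↔ aff T (klein z) = 0 := by
  rw [re_smul_eq, div_eq_zero_iff, or_iff_left (normSq_denom_pos' T z).ne']

/-- The invertible matrix with rows `(a, b)` and `(c, d)`. -/
def mat (a b c d : ℝ) (h : a * d - b * c ≠ 0) : GL (Fin 2) ℝ :=
  .mkOfDetNeZero !![a, b; c, d] (by simpa [det_fin_two_of] using h)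

section mat

variable {a b c d : ℝ} (h : a * d - b * c ≠ 0)

@[simp] theorem mat_00 : (mat a b c d h) 0 0 = a := rfl

@[simp] theorem mat_01 : (mat a b c d h) 0 1 = b := rfl

@[simp] theorem mat_10 : (mat a b c d h) 1 0 = c := rfl

@[simp] theorem mat_11 : (mat a b c d h) 1 1 = d := rfl

theorem coe_mat : (mat a b c d h : Matrix (Fin 2) (Fin 2) ℝ) = !![a, b; c, d] := rfl

end mat

theorem det_ne_zero (T : GL (Fin 2) ℝ) : T 0 0 * T 1 1 - T 0 1 * T 1 0 ≠ 0 := by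
  have := T.det_ne_zero
  rwa [Matrix.det_fin_two] at this

/-- The fraction in `cosh_dist` is unchanged: `T z - T w` is `det T * (z - w)` over the product of
the denominators, and imaginary parts scale by `|det T|` over the squared norms of the denominators.
A negative determinant only adds a conjugation `σ`, which preserves norms. -/
theorem isometry_smul_gl (T : GL (Fin 2) ℝ) : Isometry (T • · : ℍ → ℍ) := by
  refine Isometry.of_dist_eq fun z w => ?_
  have hd := det_ne_zero T
  have key : dist ((T • z : ℍ) : ℂ) ((T • w : ℍ) : ℂ) ^ 2 =
      (T 0 0 * T 1 1 - T 0 1 * T 1 0) ^ 2 * dist (z : ℂ) w ^ 2 /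
        (Complex.normSq (denom T z) * Complex.normSq (denom T w)) := by
    have h1 : num T z / denom T z - num T w / denom T w =
        (T 0 0 * T 1 1 - T 0 1 * T 1 0 : ℝ) * ((z : ℂ) - w) / (denom T z * denom T w) := by
      rw [div_sub_div _ _ (denom_ne_zero T z) (denom_ne_zero T w)]
      congr 1
      simp only [num, denom]
      push_cast
      ring
    rw [Complex.dist_eq, coe_smul, coe_smul, ← map_sub, norm_σ, h1, norm_div, norm_mul, norm_mul,
      Complex.dist_eq, Complex.normSq_eq_norm_sq, Complex.normSq_eq_norm_sq, Complex.norm_real,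
      Real.norm_eq_abs, div_pow, mul_pow, sq_abs, mul_pow]
  have h2 : Real.cosh (dist (T • z) (T • w)) = Real.cosh (dist z w) := by
    have e : (T.det : ℝ) = T 0 0 * T 1 1 - T 0 1 * T 1 0 := by
      simp [Matrix.det_fin_two]
    rw [cosh_dist, cosh_dist, key, im_smul_eq_div_normSq, im_smul_eq_div_normSq, e]
    have := (normSq_denom_pos' T z).ne'
    have := (normSq_denom_pos' T w).ne'
    have := z.im_ne_zero
    have := w.im_ne_zero
    have := abs_ne_zero.2 hd
    rw [← sq_abs (T 0 0 * T 1 1 - T 0 1 * T 1 0)]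
    field_simp
  exact (Real.cosh_strictMonoOn.injOn) (dist_nonneg : (0:ℝ) ≤ _) (dist_nonneg : (0:ℝ) ≤ _) h2

theorem dist_smul_gl (T : GL (Fin 2) ℝ) (z w : ℍ) : dist (T • z) (T • w) = dist z w :=
  (isometry_smul_gl T).dist_eq z w

namespace Geodesic

@[simp] theorem smul_val (g : GL (Fin 2) ℝ) (γ : Geodesic) : (g • γ).1 = γ.1.map (g • ·) := rfl

instance : MulAction (GL (Fin 2) ℝ) Geodesic where
  one_smul γ := by
    apply Subtype.ext
    simp
  mul_smul g h γ := by
    apply Subtype.ext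
    simp only [smul_val, Sym2.map_map]
    congr 1
    ext x
    simp [mul_smul]

/-- The geodesic with given distinct endpoints. -/
def mk (x y : OnePoint ℝ) (h : x ≠ y) : Geodesic := ⟨s(x, y), by simpa using h⟩

theorem exists_eq_mk (γ : Geodesic) : ∃ x y h, γ = mk x y h := by
  obtain ⟨s, hs⟩ := γ
  induction s with
  | h x y => exact ⟨x, y, by simpa using hs, rfl⟩

theorem smul_mk (g : GL (Fin 2) ℝ) (x y : OnePoint ℝ) (h : x ≠ y) :
    g • mk x y h = mk (g • x) (g • y) (by simpa using h) := rfl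

theorem mk_comm (x y : OnePoint ℝ) (h : x ≠ y) : mk x y h = mk y x h.symm :=
  Subtype.ext Sym2.eq_swap

/-- The geodesic from `0` to `∞`. -/
def base : Geodesic := mk ((0 : ℝ) : OnePoint ℝ) OnePoint.infty (OnePoint.coe_ne_infty 0)

theorem mem_line_coe {a b : ℝ} {h} {z : ℍ} : z ∈ (mk (a : OnePoint ℝ) (b : OnePoint ℝ) h).line ↔
    (z.re - a) * (z.re - b) + z.im ^ 2 = 0 := by
  constructor
  · rintro (⟨c, d, hcd, hz⟩ | ⟨c, hc, hz⟩)
    · rcases Sym2.eq_iff.1 (show s((a : OnePoint ℝ), (b : OnePoint ℝ)) = _ from hcd)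
        with ⟨h1, h2⟩ | ⟨h1, h2⟩
      · rw [OnePoint.coe_eq_coe] at h1 h2
        rwa [h1, h2]
      · rw [OnePoint.coe_eq_coe] at h1 h2
        rw [h1, h2]; linarith
    · rcases Sym2.eq_iff.1 (show s((a : OnePoint ℝ), (b : OnePoint ℝ)) = _ from hc)
        with ⟨h1, h2⟩ | ⟨h1, h2⟩
      · exact absurd h2 (OnePoint.coe_ne_infty b)
      · exact absurd h1 (OnePoint.coe_ne_infty a)
  · exact fun hz => Or.inl ⟨a, b, rfl, hz⟩

theorem mem_line_infty {a : ℝ} {h} {z : ℍ} : z ∈ (mk (a : OnePoint ℝ) OnePoint.infty h).line ↔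
    z.re = a := by
  constructor
  · rintro (⟨c, d, hcd, hz⟩ | ⟨c, hc, hz⟩)
    · rcases Sym2.eq_iff.1 (show s((a : OnePoint ℝ), OnePoint.infty) = _ from hcd)
        with ⟨h1, h2⟩ | ⟨h1, h2⟩
      · exact absurd h2.symm (OnePoint.coe_ne_infty d)
      · exact absurd h2.symm (OnePoint.coe_ne_infty c)
    · rcases Sym2.eq_iff.1 (show s((a : OnePoint ℝ), OnePoint.infty) = _ from hc)
        with ⟨h1, h2⟩ | ⟨h1, h2⟩
      · rw [OnePoint.coe_eq_coe] at h1
        rwa [h1]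
      · exact absurd h1 (OnePoint.coe_ne_infty a)
  · exact fun hz => Or.inr ⟨a, rfl, hz⟩

theorem mem_line_base {z : ℍ} : z ∈ base.line ↔ z.re = 0 := mem_line_infty

theorem smul_coe_eq_zero {T : GL (Fin 2) ℝ} {a : ℝ}
    (h : T • (a : OnePoint ℝ) = ((0 : ℝ) : OnePoint ℝ)) : T 0 0 * a + T 0 1 = 0 := by
  rw [OnePoint.smul_some_eq_ite] at h
  split_ifs at h with h1
  · exact absurd h (OnePoint.infty_ne_coe _)
  · rw [OnePoint.coe_eq_coe, div_eq_zero_iff] at h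
    exact h.resolve_right h1

theorem smul_infty_eq_zero {T : GL (Fin 2) ℝ}
    (h : T • (OnePoint.infty : OnePoint ℝ) = ((0 : ℝ) : OnePoint ℝ)) : T 0 0 = 0 := by
  rw [OnePoint.smul_infty_eq_ite] at h
  split_ifs at h with h1
  · exact absurd h (OnePoint.infty_ne_coe _)
  · rw [OnePoint.coe_eq_coe, div_eq_zero_iff] at h
    exact h.resolve_right h1

theorem smul_coe_eq_infty {T : GL (Fin 2) ℝ} {a : ℝ}
    (h : T • (a : OnePoint ℝ) = OnePoint.infty) : T 1 0 * a + T 1 1 = 0 := by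
  rw [OnePoint.smul_some_eq_ite] at h
  split_ifs at h with h1
  · exact h1
  · exact absurd h (OnePoint.coe_ne_infty _)

theorem smul_infty_eq_infty {T : GL (Fin 2) ℝ}
    (h : T • (OnePoint.infty : OnePoint ℝ) = OnePoint.infty) : T 1 0 = 0 := by
  rw [OnePoint.smul_infty_eq_ite] at h
  split_ifs at h with h1
  · exact h1
  · exact absurd h (OnePoint.coe_ne_infty _)

/-- Sending the ends to `0` and `∞` makes the rows of `T` vanish there, so `aff T` is a multiple of
the equation of the line; the factor is nonzero because `det T` is. -/
theorem mem_line_mk_iff {T : GL (Fin 2) ℝ} {x y : OnePoint ℝ} {h : x ≠ y}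
    (hx : T • x = ((0 : ℝ) : OnePoint ℝ)) (hy : T • y = OnePoint.infty) {z : ℍ} :
    z ∈ (mk x y h).line ↔ (T • z).re = 0 := by
  have hd := det_ne_zero T
  rw [re_smul_eq_zero, aff, klein]
  induction x using OnePoint.rec with
  | infty =>
    have h1 := smul_infty_eq_zero hx
    induction y using OnePoint.rec with
    | infty => exact absurd rfl h
    | coe b =>
      have h2 := smul_coe_eq_infty hy
      rw [mk_comm, mem_line_infty]
      have h3 : T 1 1 = - (T 1 0 * b) := by linarith
      rw [h1, h3] at hd
      have h4 : T 0 1 * T 1 0 ≠ 0 := fun h => hd (by linear_combination -h)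
      rw [h1, h3]
      constructor
      · intro hz; rw [hz]; ring
      · intro hz
        have : T 0 1 * T 1 0 * (z.re - b) = 0 := by linear_combination hz
        linarith [(mul_eq_zero.1 this).resolve_left h4]
  | coe a =>
    have h1 := smul_coe_eq_zero hx
    have h1' : T 0 1 = -(T 0 0 * a) := by linarith
    induction y using OnePoint.rec with
    | infty =>
      have h2 := smul_infty_eq_infty hy
      rw [mem_line_infty]
      rw [h2] at hd
      have h4 : T 0 0 * T 1 1 ≠ 0 := fun h => hd (by linear_combination h)
      rw [h2, h1']
      constructor
      · intro hz; rw [hz]; ring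
      · intro hz
        have : T 0 0 * T 1 1 * (z.re - a) = 0 := by linear_combination hz
        linarith [(mul_eq_zero.1 this).resolve_left h4]
    | coe b =>
      have h2 := smul_coe_eq_infty hy
      have h3 : T 1 1 = - (T 1 0 * b) := by linarith
      rw [mem_line_coe]
      rw [h1', h3] at hd
      have h4 : T 0 0 * T 1 0 ≠ 0 := fun h => hd (by linear_combination (a - b) * h)
      rw [h1', h3]
      constructor
      · intro hz; linear_combination T 0 0 * T 1 0 * hz
      · intro hz
        have : T 0 0 * T 1 0 * ((z.re - a) * (z.re - b) + z.im ^ 2) = 0 := by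
          linear_combination hz
        exact (mul_eq_zero.1 this).resolve_left h4

theorem mem_line_iff {T : GL (Fin 2) ℝ} {γ : Geodesic} (h : T • γ = base) {z : ℍ} :
    z ∈ γ.line ↔ (T • z).re = 0 := by
  obtain ⟨x, y, hxy, rfl⟩ := γ.exists_eq_mk
  have h' := congrArg Subtype.val h
  rcases Sym2.eq_iff.1 (show s(T • x, T • y) = s(((0 : ℝ) : OnePoint ℝ), OnePoint.infty) from h')
    with ⟨h1, h2⟩ | ⟨h1, h2⟩
  · exact mem_line_mk_iff h1 h2
  · rw [mk_comm]
    exact mem_line_mk_iff h2 h1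

theorem exists_smul_mk (x y : OnePoint ℝ) (h : x ≠ y) :
    ∃ T : GL (Fin 2) ℝ, T • x = ((0 : ℝ) : OnePoint ℝ) ∧ T • y = OnePoint.infty := by
  induction x using OnePoint.rec with
  | infty =>
    induction y using OnePoint.rec with
    | infty => exact absurd rfl h
    | coe b =>
      refine ⟨mat 0 1 1 (-b) (by simp), ?_, ?_⟩
      · simp [OnePoint.smul_infty_eq_ite]
      · simp [OnePoint.smul_some_eq_ite]
  | coe a =>
    induction y using OnePoint.rec with
    | infty =>
      refine ⟨mat 1 (-a) 0 1 (by simp), ?_, ?_⟩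
      · simp [OnePoint.smul_some_eq_ite]
      · simp [OnePoint.smul_infty_eq_ite]
    | coe b =>
      have hab : a ≠ b := fun e => h (by rw [e])
      have h' : a - b ≠ 0 := sub_ne_zero.2 hab
      refine ⟨mat 1 (-a) 1 (-b) (by
        intro e; apply h'; linarith), ?_, ?_⟩
      · have : a + -b ≠ 0 := by rwa [← sub_eq_add_neg]
        simp [OnePoint.smul_some_eq_ite, this]
      · simp [OnePoint.smul_some_eq_ite]

theorem exists_smul_eq_base (γ : Geodesic) : ∃ T : GL (Fin 2) ℝ, T • γ = base := by
  obtain ⟨x, y, h, rfl⟩ := γ.exists_eq_mk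
  obtain ⟨T, h1, h2⟩ := exists_smul_mk x y h
  exact ⟨T, Subtype.ext (show s(T • x, T • y) = _ by rw [h1, h2]; rfl)⟩

theorem smul_mem_line {g : GL (Fin 2) ℝ} {γ : Geodesic} {z : ℍ} :
    g • z ∈ (g • γ).line ↔ z ∈ γ.line := by
  obtain ⟨T, hT⟩ := γ.exists_smul_eq_base
  rw [mem_line_iff hT, mem_line_iff (T := T * g⁻¹) (by simp [mul_smul, hT])]
  simp [mul_smul]

theorem mem_smul_line {g : GL (Fin 2) ℝ} {γ : Geodesic} {z : ℍ} :
    z ∈ (g • γ).line ↔ g⁻¹ • z ∈ γ.line := by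
  rw [← smul_mem_line (g := g) (z := g⁻¹ • z), smul_inv_smul]


theorem eq_base_of_line_subset {γ : Geodesic} (h : γ.line ⊆ base.line) : γ = base := by
  obtain ⟨x, y, hxy, rfl⟩ := γ.exists_eq_mk
  have key : ∀ a : ℝ, ∀ h' : (a : OnePoint ℝ) ≠ OnePoint.infty,
      (mk (a : OnePoint ℝ) OnePoint.infty h').line ⊆ base.line →
      mk (a : OnePoint ℝ) OnePoint.infty h' = base := by
    intro a h' h
    have := mem_line_base.1 (h (mem_line_infty.2 (show (⟨⟨a, 1⟩, one_pos⟩ : ℍ).re = a from rfl)))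
    change a = 0 at this
    subst this
    rfl
  induction x using OnePoint.rec with
  | infty =>
    induction y using OnePoint.rec with
    | infty => exact absurd rfl hxy
    | coe b =>
      rw [mk_comm] at h ⊢
      exact key b _ h
  | coe a =>
    induction y using OnePoint.rec with
    | infty => exact key a _ h
    | coe b =>
      have hab : b - a ≠ 0 := sub_ne_zero.2 fun e => hxy (by rw [e])
      -- Two test points of the half-circle, its top and the point a fifth of the way from `a` to
      -- `b`; they cannot both have real part `0`.
      have h1 := mem_line_base.1 (h (mem_line_coe.2 (show ((⟨⟨(a + b) / 2, |b - a| / 2⟩, by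
        positivity⟩ : ℍ).re - a) * ((⟨⟨(a + b) / 2, |b - a| / 2⟩, by positivity⟩ : ℍ).re - b) +
        (|b - a| / 2) ^ 2 = 0 by
          change ((a + b) / 2 - a) * ((a + b) / 2 - b) + (|b - a| / 2) ^ 2 = 0
          rw [div_pow, sq_abs]; ring)))
      have h2 := mem_line_base.1 (h (mem_line_coe.2 (show ((⟨⟨(4 * a + b) / 5, |b - a| * (2 / 5)⟩,
        by positivity⟩ : ℍ).re - a) * ((⟨⟨(4 * a + b) / 5, |b - a| * (2 / 5)⟩, by
        positivity⟩ : ℍ).re - b) + (|b - a| * (2 / 5)) ^ 2 = 0 by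
          change ((4 * a + b) / 5 - a) * ((4 * a + b) / 5 - b) + (|b - a| * (2 / 5)) ^ 2 = 0
          rw [mul_pow, sq_abs]; ring)))
      change (a + b) / 2 = 0 at h1
      change (4 * a + b) / 5 = 0 at h2
      exact absurd (by linarith) hab

theorem eq_of_line_subset {γ γ' : Geodesic} (h : γ.line ⊆ γ'.line) : γ = γ' := by
  obtain ⟨T, hT⟩ := γ'.exists_smul_eq_base
  have : T • γ = base := by
    apply eq_base_of_line_subset
    intro z hz
    rw [← hT]
    rw [mem_smul_line] at hz ⊢
    exact h hz
  rw [← hT] at this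
  exact MulAction.injective T this

end Geodesic

/-- The unit speed parametrization of the imaginary axis. -/
def pt (t : ℝ) : ℍ := ⟨⟨0, Real.exp t⟩, Real.exp_pos t⟩

@[simp] theorem pt_re (t : ℝ) : (pt t).re = 0 := rfl

@[simp] theorem pt_im (t : ℝ) : (pt t).im = Real.exp t := rfl

theorem exists_eq_pt {z : ℍ} (h : z.re = 0) : ∃ t, z = pt t :=
  ⟨Real.log z.im, UpperHalfPlane.ext (Complex.ext h (Real.exp_log z.im_pos).symm)⟩

theorem dist_pt (s t : ℝ) : dist (pt s) (pt t) = |s - t| := by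
  rw [dist_of_re_eq (by simp)]
  simp [Real.dist_eq]

theorem exists_smul_eq_pt (z w : ℍ) :
    ∃ (T : GL (Fin 2) ℝ) (s t : ℝ), T • z = pt s ∧ T • w = pt t := by
  suffices ∃ T : GL (Fin 2) ℝ, aff T (klein z) = 0 ∧ aff T (klein w) = 0 by
    obtain ⟨T, h1, h2⟩ := this
    obtain ⟨s, hs⟩ := exists_eq_pt (re_smul_eq_zero.2 h1)
    obtain ⟨t, ht⟩ := exists_eq_pt (re_smul_eq_zero.2 h2)
    exact ⟨T, s, t, hs, ht⟩
  by_cases h : z.re = w.re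
  · refine ⟨mat 1 (-z.re) 0 1 (by simp), ?_, ?_⟩
    · simp [aff, klein]
    · simp [aff, klein, h]
  · have h' : z.re - w.re ≠ 0 := sub_ne_zero.2 h
    -- `c` is the real point at equal Euclidean distance `r` from `z` and `w`; the matrix below
    -- sends `c - r` to `0` and `c + r` to `∞`.
    obtain ⟨c, hc⟩ : ∃ c : ℝ, 2 * c * (z.re - w.re) =
        (z.re ^ 2 + z.im ^ 2) - (w.re ^ 2 + w.im ^ 2) :=
      ⟨((z.re ^ 2 + z.im ^ 2) - (w.re ^ 2 + w.im ^ 2)) / (2 * (z.re - w.re)), by field_simp⟩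
    have hpos : 0 < (z.re - c) ^ 2 + z.im ^ 2 := by have := z.im_pos; positivity
    obtain ⟨r, hr, hr'⟩ : ∃ r : ℝ, 0 < r ∧ r ^ 2 = (z.re - c) ^ 2 + z.im ^ 2 :=
      ⟨_, Real.sqrt_pos.2 hpos, Real.sq_sqrt hpos.le⟩
    refine ⟨mat 1 (-(c - r)) 1 (-(c + r)) ?_, ?_, ?_⟩
    · intro e
      linarith
    · simp only [aff, klein, mat_00, mat_01, mat_10, mat_11]
      linear_combination -hr'
    · simp only [aff, klein, mat_00, mat_01, mat_10, mat_11]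
      linear_combination -hr' + hc

theorem eq_of_aff_segment (T : GL (Fin 2) ℝ) {z w p : ℍ}
    (hp : klein p ∈ segment ℝ (klein z) (klein w)) :
    ∃ a b : ℝ, 0 ≤ a ∧ 0 ≤ b ∧ a + b = 1 ∧
      aff T (klein p) = a * aff T (klein z) + b * aff T (klein w) := by
  obtain ⟨a, b, ha, hb, hab, h⟩ := hp
  exact ⟨a, b, ha, hb, hab, by rw [← h, aff_combo T _ _ hab]⟩

/-- Once `z` and `w` are moved to the imaginary axis, `p` lies there too, because `aff T` vanishes
at both ends. Betweenness follows since an affine function vanishing at `p` cannot have the same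
strict sign at both ends. -/
theorem dist_add_dist_of_mem_segment {z w p : ℍ}
    (hp : klein p ∈ segment ℝ (klein z) (klein w)) : dist z p + dist p w = dist z w := by
  obtain ⟨T, s, t, hs, ht⟩ := exists_smul_eq_pt z w
  obtain ⟨u, hu⟩ : ∃ u, T • p = pt u := by
    apply exists_eq_pt
    obtain ⟨a, b, -, -, -, h⟩ := eq_of_aff_segment T hp
    have h1 := re_smul_eq_zero.1 (show (T • z).re = 0 by rw [hs]; rfl)
    have h2 := re_smul_eq_zero.1 (show (T • w).re = 0 by rw [ht]; rfl)
    rw [re_smul_eq_zero, h, h1, h2]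
    ring
  have hmem : (s ≤ u ∧ u ≤ t) ∨ (t ≤ u ∧ u ≤ s) := by
    -- `U` cuts the plane along the geodesic through `pt u` perpendicular to the imaginary axis, so
    -- the sign of its affine function compares heights with `exp u`.
    set U : GL (Fin 2) ℝ := mat 1 (-Real.exp u) 1 (Real.exp u) (by
      have := Real.exp_pos u
      intro e
      linarith) with hU
    have key : ∀ v, aff U (klein (pt v)) = Real.exp v ^ 2 - Real.exp u ^ 2 := by
      intro v
      simp only [hU, aff, klein, mat_00, mat_01, mat_10, mat_11, pt_re, pt_im]
      ring
    have hpos : ∀ v, 0 < (U • pt v).re ↔ u < v := by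
      intro v
      rw [re_smul_pos, key, sub_pos, sq_lt_sq₀ (Real.exp_pos u).le (Real.exp_pos v).le,
        Real.exp_lt_exp]
    have hzero : (U • pt u).re = 0 := by
      rw [re_smul_eq_zero, key, sub_self]
    have hneg : ∀ v, (U • pt v).re < 0 ↔ v < u := by
      intro v
      rw [← not_le, re_smul_nonneg, key, sub_nonneg,
        sq_le_sq₀ (Real.exp_pos u).le (Real.exp_pos v).le, Real.exp_le_exp, not_le]
    rw [← hu, ← mul_smul, re_smul_eq_zero] at hzero
    obtain ⟨a, b, ha, hb, hab, h⟩ := eq_of_aff_segment (U * T) hp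
    have hs1 := hpos s
    have hs2 := hneg s
    have ht1 := hpos t
    have ht2 := hneg t
    rw [← hs, ← mul_smul, re_smul_pos] at hs1
    rw [← hs, ← mul_smul, ← not_le, re_smul_nonneg, not_le] at hs2
    rw [← ht, ← mul_smul, re_smul_pos] at ht1
    rw [← ht, ← mul_smul, ← not_le, re_smul_nonneg, not_le] at ht2
    rw [hzero] at h
    rcases lt_trichotomy s u with h1 | rfl | h1
    · rcases lt_or_ge t u with h2 | h2
      · exfalso
        have e1 := hs2.2 h1
        have e2 := ht2.2 h2
        rcases ha.eq_or_lt with rfl | ha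
        · nlinarith
        · nlinarith [mul_neg_of_pos_of_neg ha e1, mul_nonneg hb (neg_nonneg.2 e2.le)]
      · exact Or.inl ⟨h1.le, h2⟩
    · rcases le_total t s with h2 | h2
      · exact Or.inr ⟨h2, le_rfl⟩
      · exact Or.inl ⟨le_rfl, h2⟩
    · rcases lt_or_ge u t with h2 | h2
      · exfalso
        have e1 := hs1.2 h1
        have e2 := ht1.2 h2
        rcases ha.eq_or_lt with rfl | ha
        · nlinarith
        · nlinarith [mul_pos ha e1, mul_nonneg hb e2.le]
      · exact Or.inr ⟨h2, h1.le⟩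
  rw [← dist_smul_gl T z p, ← dist_smul_gl T p w, ← dist_smul_gl T z w, hs, ht, hu, dist_pt,
    dist_pt, dist_pt]
  rcases hmem with ⟨h1, h2⟩ | ⟨h1, h2⟩
  · rw [abs_of_nonpos (by linarith), abs_of_nonpos (by linarith), abs_of_nonpos (by linarith)]
    ring
  · rw [abs_of_nonneg (by linarith), abs_of_nonneg (by linarith), abs_of_nonneg (by linarith)]
    ring

/-- An orientation preserving isometry with two fixed points is trivial. -/
theorem smul_eq_self_of_fixes_two {g : GL (Fin 2) ℝ}
    (hg : 0 < (g : Matrix (Fin 2) (Fin 2) ℝ).det) {z w : ℍ} (hzw : z ≠ w) (hz : g • z = z)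
    (hw : g • w = w) : ∃ c : ℝ, c ≠ 0 ∧ (g : Matrix (Fin 2) (Fin 2) ℝ) = !![c, 0; 0, c] := by
  -- Real and imaginary parts of the fixed point equation `g₁₀ u² + (g₁₁ - g₀₀) u - g₀₁ = 0`, the
  -- latter divided by `u.im`.
  have key : ∀ u : ℍ, g • u = u → g 1 0 * (u.re ^ 2 - u.im ^ 2) + (g 1 1 - g 0 0) * u.re - g 0 1 = 0
      ∧ 2 * g 1 0 * u.re + (g 1 1 - g 0 0) = 0 := by
    intro u hu
    have h1 := congrArg (fun x : ℍ => (x : ℂ)) hu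
    simp only [coe_smul_of_det_pos (g := g) (by simpa using hg)] at h1
    rw [div_eq_iff (denom_ne_zero g u)] at h1
    have hre := congrArg Complex.re h1
    have him := congrArg Complex.im h1
    simp only [num, denom, Complex.add_re, Complex.mul_re, Complex.ofReal_re,
      Complex.ofReal_im, Complex.add_im, Complex.mul_im, zero_mul, sub_zero, add_zero,
      UpperHalfPlane.coe_re, UpperHalfPlane.coe_im] at hre him
    have h2 : 2 * g 1 0 * u.re + (g 1 1 - g 0 0) = 0 := by
      have : u.im * (2 * g 1 0 * u.re + (g 1 1 - g 0 0)) = 0 := by linear_combination -him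
      exact (mul_eq_zero.1 this).resolve_left u.im_ne_zero
    exact ⟨by linear_combination -hre, h2⟩
  obtain ⟨h1, h2⟩ := key z hz
  obtain ⟨h3, h4⟩ := key w hw
  have hc : g 1 0 = 0 := by
    by_contra hc
    have hre : z.re = w.re := by
      have : g 1 0 * (z.re - w.re) = 0 := by linear_combination (h2 - h4) / 2
      linarith [(mul_eq_zero.1 this).resolve_left hc]
    have him : z.im = w.im := by
      rw [hre] at h1
      have : g 1 0 * (z.im ^ 2 - w.im ^ 2) = 0 := by linear_combination h3 - h1
      have := (mul_eq_zero.1 this).resolve_left hc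
      exact (sq_eq_sq₀ z.im_pos.le w.im_pos.le).1 (by linarith)
    exact hzw (UpperHalfPlane.ext (Complex.ext hre him))
  have hd : g 1 1 = g 0 0 := by rw [hc] at h2; linarith
  have hb : g 0 1 = 0 := by rw [hc, hd] at h1; linarith
  have hdet := det_ne_zero g
  refine ⟨g 0 0, fun h => hdet (by rw [h, hc]; ring), ?_⟩
  ext i j
  fin_cases i <;> fin_cases j <;> simp [hc, hd, hb]

end GeodesicCurrents

end

/-! ### Topology of the space of geodesics -/

noncomputable section

namespace GeodesicCurrents

open UpperHalfPlane Filter Topology Set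

/-- The point of the projective line with homogeneous coordinates `v`. -/
def pr (v : ℝ × ℝ) : OnePoint ℝ := if v.2 = 0 then OnePoint.infty else ((v.1 / v.2 : ℝ) : OnePoint ℝ)

theorem tendsto_infty_of_abs {α : Type*} {l : Filter α} {f : α → OnePoint ℝ}
    (h : ∀ M : ℝ, ∀ᶠ a in l, ∀ x : ℝ, f a = x → M ≤ |x|) :
    Tendsto f l (𝓝 OnePoint.infty) := by
  intro s hs
  obtain ⟨hs1, t, -, ht, hts⟩ := OnePoint.tendsto_nhds_infty.1 tendsto_id s hs
  obtain ⟨M, hM⟩ := ht.isBounded.exists_norm_le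
  rw [mem_map]
  filter_upwards [h (M + 1)] with a ha
  change f a ∈ s
  cases hfa : f a with
  | infty => exact hs1
  | coe x =>
    refine hts fun hx => ?_
    have h1 := hM x hx
    have h2 := ha x hfa
    rw [Real.norm_eq_abs] at h1
    linarith

theorem eventually_nhds_infty (M : ℝ) :
    ∀ᶠ ξ : OnePoint ℝ in 𝓝 (OnePoint.infty : OnePoint ℝ), ∀ y : ℝ, ξ = y → M < |y| := by
  have h : IsOpen ((fun x : ℝ => (x : OnePoint ℝ)) '' Metric.closedBall 0 M)ᶜ :=
    OnePoint.isOpen_compl_image_coe.2 ⟨Metric.isClosed_closedBall, isCompact_closedBall 0 M⟩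
  filter_upwards [h.mem_nhds (OnePoint.infty_notMem_image_coe)] with ξ hξ y hy
  by_contra hM
  exact hξ ⟨y, by simpa using hM, hy.symm⟩

theorem eventually_nhds_coe {x : ℝ} {P : ℝ → Prop} (h : ∀ᶠ y in 𝓝 x, P y) :
    ∀ᶠ ξ : OnePoint ℝ in 𝓝 (x : OnePoint ℝ), ∃ y : ℝ, ξ = y ∧ P y := by
  rw [OnePoint.nhds_coe_eq, eventually_map]
  filter_upwards [h] with y hy using ⟨y, rfl, hy⟩

theorem continuousAt_pr {v : ℝ × ℝ} (hv : v ≠ 0) : ContinuousAt pr v := by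
  by_cases h : v.2 = 0
  · have h1 : v.1 ≠ 0 := fun h1 => hv (Prod.ext h1 h)
    rw [ContinuousAt, show pr v = OnePoint.infty by simp [pr, h]]
    apply tendsto_infty_of_abs
    intro M
    have hc : ContinuousAt (fun w : ℝ × ℝ => |w.1| - M * |w.2|) v := by fun_prop
    have hp : 0 < |v.1| - M * |v.2| := by simpa [h] using h1
    filter_upwards [hc.eventually_const_lt hp] with w hw x hx
    unfold pr at hx
    split_ifs at hx with h2
    · exact absurd hx (OnePoint.infty_ne_coe _)
    · rw [OnePoint.coe_eq_coe] at hx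
      rw [← hx, abs_div, le_div_iff₀ (abs_pos.2 h2)]
      linarith
  · have h1 : ContinuousAt (fun w : ℝ × ℝ => ((w.1 / w.2 : ℝ) : OnePoint ℝ)) v :=
      OnePoint.continuous_coe.continuousAt.comp (continuousAt_fst.div continuousAt_snd h)
    refine h1.congr ?_
    filter_upwards [continuousAt_snd.eventually_ne h] with w hw
    simp [pr, hw]

theorem pr_smul {c : ℝ} (hc : c ≠ 0) (v : ℝ × ℝ) : pr (c * v.1, c * v.2) = pr v := by
  simp [pr, hc, mul_div_mul_left]

theorem smul_coe_eq_pr (g : GL (Fin 2) ℝ) (x : ℝ) :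
    g • (x : OnePoint ℝ) = pr (g 0 0 * x + g 0 1, g 1 0 * x + g 1 1) :=
  OnePoint.smul_some_eq_ite

theorem smul_infty_eq_pr (g : GL (Fin 2) ℝ) :
    g • (OnePoint.infty : OnePoint ℝ) = pr (g 0 0, g 1 0) :=
  OnePoint.smul_infty_eq_ite g

/-- In homogeneous coordinates the action is linear, so everything reduces to continuity of `pr`
away from the origin. Near `∞` the coordinates `(x, 1)` are rescaled by `x⁻¹`. -/
theorem continuous_smul_onePoint (g : GL (Fin 2) ℝ) : Continuous (g • · : OnePoint ℝ → OnePoint ℝ) := by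
  have hd := det_ne_zero g
  rw [continuous_iff_continuousAt]
  intro ξ
  induction ξ using OnePoint.rec with
  | coe x =>
    rw [OnePoint.continuousAt_coe]
    have : ((g • · : OnePoint ℝ → OnePoint ℝ) ∘ OnePoint.some) =
        pr ∘ fun x : ℝ => (g 0 0 * x + g 0 1, g 1 0 * x + g 1 1) := by
      ext1 x
      exact smul_coe_eq_pr g x
    rw [this]
    refine ContinuousAt.comp (continuousAt_pr ?_) (by fun_prop)
    intro h
    simp only [Prod.mk_eq_zero] at h
    exact hd (by linear_combination g 0 0 * h.2 - g 1 0 * h.1)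
  | infty =>
    rw [OnePoint.continuousAt_infty', smul_infty_eq_pr, coclosedCompact_eq_cocompact,
      ← Metric.cobounded_eq_cocompact]
    have h1 : Tendsto (fun x : ℝ => pr (g 0 0 + g 0 1 * x⁻¹, g 1 0 + g 1 1 * x⁻¹))
        (Bornology.cobounded ℝ) (𝓝 (pr (g 0 0, g 1 0))) := by
      refine (continuousAt_pr ?_).tendsto.comp ?_
      · intro h
        simp only [Prod.mk_eq_zero] at h
        exact hd (by rw [h.1, h.2]; ring)
      · have := tendsto_inv₀_cobounded (α := ℝ)
        have h2 := (this.const_mul (g 0 1)).const_add (g 0 0)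
        have h3 := (this.const_mul (g 1 1)).const_add (g 1 0)
        simp only [mul_zero, add_zero] at h2 h3
        exact h2.prodMk_nhds h3
    refine h1.congr' ?_
    filter_upwards [Bornology.eventually_ne_cobounded (0 : ℝ)] with x hx
    change _ = g • (x : OnePoint ℝ)
    rw [smul_coe_eq_pr, ← pr_smul hx (_, _)]
    congr 2
    · field_simp
    · field_simp

instance : SecondCountableTopology (OnePoint ℝ) :=
  (onePointEquivSphereOfFinrankEq (ι := Fin 2) (V := ℝ) (by simp)).secondCountableTopology

section Sym2

variable {X : Type*} [TopologicalSpace X]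

/-- Openness: the saturation of an open set is its union with its image under the swap. -/
theorem isOpenQuotientMap_sym2_mk : IsOpenQuotientMap (fun p : X × X => s(p.1, p.2)) := by
  refine ⟨fun s => ?_, continuous_quot_mk, fun U hU => ?_⟩
  · induction s with
    | h x y => exact ⟨(x, y), rfl⟩
  · have hq : IsQuotientMap (fun p : X × X => s(p.1, p.2)) := isQuotientMap_quot_mk
    rw [← hq.isOpen_preimage]
    have : (fun p : X × X => s(p.1, p.2)) ⁻¹' ((fun p : X × X => s(p.1, p.2)) '' U) =
        U ∪ Prod.swap ⁻¹' U := by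
      ext ⟨a, b⟩
      simp only [mem_preimage, mem_image, Prod.exists, Sym2.eq_iff, mem_union, Prod.swap_prod_mk]
      constructor
      · rintro ⟨c, d, h, ⟨rfl, rfl⟩ | ⟨rfl, rfl⟩⟩
        exacts [Or.inl h, Or.inr h]
      · rintro (h | h)
        exacts [⟨a, b, h, Or.inl ⟨rfl, rfl⟩⟩, ⟨b, a, h, Or.inr ⟨rfl, rfl⟩⟩]
    rw [this]
    exact hU.union (hU.preimage continuous_swap)

instance [T2Space X] : T2Space (Sym2 X) := by
  rw [t2Space_iff_of_isOpenQuotientMap isOpenQuotientMap_sym2_mk]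
  have : {q : (X × X) × (X × X) | s(q.1.1, q.1.2) = s(q.2.1, q.2.2)} =
      {q | q.1 = q.2} ∪ {q | q.1 = q.2.swap} := by
    ext ⟨⟨a, b⟩, c, d⟩
    simp
  rw [this]
  exact (isClosed_eq continuous_fst continuous_snd).union
    (isClosed_eq continuous_fst (continuous_swap.comp continuous_snd))

instance [SecondCountableTopology X] : SecondCountableTopology (Sym2 X) :=
  isOpenQuotientMap_sym2_mk.isQuotientMap.secondCountableTopology isOpenQuotientMap_sym2_mk.isOpenMap

instance [CompactSpace X] : CompactSpace (Sym2 X) :=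
  isOpenQuotientMap_sym2_mk.surjective.compactSpace isOpenQuotientMap_sym2_mk.continuous

theorem isClosed_setOf_isDiag [CompactSpace X] [T2Space X] :
    IsClosed {s : Sym2 X | s.IsDiag} := by
  have : {s : Sym2 X | s.IsDiag} = range fun x : X => s(x, x) := by
    ext s
    induction s with
    | h a b =>
      simp only [Sym2.mk_isDiag_iff, Set.mem_ofPred_eq, mem_range, Sym2.eq_iff]
      constructor
      · rintro rfl; exact ⟨a, by simp⟩
      · rintro ⟨y, ⟨rfl, rfl⟩ | ⟨rfl, rfl⟩⟩ <;> rfl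
  rw [this]
  exact (isCompact_range (isOpenQuotientMap_sym2_mk.continuous.comp
    (continuous_id.prodMk continuous_id))).isClosed

theorem continuous_sym2_map {f : X → X} (hf : Continuous f) : Continuous (Sym2.map f) := by
  rw [← isOpenQuotientMap_sym2_mk.continuous_comp_iff]
  exact isOpenQuotientMap_sym2_mk.continuous.comp (hf.prodMap hf)

end Sym2

namespace Geodesic

instance : T2Space Geodesic :=
  inferInstanceAs (T2Space {s : Sym2 (OnePoint ℝ) // ¬ s.IsDiag})

instance : SecondCountableTopology Geodesic :=
  TopologicalSpace.Subtype.secondCountableTopology {s : Sym2 (OnePoint ℝ) | ¬ s.IsDiag}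

instance : LocallyCompactSpace Geodesic :=
  (isClosed_setOf_isDiag (X := OnePoint ℝ)).isOpen_compl.locallyCompactSpace

theorem continuous_val : Continuous (Subtype.val : Geodesic → Sym2 (OnePoint ℝ)) :=
  continuous_subtype_val

instance : ContinuousConstSMul (GL (Fin 2) ℝ) Geodesic :=
  ⟨fun g => Continuous.subtype_mk
    ((continuous_sym2_map (continuous_smul_onePoint g)).comp continuous_val) _⟩

/-- The inclusion of the space of geodesics into the unordered pairs of boundary points. -/
def ends (γ : Geodesic) : Sym2 (OnePoint ℝ) := γ.1

theorem nhds_mk {x y : OnePoint ℝ} (hxy : x ≠ y) : 𝓝 (mk x y hxy) = comap ends (𝓝 s(x, y)) :=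
  nhds_subtype_eq_comap

theorem tendsto_mk {α : Type*} {l : Filter α} {f g : α → OnePoint ℝ} {x y : OnePoint ℝ}
    (h : ∀ a, f a ≠ g a) (hxy : x ≠ y) (hf : Tendsto f l (𝓝 x)) (hg : Tendsto g l (𝓝 y)) :
    Tendsto (fun a => mk (f a) (g a) (h a)) l (𝓝 (mk x y hxy)) := by
  rw [nhds_mk,
    tendsto_comap_iff]
  exact (isOpenQuotientMap_sym2_mk.continuous.tendsto (x, y)).comp (hf.prodMk_nhds hg)

theorem eventually_nhds_mk {x y : OnePoint ℝ} (hxy : x ≠ y) {P : Geodesic → Prop}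
    (h : ∀ᶠ p : OnePoint ℝ × OnePoint ℝ in 𝓝 (x, y), ∀ hp : p.1 ≠ p.2, P (mk p.1 p.2 hp)) :
    ∀ᶠ γ in 𝓝 (mk x y hxy), P γ := by
  rw [nhds_mk,
    ← isOpenQuotientMap_sym2_mk.map_nhds_eq (x, y), eventually_comap, eventually_map]
  filter_upwards [h] with p hp γ hγ
  have hp12 : p.1 ≠ p.2 := by
    have := γ.2
    change γ.1 = s(p.1, p.2) at hγ
    rw [hγ, Sym2.mk_isDiag_iff] at this
    exact this
  convert hp hp12
  exact Subtype.ext hγ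

/-- A nearby geodesic has one end near `0` and the other near `∞`. Its equation changes sign on a
short horizontal segment through `pt t`, so the intermediate value theorem produces a point of
intersection. -/
theorem eventually_inter_ball_base (t : ℝ) {ρ : ℝ} (hρ : 0 < ρ) :
    ∀ᶠ γ in 𝓝 base, (line γ ∩ Metric.ball (pt t) ρ).Nonempty := by
  set r := Real.exp t with hr
  have hr0 : 0 < r := Real.exp_pos t
  let Z : ℝ → ℍ := fun s => ⟨⟨s * r, r⟩, hr0⟩
  have hZc : Continuous Z := by
    rw [UpperHalfPlane.isEmbedding_coe.continuous_iff]
    have : (UpperHalfPlane.coe ∘ Z) = fun s : ℝ => ((s * r : ℝ) : ℂ) + r * Complex.I := by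
      ext s
      exact Complex.mk_eq_add_mul_I _ _
    rw [this]
    fun_prop
  have hZ0 : Z 0 = pt t := UpperHalfPlane.ext (Complex.ext (by simp [Z, pt]) rfl)
  obtain ⟨δ, hδ, hZδ⟩ := Metric.continuousAt_iff.1 (hZc.continuousAt (x := 0)) ρ hρ
  set d := δ / 2 with hd
  have hd0 : 0 < d := half_pos hδ
  -- The equation at `Z s` of the geodesic with ends `p.1` and `1 / p.2`, divided by `-1 / p.2`; the
  -- value `p.2 = 0` then takes care of the end `∞`.
  let F : ℝ × ℝ → ℝ → ℝ := fun p s => s * r * (1 + p.2 * p.1) - p.1 - p.2 * (r ^ 2 * (1 + s ^ 2))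
  have hF1 : ∀ᶠ p in 𝓝 ((0 : ℝ), (0 : ℝ)), 0 < F p d := by
    have hc : Continuous fun p => F p d := by fun_prop
    exact hc.continuousAt.eventually_const_lt (by simp only [F]; simpa using mul_pos hd0 hr0)
  have hF2 : ∀ᶠ p in 𝓝 ((0 : ℝ), (0 : ℝ)), F p (-d) < 0 := by
    have hc : Continuous fun p => F p (-d) := by fun_prop
    exact hc.continuousAt.eventually_lt_const (by simp only [F]; simpa using mul_pos hd0 hr0)
  obtain ⟨η, hη, hball⟩ := Metric.eventually_nhds_iff.1 (hF1.and hF2)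
  apply eventually_nhds_mk
  rw [nhds_prod_eq]
  filter_upwards [(eventually_nhds_coe (Metric.ball_mem_nhds (0 : ℝ) hη)).prod_mk
    (eventually_nhds_infty η⁻¹)] with ⟨ξ, ζ⟩ ⟨⟨x, hx, hxη⟩, hζ⟩ hne
  simp only at hx hζ
  subst hx
  have hIVT : ∀ v : ℝ, |v| < η → ∃ s ∈ Icc (-d) d, F (x, v) s = 0 := by
    intro v hv
    obtain ⟨h1, h2⟩ := hball (y := (x, v)) (by
      rw [Prod.dist_eq]
      exact max_lt hxη (by simpa using hv))
    have hc : Continuous (F (x, v)) := by fun_prop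
    exact intermediate_value_Icc (by linarith) hc.continuousOn ⟨h2.le, h1.le⟩
  have hmem : ∀ s ∈ Icc (-d) d, Z s ∈ Metric.ball (pt t) ρ := by
    intro s hs
    rw [← hZ0]
    apply hZδ
    rw [Real.dist_eq, sub_zero, abs_lt]
    constructor <;> linarith [hs.1, hs.2]
  cases ζ with
  | infty =>
    obtain ⟨s, hs, hFs⟩ := hIVT 0 (by simpa using hη)
    refine ⟨Z s, mem_line_infty.2 ?_, hmem s hs⟩
    simp only [F] at hFs
    change s * r = x
    linarith
  | coe y =>
    have hy := hζ y rfl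
    have hy0 : y ≠ 0 := abs_pos.1 ((inv_pos.2 hη).trans hy)
    obtain ⟨s, hs, hFs⟩ := hIVT y⁻¹ (by
      rw [abs_inv]
      exact inv_lt_of_inv_lt₀ hη hy)
    refine ⟨Z s, mem_line_coe.2 ?_, hmem s hs⟩
    simp only [F] at hFs
    change (s * r - x) * (s * r - y) + r ^ 2 = 0
    field_simp at hFs
    linear_combination -hFs

/-- Translates neighbourhoods in the space of geodesics into balls of the plane; local finiteness of
families of geodesics is checked through it. -/
theorem eventually_inter_ball {γ : Geodesic} {z : ℍ} (hz : z ∈ γ.line) {ρ : ℝ} (hρ : 0 < ρ) :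
    ∀ᶠ γ' in 𝓝 γ, (line γ' ∩ Metric.ball z ρ).Nonempty := by
  obtain ⟨T, hT⟩ := γ.exists_smul_eq_base
  obtain ⟨t, ht⟩ := exists_eq_pt ((mem_line_iff hT).1 hz)
  have h := eventually_inter_ball_base t hρ
  rw [← hT] at h
  filter_upwards [((continuous_const_smul T).tendsto γ).eventually h] with γ' ⟨w, hw, hw'⟩
  refine ⟨T⁻¹ • w, mem_smul_line.1 hw, ?_⟩
  rw [Metric.mem_ball, ← dist_smul_gl T, smul_inv_smul, ht]
  exact hw'

theorem line_nonempty (γ : Geodesic) : γ.line.Nonempty := by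
  obtain ⟨T, hT⟩ := γ.exists_smul_eq_base
  exact ⟨T⁻¹ • pt 0, (mem_line_iff hT).2 (by simp)⟩

theorem exists_closedBall_of_isCompact {Q : Set Geodesic} (hQ : IsCompact Q) (z₀ : ℍ) :
    ∃ R, ∀ γ ∈ Q, (γ.line ∩ Metric.closedBall z₀ R).Nonempty := by
  refine hQ.induction_on (p := fun s => ∃ R, ∀ γ ∈ s, (γ.line ∩ Metric.closedBall z₀ R).Nonempty)
    ⟨0, by simp⟩ (fun s t hst ⟨R, hR⟩ => ⟨R, fun γ hγ => hR γ (hst hγ)⟩)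
    (fun s t ⟨R, hR⟩ ⟨R', hR'⟩ => ⟨max R R', fun γ hγ => ?_⟩) (fun γ hγ => ?_)
  · rcases hγ with hγ | hγ
    · exact (hR γ hγ).mono (inter_subset_inter_right _
        (Metric.closedBall_subset_closedBall (le_max_left _ _)))
    · exact (hR' γ hγ).mono (inter_subset_inter_right _
        (Metric.closedBall_subset_closedBall (le_max_right _ _)))
  · obtain ⟨z, hz⟩ := γ.line_nonempty
    refine ⟨_, mem_nhdsWithin_of_mem_nhds (eventually_inter_ball hz one_pos), dist z z₀ + 1, ?_⟩
    rintro γ' ⟨w, hw, hw'⟩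
    refine ⟨w, hw, ?_⟩
    rw [Metric.mem_closedBall]
    rw [Metric.mem_ball] at hw'
    linarith [dist_triangle w z z₀]

end Geodesic

end GeodesicCurrents

end

/-! ### Convexity of the universal cover and its boundary half-planes -/

noncomputable section

namespace GeodesicCurrents

open UpperHalfPlane Filter Topology Set

theorem sq_lt_klein (z : ℍ) : (klein z).1 ^ 2 < (klein z).2 := by
  have := z.im_pos
  simp only [klein]
  nlinarith

theorem klein_injective : Function.Injective klein := by
  intro z w h
  have h1 : z.re = w.re := congrArg Prod.fst h
  have h2 : z.re ^ 2 + z.im ^ 2 = w.re ^ 2 + w.im ^ 2 := congrArg Prod.snd h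
  rw [h1, add_right_inj, sq_eq_sq₀ z.im_pos.le w.im_pos.le] at h2
  exact UpperHalfPlane.ext (Complex.ext h1 h2)

theorem exists_klein_eq {p : ℝ × ℝ} (hp : p.1 ^ 2 < p.2) : ∃ z, klein z = p := by
  refine ⟨⟨⟨p.1, √(p.2 - p.1 ^ 2)⟩, Real.sqrt_pos.2 (by linarith)⟩, Prod.ext rfl ?_⟩
  change p.1 ^ 2 + √(p.2 - p.1 ^ 2) ^ 2 = p.2
  rw [Real.sq_sqrt (by linarith)]
  ring

theorem isOpen_paraboloid : IsOpen {p : ℝ × ℝ | p.1 ^ 2 < p.2} :=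
  isOpen_lt (by fun_prop) (by fun_prop)

theorem exists_klein_combo (z w : ℍ) {a b : ℝ} (ha : 0 ≤ a) (hb : 0 ≤ b) (hab : a + b = 1) :
    ∃ y, klein y = a • klein z + b • klein w := by
  apply exists_klein_eq
  have h1 := sq_lt_klein z
  have h2 := sq_lt_klein w
  obtain rfl : a = 1 - b := by linarith
  simp only [Prod.fst_add, Prod.snd_add, Prod.smul_fst, Prod.smul_snd, smul_eq_mul]
  rcases hb.eq_or_lt with rfl | hb'
  · simpa using h1
  · nlinarith [mul_pos hb' (sub_pos.2 h2), mul_nonneg ha (sub_pos.2 h1).le,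
      mul_nonneg (mul_nonneg ha hb) (sq_nonneg ((klein z).1 - (klein w).1))]

/-- The inverse formula `g` is continuous on the whole plane because `√` is `0` on negative numbers;
where its value has positive imaginary part, the argument is a point of the paraboloid. -/
theorem isOpenMap_klein : IsOpenMap klein := by
  refine IsOpenMap.of_nhds_le fun z U hU => ?_
  rw [mem_map] at hU
  let g : ℝ × ℝ → ℂ := fun p => (p.1 : ℂ) + (√(p.2 - p.1 ^ 2) : ℝ) * Complex.I
  have hg : Continuous g := by fun_prop
  have hgim : ∀ p, (g p).im = √(p.2 - p.1 ^ 2) := fun p => by simp [g]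
  have hgre : ∀ p, (g p).re = p.1 := fun p => by simp [g]
  have hgz : g (klein z) = z := by
    apply Complex.ext
    · rw [hgre]; rfl
    · rw [hgim, show (klein z).2 - (klein z).1 ^ 2 = z.im ^ 2 by simp [klein],
        Real.sqrt_sq z.im_pos.le]
      rfl
  have hU' : UpperHalfPlane.coe '' (klein ⁻¹' U) ∈ 𝓝 (g (klein z)) := by
    rw [hgz]
    exact UpperHalfPlane.isOpenEmbedding_coe.isOpenMap.image_mem_nhds hU
  filter_upwards [hg.continuousAt hU'] with p hp
  obtain ⟨w, hw, hwp⟩ := hp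
  have : klein w = p := by
    have h1 : w.re = p.1 := by rw [← hgre p, ← hwp]; rfl
    have h2 : w.im = √(p.2 - p.1 ^ 2) := by rw [← hgim p, ← hwp]; rfl
    have h3 : 0 < p.2 - p.1 ^ 2 := Real.sqrt_pos.1 (h2 ▸ w.im_pos)
    refine Prod.ext h1 ?_
    change w.re ^ 2 + w.im ^ 2 = p.2
    rw [h1, h2, Real.sq_sqrt h3.le]
    ring
  rw [← this]
  exact hw

theorem Geodesic.mem_line_iff_aff {T : GL (Fin 2) ℝ} {γ : Geodesic} (h : T • γ = base) {z : ℍ} :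
    z ∈ γ.line ↔ aff T (klein z) = 0 := by
  rw [mem_line_iff h, re_smul_eq_zero]

/-- A geodesic contained in a closed half-plane and touching its boundary is the boundary. -/
theorem Geodesic.eq_of_touches {T : GL (Fin 2) ℝ} {γ β : Geodesic} (hT : T • β = base)
    (hγ : ∀ z ∈ γ.line, 0 ≤ (T • z).re) {x : ℍ} (hx : x ∈ γ.line) (hxβ : x ∈ β.line) : γ = β := by
  obtain ⟨U, hU⟩ := γ.exists_smul_eq_base
  apply eq_of_line_subset
  intro z hz
  rw [mem_line_iff_aff hU] at hz hx
  rw [mem_line_iff_aff hT] at hxβ ⊢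
  -- The chord is prolonged slightly beyond `x`, away from `z`. An affine function vanishing at `x`
  -- and nonnegative on both sides of it vanishes at `z`.
  have hc : Continuous fun e : ℝ => (1 + e) • klein x + (-e) • klein z := by fun_prop
  have hev : ∀ᶠ e : ℝ in 𝓝[>] 0, (1 + e) • klein x + (-e) • klein z ∈ {p : ℝ × ℝ | p.1 ^ 2 < p.2} :=
    (hc.continuousAt.mono_left nhdsWithin_le_nhds).eventually
      (isOpen_paraboloid.mem_nhds (by simpa using sq_lt_klein x))
  obtain ⟨e, he, he0⟩ := (hev.and self_mem_nhdsWithin).exists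
  obtain ⟨w, hw⟩ := exists_klein_eq he
  have hsum : (1 + e) + (-e) = 1 := by ring
  have hwγ : w ∈ γ.line := by
    rw [mem_line_iff_aff hU, hw, aff_combo U _ _ hsum, hx, hz]
    ring
  have h1 := re_smul_nonneg.1 (hγ w hwγ)
  have h2 := re_smul_nonneg.1 (hγ z ((mem_line_iff_aff hU).2 hz))
  rw [hw, aff_combo T _ _ hsum, hxβ] at h1
  have he0' : 0 < e := he0
  nlinarith

/-- Reflection in the imaginary axis. -/
def axisRefl : GL (Fin 2) ℝ := mat (-1) 0 0 1 (by norm_num)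

theorem axisRefl_smul_base : axisRefl • Geodesic.base = Geodesic.base := by
  apply Subtype.ext
  change s(axisRefl • ((0 : ℝ) : OnePoint ℝ), axisRefl • OnePoint.infty) = _
  simp [axisRefl, OnePoint.smul_some_eq_ite, OnePoint.smul_infty_eq_ite, Geodesic.base,
    Geodesic.mk]

theorem axisRefl_smul_re (z : ℍ) : (axisRefl • z).re = -z.re := by
  rw [re_smul_eq]
  simp [aff, axisRefl, klein, denom]

theorem axisRefl_smul_of_re_eq_zero {z : ℍ} (hz : z.re = 0) : axisRefl • z = z := by
  refine UpperHalfPlane.ext (Complex.ext ?_ ?_)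
  · change (axisRefl • z).re = z.re
    rw [axisRefl_smul_re, hz, neg_zero]
  · change (axisRefl • z).im = z.im
    rw [im_smul_eq_div_normSq]
    simp [axisRefl, denom, coe_mat, Matrix.det_fin_two_of]

theorem axisRefl_mul_self : axisRefl * axisRefl = 1 := by
  ext i j
  fin_cases i <;> fin_cases j <;> simp [axisRefl, coe_mat, Matrix.mul_apply]

/-- The value at a boundary point of the affine function `aff T`. -/
def affBdry (T : GL (Fin 2) ℝ) : OnePoint ℝ → ℝ
  | OnePoint.infty => T 0 0 * T 1 0
  | OnePoint.some x => aff T (x, x ^ 2)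

/-- On a chord with real ends, `aff T` is a convex combination of its values at the ends. If one end
is `∞`, it is the value at the real end plus `z.im ^ 2` times the value at `∞`. -/
theorem aff_nonneg_of_mem_line {T : GL (Fin 2) ℝ} {x y : OnePoint ℝ} {hxy : x ≠ y}
    (hx : 0 ≤ affBdry T x) (hy : 0 ≤ affBdry T y) {z : ℍ} (hz : z ∈ (Geodesic.mk x y hxy).line) :
    0 ≤ aff T (klein z) := by
  have key : ∀ a : ℝ, ∀ ha, 0 ≤ affBdry T (a : OnePoint ℝ) → 0 ≤ affBdry T OnePoint.infty →
      z ∈ (Geodesic.mk (a : OnePoint ℝ) OnePoint.infty ha).line → 0 ≤ aff T (klein z) := by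
    intro a ha h1 h2 h3
    rw [Geodesic.mem_line_infty] at h3
    change 0 ≤ aff T (a, a ^ 2) at h1
    change 0 ≤ T 0 0 * T 1 0 at h2
    simp only [aff, klein] at h1 ⊢
    rw [h3]
    nlinarith [mul_nonneg h2 (sq_nonneg z.im)]
  cases x with
  | infty =>
    cases y with
    | infty => exact absurd rfl hxy
    | coe b =>
      rw [Geodesic.mk_comm] at hz
      exact key b _ hy hx hz
  | coe a =>
    cases y with
    | infty => exact key a _ hx hy hz
    | coe b =>
      rw [Geodesic.mem_line_coe] at hz
      change 0 ≤ aff T (a, a ^ 2) at hx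
      change 0 ≤ aff T (b, b ^ 2) at hy
      have hab : a ≠ b := fun e => hxy (by rw [e])
      have him := z.im_pos
      have hlt : (z.re - a) * (z.re - b) < 0 := by nlinarith
      have e1 : z.re ^ 2 + z.im ^ 2 = (a + b) * z.re - a * b := by linarith
      have key2 : (b - a) * aff T (klein z) =
          (b - z.re) * aff T (a, a ^ 2) + (z.re - a) * aff T (b, b ^ 2) := by
        simp only [aff, klein]
        rw [e1]
        ring
      rcases mul_neg_iff.1 hlt with ⟨h1, h2⟩ | ⟨h1, h2⟩
      · have h3 : 0 ≤ (b - a) * aff T (klein z) := by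
          rw [key2]
          exact add_nonneg (mul_nonneg (by linarith) hx) (mul_nonneg h1.le hy)
        exact nonneg_of_mul_nonneg_right h3 (by linarith)
      · have h3 : (b - a) * aff T (klein z) ≤ 0 := by
          rw [key2]
          exact add_nonpos (mul_nonpos_of_nonpos_of_nonneg (by linarith) hx)
            (mul_nonpos_of_nonpos_of_nonneg h1.le hy)
        by_contra h4
        nlinarith [mul_pos_of_neg_of_neg (show b - a < 0 by linarith) (not_le.1 h4)]

namespace HyperbolicStructure

variable {S : Type*} [TopologicalSpace S] (h : HyperbolicStructure S)

theorem convex_klein_image : Convex ℝ (klein '' h.cover) := by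
  rintro _ ⟨z, hz, rfl⟩ _ ⟨w, hw, rfl⟩ a b ha hb hab
  obtain ⟨y, hy⟩ := exists_klein_combo z w ha hb hab
  exact ⟨y, h.convex z hz w hw y (dist_add_dist_of_mem_segment ⟨a, b, ha, hb, hab, hy.symm⟩), hy⟩

theorem mem_interior_iff {z : ℍ} : z ∈ interior h.cover ↔ klein z ∈ interior (klein '' h.cover) := by
  rw [← mem_preimage, isOpenMap_klein.preimage_interior_eq_interior_preimage continuous_klein,
    klein_injective.preimage_image]

theorem mem_interior_of_combo {p q y : ℍ} (hp : p ∈ interior h.cover) (hq : q ∈ h.cover) {a b : ℝ}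
    (ha : 0 < a) (hb : 0 ≤ b) (hab : a + b = 1) (hy : klein y = a • klein p + b • klein q) :
    y ∈ interior h.cover := by
  rw [mem_interior_iff] at hp ⊢
  rw [hy]
  exact h.convex_klein_image.combo_interior_self_subset_interior ha hb hab
    (add_mem_add (smul_mem_smul_set hp) (smul_mem_smul_set ⟨q, hq, rfl⟩))

/-- The geodesics bounding the universal cover. -/
def bdry : Set Geodesic := {γ | γ.line ⊆ frontier h.cover}

theorem frontier_subset : frontier h.cover ⊆ h.cover := h.isClosed_cover.frontier_subset

variable {h}

theorem line_subset_of_mem_bdry {β : Geodesic} (hβ : β ∈ h.bdry) : β.line ⊆ h.cover :=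
  subset_trans hβ h.frontier_subset

theorem notMem_line_of_mem_interior {β : Geodesic} (hβ : β ∈ h.bdry) {z : ℍ}
    (hz : z ∈ interior h.cover) : z ∉ β.line := fun hz' =>
  disjoint_interior_frontier.le_bot ⟨hz, hβ hz'⟩

/-- If a point of the cover lay strictly across `β` from an interior point, the chord joining them
would meet `β` at an interior point, but `β` is contained in the frontier. -/
theorem exists_side {β : Geodesic} (hβ : β ∈ h.bdry) :
    ∃ T : GL (Fin 2) ℝ, T • β = Geodesic.base ∧ ∀ z ∈ h.cover, 0 ≤ (T • z).re := by
  obtain ⟨p, hp⟩ := h.interior_nonempty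
  obtain ⟨T, hT, hTp⟩ : ∃ T : GL (Fin 2) ℝ, T • β = Geodesic.base ∧ 0 < (T • p).re := by
    obtain ⟨T, hT⟩ := β.exists_smul_eq_base
    have hne : (T • p).re ≠ 0 := fun e =>
      notMem_line_of_mem_interior hβ hp ((Geodesic.mem_line_iff hT).2 e)
    rcases hne.lt_or_gt with h1 | h1
    · refine ⟨axisRefl * T, by rw [mul_smul, hT, axisRefl_smul_base], ?_⟩
      rw [mul_smul, axisRefl_smul_re]
      linarith
    · exact ⟨T, hT, h1⟩
  refine ⟨T, hT, fun w hw => ?_⟩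
  by_contra hneg
  rw [re_smul_nonneg, not_le] at hneg
  rw [re_smul_pos] at hTp
  set u := aff T (klein p)
  set v := aff T (klein w) with hv
  have huv : 0 < u - v := by linarith
  -- The weights at which an affine function with values `u` and `v` at the two ends vanishes.
  have ha : 0 < -v / (u - v) := div_pos (by linarith) huv
  have hb : 0 < u / (u - v) := div_pos hTp huv
  have hab : -v / (u - v) + u / (u - v) = 1 := by field_simp; ring
  obtain ⟨y, hy⟩ := exists_klein_combo p w ha.le hb.le hab
  refine notMem_line_of_mem_interior hβ (h.mem_interior_of_combo hp hw ha hb.le hab hy) ?_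
  rw [Geodesic.mem_line_iff_aff hT, hy, aff_combo T _ _ hab]
  change -v / (u - v) * u + u / (u - v) * v = 0
  field_simp
  ring

variable (h) in
/-- An isometry taking a boundary geodesic `β` to the imaginary axis and the universal cover
into the right half-plane. -/
def side (β : h.bdry) : GL (Fin 2) ℝ := (exists_side β.2).choose

theorem side_smul (β : h.bdry) : h.side β • β.1 = Geodesic.base := (exists_side β.2).choose_spec.1

theorem side_nonneg (β : h.bdry) {z : ℍ} (hz : z ∈ h.cover) : 0 ≤ (h.side β • z).re :=
  (exists_side β.2).choose_spec.2 z hz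

theorem mem_line_side (β : h.bdry) {z : ℍ} : z ∈ β.1.line ↔ (h.side β • z).re = 0 :=
  Geodesic.mem_line_iff (side_smul β)

theorem side_pos (β : h.bdry) {z : ℍ} (hz : z ∈ interior h.cover) : 0 < (h.side β • z).re :=
  (side_nonneg β (interior_subset hz)).lt_of_ne fun e =>
    notMem_line_of_mem_interior β.2 hz ((mem_line_side β).2 e.symm)

theorem eq_of_touches (β : h.bdry) {γ : Geodesic} (hγ : γ.line ⊆ h.cover) {x : ℍ}
    (hx : x ∈ γ.line) (hxβ : x ∈ β.1.line) : γ = β.1 :=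
  Geodesic.eq_of_touches (side_smul β) (fun _ hz => side_nonneg β (hγ hz)) hx hxβ

theorem bdry_eq_of_mem {β β' : h.bdry} {x : ℍ} (hx : x ∈ β.1.line) (hx' : x ∈ β'.1.line) :
    β = β' :=
  Subtype.ext (eq_of_touches β' (line_subset_of_mem_bdry β.2) hx hx')

/-- Near a boundary geodesic, the universal cover fills its side of the geodesic. -/
theorem eventually_mem_interior (β : h.bdry) {x : ℍ} (hx : x ∈ β.1.line) :
    ∀ᶠ y in 𝓝 x, 0 < (h.side β • y).re → y ∈ interior h.cover := by
  obtain ⟨p, hp⟩ := h.interior_nonempty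
  set T := h.side β
  have hTp := re_smul_pos.1 (side_pos β hp)
  rw [Geodesic.mem_line_iff_aff (side_smul β)] at hx
  -- With this `t`, the point `klein y` is the combination of `klein p` and `q y` with weights `t y`
  -- and `1 - t y`, and `q y` lies on the chord of `β`. Near `x` the weight `t y` is small, so `q y`
  -- stays inside the paraboloid.
  let t : ℍ → ℝ := fun y => aff T (klein y) / aff T (klein p)
  have ht : Continuous t := ((continuous_aff T).comp continuous_klein).div_const _
  have htx : t x = 0 := by simp only [t]; rw [hx, zero_div]
  let q : ℍ → ℝ × ℝ := fun y => (1 - t y)⁻¹ • klein y + (-t y * (1 - t y)⁻¹) • klein p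
  have hq : ContinuousAt q x := by
    have h1 : ContinuousAt (fun y => (1 - t y)⁻¹) x :=
      (continuousAt_const.sub ht.continuousAt).inv₀ (by simp [htx])
    exact (h1.smul continuous_klein.continuousAt).add
      ((ht.continuousAt.neg.mul h1).smul continuousAt_const)
  have hqx : q x = klein x := by simp [q, htx]
  filter_upwards [hq.eventually (isOpen_paraboloid.mem_nhds (hqx ▸ sq_lt_klein x)),
    ht.continuousAt.eventually_lt_const (show t x < 1 by rw [htx]; exact one_pos)]
    with y hy hty hpos
  rw [re_smul_pos] at hpos
  obtain ⟨w, hw⟩ := exists_klein_eq hy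
  have ht0 : 0 < t y := div_pos hpos hTp
  have h1t : 1 - t y ≠ 0 := by linarith
  have hsum : (1 - t y)⁻¹ + (-t y * (1 - t y)⁻¹) = 1 := by field_simp; ring
  have hwβ : w ∈ β.1.line := by
    rw [Geodesic.mem_line_iff_aff (side_smul β), hw]
    simp only [q]
    rw [aff_combo _ _ _ hsum]
    have : aff T (klein y) = t y * aff T (klein p) := (div_mul_cancel₀ _ hTp.ne').symm
    change (1 - t y)⁻¹ * aff T (klein y) + -t y * (1 - t y)⁻¹ * aff T (klein p) = 0
    rw [this]
    ring
  refine h.mem_interior_of_combo hp (line_subset_of_mem_bdry β.2 hwβ) ht0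
    (by linarith : 0 ≤ 1 - t y) (by ring) ?_
  rw [hw]
  simp only [q]
  rw [smul_add, smul_smul, smul_smul, mul_inv_cancel₀ h1t, one_smul, add_comm (klein y), ← add_assoc,
    ← add_smul, show t y + (1 - t y) * (-t y * (1 - t y)⁻¹) = 0 by field_simp; ring, zero_smul,
    zero_add]

/-- Distinct boundary geodesics bound disjoint half-planes. -/
theorem side_nonneg_of_side_nonpos {β₁ β₂ : h.bdry} (hne : β₁ ≠ β₂) {z : ℍ}
    (hz : (h.side β₂ • z).re ≤ 0) : 0 ≤ (h.side β₁ • z).re := by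
  obtain ⟨p, hp⟩ := h.interior_nonempty
  by_contra hneg
  rw [re_smul_nonneg, not_le] at hneg
  rw [← not_lt, re_smul_pos, not_lt] at hz
  have h1 := re_smul_pos.1 (side_pos β₁ hp)
  set T₁ := h.side β₁
  set T₂ := h.side β₂
  set u := aff T₁ (klein p)
  set v := aff T₁ (klein z)
  have huv : 0 < u - v := by linarith
  have ha : 0 < -v / (u - v) := div_pos (by linarith) huv
  have hb : 0 < u / (u - v) := div_pos h1 huv
  have hab : -v / (u - v) + u / (u - v) = 1 := by field_simp; ring
  -- The chord from `p` to `z` crosses `β₁` at `y`, and the part from `y` to `z` meets `β₂` at some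
  -- `w`. Then `w` lies in the cover and yet strictly beyond `β₁`.
  obtain ⟨y, hy⟩ := exists_klein_combo p z ha.le hb.le hab
  have hy1 : aff T₁ (klein y) = 0 := by
    rw [hy, aff_combo T₁ _ _ hab]
    change -v / (u - v) * u + u / (u - v) * v = 0
    field_simp
    ring
  have hyl : y ∈ β₁.1.line := (Geodesic.mem_line_iff_aff (side_smul β₁)).2 hy1
  have hy2 : 0 < aff T₂ (klein y) := by
    refine (re_smul_nonneg.1 (side_nonneg β₂ (line_subset_of_mem_bdry β₁.2 hyl))).lt_of_ne
      fun e => hne (bdry_eq_of_mem hyl ((Geodesic.mem_line_iff_aff (side_smul β₂)).2 e.symm))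
  set r := aff T₂ (klein y)
  set s := aff T₂ (klein z)
  have hrs : 0 < r - s := by linarith
  have hc : 0 ≤ -s / (r - s) := div_nonneg (by linarith) hrs.le
  have hd : 0 < r / (r - s) := div_pos hy2 hrs
  have hcd : -s / (r - s) + r / (r - s) = 1 := by field_simp; ring
  obtain ⟨w, hw⟩ := exists_klein_combo y z hc hd.le hcd
  have hw2 : w ∈ β₂.1.line := by
    rw [Geodesic.mem_line_iff_aff (side_smul β₂), hw, aff_combo _ _ _ hcd]
    change -s / (r - s) * r + r / (r - s) * s = 0
    field_simp
    ring
  have hw1 := re_smul_nonneg.1 (side_nonneg β₁ (line_subset_of_mem_bdry β₂.2 hw2))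
  rw [hw, aff_combo _ _ _ hcd] at hw1
  change 0 ≤ -s / (r - s) * aff T₁ (klein y) + r / (r - s) * v at hw1
  rw [hy1] at hw1
  nlinarith [mul_neg_of_pos_of_neg hd hneg]

/-- The universal cover is the intersection of the half-planes given by its boundary geodesics. -/
theorem exists_side_neg {z : ℍ} (hz : z ∉ h.cover) : ∃ β : h.bdry, (h.side β • z).re < 0 := by
  obtain ⟨p, hp⟩ := h.interior_nonempty
  -- By connectedness of the interval, the chord from the interior point `p` to `z` passes through a
  -- frontier point; the boundary geodesic there separates `z` from `p`.
  have hex : ∃ t ∈ Icc (0 : ℝ) 1, ∃ y ∈ frontier h.cover,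
      klein y = (1 - t) • klein p + t • klein z := by
    choose c hc using fun t : Icc (0 : ℝ) 1 =>
      exists_klein_combo p z (by linarith [t.2.2] : 0 ≤ 1 - (t : ℝ)) t.2.1 (by ring)
    have hcc : Continuous c := by
      rw [(IsOpenEmbedding.of_continuous_injective_isOpenMap continuous_klein klein_injective
        isOpenMap_klein).isInducing.continuous_iff]
      have : klein ∘ c = fun t : Icc (0 : ℝ) 1 => (1 - (t : ℝ)) • klein p + (t : ℝ) • klein z :=
        funext hc
      rw [this]
      fun_prop
    have hne : (frontier (c ⁻¹' h.cover)).Nonempty := by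
      rw [nonempty_frontier_iff]
      refine ⟨⟨0, ?_⟩, fun e => hz ?_⟩
      · have : c 0 = p := klein_injective (by rw [hc]; simp)
        rw [mem_preimage, this]
        exact interior_subset hp
      · have h1 : c 1 = z := klein_injective (by rw [hc]; simp)
        have h2 : (1 : Icc (0 : ℝ) 1) ∈ c ⁻¹' h.cover := e ▸ mem_univ _
        rwa [mem_preimage, h1] at h2
    obtain ⟨t, ht⟩ := hne
    exact ⟨t, t.2, c t, hcc.frontier_preimage_subset _ ht, hc t⟩
  obtain ⟨t, ht, y, hy, hyt⟩ := hex
  obtain ⟨γ, hyγ, hγ⟩ := h.frontier_geodesic y hy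
  refine ⟨⟨γ, hγ⟩, ?_⟩
  set β : h.bdry := ⟨γ, hγ⟩
  have h1 := re_smul_pos.1 (side_pos β hp)
  have h2 := (Geodesic.mem_line_iff_aff (side_smul β)).1 hyγ
  rw [hyt, aff_combo _ _ _ (by ring)] at h2
  have hne : aff (h.side β) (klein z) ≠ 0 := by
    intro e
    rw [e, mul_zero, add_zero] at h2
    have ht1 : t = 1 := by
      rcases mul_eq_zero.1 h2 with h3 | h3
      · linarith
      · exact absurd h3 h1.ne'
    rw [ht1, sub_self, zero_smul, zero_add, one_smul] at hyt
    rw [klein_injective hyt] at hy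
    exact hz (h.frontier_subset hy)
  rw [← not_le, re_smul_nonneg, not_le]
  refine lt_of_le_of_ne ?_ hne
  by_contra h3
  rw [not_le] at h3
  have h4 : 0 ≤ (1 - t) * aff (h.side β) (klein p) := mul_nonneg (by linarith [ht.2]) h1.le
  have h5 : 0 ≤ t * aff (h.side β) (klein z) := mul_nonneg ht.1 h3.le
  have h6 : t * aff (h.side β) (klein z) = 0 := by linarith
  have h7 : (1 - t) * aff (h.side β) (klein p) = 0 := by linarith
  have h8 := (mul_eq_zero.1 h6).resolve_right h3.ne'
  rw [h8] at h7
  linarith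

/-- A negative boundary value of `aff T` would persist in a neighbourhood, which contains points of
the cover. At `∞` the sign is that of the quadratic coefficient. -/
theorem affBdry_nonneg {T : GL (Fin 2) ℝ} (hT : ∀ z ∈ h.cover, 0 ≤ (T • z).re) {ξ : OnePoint ℝ}
    (hξ : ξ ∈ h.idealBoundary) : 0 ≤ affBdry T ξ := by
  have hξ' : ξ.map (fun x : ℝ => (x : ℂ)) ∈
    closure ((fun z : ℍ => ((z : ℂ) : OnePoint ℂ)) '' h.cover) := hξ
  by_contra hneg
  rw [not_le] at hneg
  let G : ℂ → ℝ := fun w => aff T (w.re, w.re ^ 2 + w.im ^ 2)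
  have hG : Continuous G := by unfold G aff; fun_prop
  have hGz : ∀ z ∈ h.cover, 0 ≤ G z := fun z hz => re_smul_nonneg.1 (hT z hz)
  cases ξ with
  | coe x =>
    change aff T (x, x ^ 2) < 0 at hneg
    have hopen : IsOpen ((fun w : ℂ => (w : OnePoint ℂ)) '' {w | G w < 0}) :=
      OnePoint.isOpenMap_coe _ (isOpen_lt hG continuous_const)
    obtain ⟨_, ⟨w, hw, rfl⟩, z, hz, hzw⟩ := mem_closure_iff.1 hξ' _ hopen
      ⟨(x : ℂ), by simpa [G] using hneg, rfl⟩
    rw [← OnePoint.coe_eq_coe.1 hzw] at hw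
    exact absurd (hGz z hz) (not_le.2 hw)
  | infty =>
    change T 0 0 * T 1 0 < 0 at hneg
    set c := T 0 0 * T 1 0
    set B := |T 0 0 * T 1 1 + T 0 1 * T 1 0| with hB
    set D := |T 0 1 * T 1 1| with hD
    -- Outside the disc of radius `M` the term `c * ‖z‖ ^ 2` outweighs the linear and constant
    -- terms.
    set M := max 1 ((B + D) / (-c))
    have hopen : IsOpen ((fun w : ℂ => (w : OnePoint ℂ)) '' Metric.closedBall 0 M)ᶜ :=
      OnePoint.isOpen_compl_image_coe.2 ⟨Metric.isClosed_closedBall, isCompact_closedBall 0 M⟩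
    obtain ⟨_, hw, z, hz, rfl⟩ := mem_closure_iff.1 hξ' _ hopen OnePoint.infty_notMem_image_coe
    have hnorm : M < ‖(z : ℂ)‖ := by
      by_contra hle
      exact hw ⟨z, by simpa using hle, rfl⟩
    have h1 : 1 < ‖(z : ℂ)‖ := (le_max_left _ _).trans_lt hnorm
    have h2 : (B + D) / (-c) < ‖(z : ℂ)‖ := (le_max_right _ _).trans_lt hnorm
    rw [div_lt_iff₀ (by linarith)] at h2
    have h3 : (z : ℂ).re ^ 2 + (z : ℂ).im ^ 2 = ‖(z : ℂ)‖ ^ 2 := by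
      rw [← Complex.normSq_eq_norm_sq, Complex.normSq_apply]; ring
    have h4 : (T 0 0 * T 1 1 + T 0 1 * T 1 0) * (z : ℂ).re ≤ B * ‖(z : ℂ)‖ := by
      refine (le_abs_self _).trans ?_
      rw [abs_mul]
      exact mul_le_mul_of_nonneg_left (Complex.abs_re_le_norm _) (abs_nonneg _)
    have h5 : T 0 1 * T 1 1 ≤ D * ‖(z : ℂ)‖ :=
      (le_abs_self _).trans (le_mul_of_one_le_right (abs_nonneg _) h1.le)
    have h6 := hGz z hz
    simp only [G, aff] at h6
    rw [h3] at h6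
    nlinarith

theorem isClosed_idealBoundary : IsClosed h.idealBoundary :=
  isClosed_closure.preimage (OnePoint.continuous_map Complex.continuous_ofReal (by
    rw [coclosedCompact_eq_cocompact, coclosedCompact_eq_cocompact]
    exact Complex.isometry_ofReal.isClosedEmbedding.tendsto_cocompact))

theorem left_mem_idealBoundary {x y : OnePoint ℝ} {hxy : x ≠ y}
    (hl : (Geodesic.mk x y hxy).line ⊆ h.cover) : x ∈ h.idealBoundary := by
  change x.map (fun x : ℝ => (x : ℂ)) ∈
    closure ((fun z : ℍ => ((z : ℂ) : OnePoint ℂ)) '' h.cover)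
  have key : ∀ (ξ : OnePoint ℂ) (l : Filter ℝ) [l.NeBot] (f : ℝ → ℂ),
      (∀ᶠ t in l, ∃ w : ℍ, (w : ℂ) = f t ∧ w ∈ (Geodesic.mk x y hxy).line) →
      Tendsto (fun t => (f t : OnePoint ℂ)) l (𝓝 ξ) →
      ξ ∈ closure ((fun z : ℍ => ((z : ℂ) : OnePoint ℂ)) '' h.cover) := by
    intro ξ l _ f h1 h2
    refine mem_closure_of_tendsto h2 ?_
    filter_upwards [h1] with t ⟨w, hw, hwl⟩
    exact ⟨w, hl hwl, by simp only [hw]⟩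
  cases x with
  | infty =>
    cases y with
    | infty => exact absurd rfl hxy
    | coe b =>
      refine key _ atTop (fun t => (b : ℂ) + t * Complex.I) ?_ ?_
      · filter_upwards [eventually_gt_atTop 0] with t ht
        refine ⟨⟨b + t * Complex.I, by simpa using ht⟩, rfl, ?_⟩
        rw [Geodesic.mk_comm, Geodesic.mem_line_infty]
        change ((b : ℂ) + t * Complex.I).re = b
        simp
      · have h1 : Tendsto (fun t : ℝ => (b : ℂ) + t * Complex.I) atTop (coclosedCompact ℂ) := by
          rw [coclosedCompact_eq_cocompact, ← Metric.cobounded_eq_cocompact,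
            ← tendsto_norm_atTop_iff_cobounded]
          refine tendsto_atTop_mono (fun t => ?_) tendsto_id
          refine le_trans ?_ (Complex.abs_im_le_norm _)
          simpa using le_abs_self t
        exact (OnePoint.tendsto_coe_infty (X := ℂ)).comp h1
  | coe a =>
    cases y with
    | infty =>
      refine key _ (𝓝[>] 0) (fun t => (a : ℂ) + t * Complex.I) ?_ ?_
      · filter_upwards [self_mem_nhdsWithin] with t ht
        refine ⟨⟨a + t * Complex.I, by simpa using ht⟩, rfl, ?_⟩
        rw [Geodesic.mem_line_infty]
        change ((a : ℂ) + t * Complex.I).re = a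
        simp
      · have hc : Continuous fun t : ℝ => (((a : ℂ) + t * Complex.I : ℂ) : OnePoint ℂ) :=
          OnePoint.continuous_coe.comp (by fun_prop)
        have := hc.tendsto 0
        simp only [Complex.ofReal_zero, zero_mul, add_zero] at this
        exact this.mono_left nhdsWithin_le_nhds
    | coe b =>
      have hab : b - a ≠ 0 := sub_ne_zero.2 fun e => hxy (by rw [e])
      -- The half-circle parametrized by the fraction `t` of its diameter, counted from `a`.
      let f : ℝ → ℂ := fun t => ((a + (b - a) * t : ℝ) : ℂ) +
        (|b - a| * √(t * (1 - t)) : ℝ) * Complex.I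
      have hre : ∀ t, (f t).re = a + (b - a) * t := fun t => by simp [f]
      have him : ∀ t, (f t).im = |b - a| * √(t * (1 - t)) := fun t => by simp [f]
      refine key _ (𝓝[>] 0) f ?_ ?_
      · filter_upwards [Ioo_mem_nhdsGT one_pos] with t ht
        have hpos : 0 < t * (1 - t) := mul_pos ht.1 (by linarith [ht.2])
        refine ⟨⟨f t, ?_⟩, rfl, ?_⟩
        · rw [him]
          have := Real.sqrt_pos.2 hpos
          positivity
        · rw [Geodesic.mem_line_coe]
          change ((f t).re - a) * ((f t).re - b) + (f t).im ^ 2 = 0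
          rw [hre, him, mul_pow, Real.sq_sqrt hpos.le, sq_abs]
          ring
      · have hc : Continuous fun t : ℝ => (f t : OnePoint ℂ) :=
          OnePoint.continuous_coe.comp (by fun_prop)
        have h1 := hc.tendsto 0
        have h0 : f 0 = a := by simp [f]
        rw [h0] at h1
        exact h1.mono_left nhdsWithin_le_nhds

/-- The cover is an intersection of half-planes, and a half-plane whose closure contains both ends
of a geodesic contains its line. From here on the ideal boundary can mostly be replaced by inclusion
of lines. -/
theorem mem_geodesicSet_iff {γ : Geodesic} : γ ∈ h.geodesicSet ↔ γ.line ⊆ h.cover := by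
  obtain ⟨x, y, hxy, rfl⟩ := γ.exists_eq_mk
  have hmem : ∀ ξ, ξ ∈ (Geodesic.mk x y hxy).1 ↔ ξ = x ∨ ξ = y := fun ξ => Sym2.mem_iff
  constructor
  · intro hγ z hz
    by_contra hzc
    obtain ⟨β, hβ⟩ := exists_side_neg hzc
    have hn : ∀ w ∈ h.cover, 0 ≤ (h.side β • w).re := fun w hw => side_nonneg β hw
    have h1 := affBdry_nonneg hn (hγ x ((hmem x).2 (Or.inl rfl)))
    have h2 := affBdry_nonneg hn (hγ y ((hmem y).2 (Or.inr rfl)))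
    exact absurd (re_smul_nonneg.2 (aff_nonneg_of_mem_line h1 h2 hz)) (not_le.2 hβ)
  · intro hl ξ hξ
    rcases (hmem ξ).1 hξ with rfl | rfl
    · exact left_mem_idealBoundary hl
    · rw [Geodesic.mk_comm] at hl
      exact left_mem_idealBoundary hl

end HyperbolicStructure

end GeodesicCurrents

end

/-! ### Cocompactness, discreteness and separation -/

noncomputable section

namespace GeodesicCurrents

open UpperHalfPlane Filter Topology Set

/-- `g` is a scalar matrix; these act trivially. -/
def IsTriv (g : GL (Fin 2) ℝ) : Prop :=
  ∃ c : ℝ, c ≠ 0 ∧ (g : Matrix (Fin 2) (Fin 2) ℝ) = !![c, 0; 0, c]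

theorem IsTriv.smul_onePoint {g : GL (Fin 2) ℝ} (hg : IsTriv g) (ξ : OnePoint ℝ) : g • ξ = ξ := by
  obtain ⟨c, hc, hg⟩ := hg
  cases ξ with
  | infty => simp [OnePoint.smul_infty_eq_ite, hg]
  | coe x => simp [OnePoint.smul_some_eq_ite, hg, hc]

theorem IsTriv.smul_geodesic {g : GL (Fin 2) ℝ} (hg : IsTriv g) (γ : Geodesic) : g • γ = γ := by
  obtain ⟨x, y, hxy, rfl⟩ := γ.exists_eq_mk
  apply Subtype.ext
  change s(g • x, g • y) = s(x, y)
  rw [hg.smul_onePoint, hg.smul_onePoint]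

theorem IsTriv.smul_upperHalfPlane {g : GL (Fin 2) ℝ} (hg : IsTriv g) (z : ℍ) : g • z = z := by
  obtain ⟨c, hc, hg⟩ := hg
  have hdet : 0 < (g : Matrix (Fin 2) (Fin 2) ℝ).det := by
    rw [hg, det_fin_two_of]
    have := mul_self_pos.2 hc
    linarith
  apply UpperHalfPlane.ext
  rw [coe_smul_of_det_pos (by simpa using hdet)]
  simp [num, denom, hg, hc]

theorem finite_of_separated {X : Type*} [PseudoMetricSpace X] [ProperSpace X] {A : Set X}
    (hA : Bornology.IsBounded A) {r : ℝ} (hr : 0 < r)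
    (hsep : ∀ a ∈ A, ∀ b ∈ A, dist a b < r → a = b) : A.Finite := by
  have htb : TotallyBounded A :=
    hA.isCompact_closure.totallyBounded.subset subset_closure
  obtain ⟨t, ht, hAt⟩ := Metric.totallyBounded_iff.1 htb (r / 2) (half_pos hr)
  have hex : ∀ a ∈ A, ∃ y ∈ t, dist a y < r / 2 := by
    intro a ha
    simpa using hAt ha
  choose! f hft hf using hex
  refine Set.Finite.of_finite_image (f := f) (ht.subset (image_subset_iff.2 hft)) ?_
  intro a ha b hb hab
  apply hsep a ha b hb
  have h1 := hf a ha
  have h2 := hf b hb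
  rw [← hab, dist_comm] at h2
  linarith [dist_triangle a (f a) b]

namespace HyperbolicStructure

variable {S : Type*} [TopologicalSpace S] {h : HyperbolicStructure S}

theorem smul_mem_cover {g : GL (Fin 2) ℝ} (hg : g ∈ h.deck) {z : ℍ} :
    g • z ∈ h.cover ↔ z ∈ h.cover := by
  refine ⟨fun hz => ?_, h.deck_smul_mem g hg z⟩
  simpa using h.deck_smul_mem g⁻¹ (inv_mem hg) _ hz

theorem smul_mem_frontier {g : GL (Fin 2) ℝ} (hg : g ∈ h.deck) {z : ℍ} :
    g • z ∈ frontier h.cover ↔ z ∈ frontier h.cover := by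
  have : (Homeomorph.smul g : ℍ ≃ₜ ℍ) ⁻¹' h.cover = h.cover := by
    ext w
    exact smul_mem_cover hg
  conv_rhs => rw [← this, ← Homeomorph.preimage_frontier]
  rfl

theorem smul_mem_bdry {g : GL (Fin 2) ℝ} (hg : g ∈ h.deck) {β : Geodesic} (hβ : β ∈ h.bdry) :
    g • β ∈ h.bdry := by
  intro z hz
  rw [Geodesic.mem_smul_line] at hz
  rw [← smul_mem_frontier (inv_mem hg)]
  exact hβ hz

theorem smul_line_subset {g : GL (Fin 2) ℝ} (hg : g ∈ h.deck) {γ : Geodesic}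
    (hγ : γ.line ⊆ h.cover) : (g • γ).line ⊆ h.cover := by
  intro z hz
  rw [Geodesic.mem_smul_line] at hz
  rw [← smul_mem_cover (inv_mem hg)]
  exact hγ hz

variable (h) in
-- The covering map is open, so the images of the balls about `z₀` form an increasing open cover of
-- `S`, and compactness leaves one ball.
theorem exists_dist_le [CompactSpace S] (z₀ : ℍ) :
    ∃ R, ∀ z ∈ h.cover, ∃ g ∈ h.deck, dist (g • z) z₀ ≤ R := by
  have hopen : ∀ n : ℕ, IsOpen (h.proj '' {z | dist (z : ℍ) z₀ < n}) := fun n =>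
    h.isCoveringMap_proj.isOpenMap _ (isOpen_lt (by fun_prop) continuous_const)
  have hdir : Directed (· ⊆ ·) fun n : ℕ => h.proj '' {z | dist (z : ℍ) z₀ < n} :=
    directed_of_isDirected_le fun m n hmn => image_mono fun z hz => by
      simp only [mem_ofPred_eq] at hz ⊢
      exact hz.trans_le (Nat.cast_le.2 hmn)
  obtain ⟨n, hn⟩ := isCompact_univ.elim_directed_cover _ hopen (fun s _ => by
    obtain ⟨z, rfl⟩ := h.surjective_proj s
    obtain ⟨n, hn⟩ := exists_nat_gt (dist (z : ℍ) z₀)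
    exact mem_iUnion.2 ⟨n, z, hn, rfl⟩) hdir
  refine ⟨n, fun z hz => ?_⟩
  obtain ⟨w, hw, hwz⟩ := hn (mem_univ (h.proj ⟨z, hz⟩))
  obtain ⟨g, hg, hgz⟩ := (h.proj_eq_iff ⟨z, hz⟩ w).1 hwz.symm
  exact ⟨g, hg, by rw [hgz]; exact le_of_lt hw⟩

/-- A local property of the universal cover, invariant under the deck group, is uniform. -/
theorem exists_uniform [CompactSpace S] (Q : ℍ → ℝ → Prop)
    (hmono : ∀ z δ δ', δ' ≤ δ → Q z δ → Q z δ')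
    (hinv : ∀ g ∈ h.deck, ∀ z δ, Q (g • z) δ → Q z δ)
    (hloc : ∀ x ∈ h.cover, ∃ δ > 0, ∀ z, dist z x < δ → Q z δ) :
    ∃ δ > 0, ∀ z ∈ h.cover, Q z δ := by
  obtain ⟨z₀, -⟩ := h.interior_nonempty
  obtain ⟨R, hR⟩ := h.exists_dist_le z₀
  have hK : IsCompact (Metric.closedBall z₀ R ∩ h.cover) :=
    (isCompact_closedBall z₀ R).inter_right h.isClosed_cover
  obtain ⟨δ, hδ, hQ⟩ : ∃ δ > 0, ∀ z ∈ Metric.closedBall z₀ R ∩ h.cover, Q z δ := by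
    refine hK.induction_on (p := fun s => ∃ δ > 0, ∀ z ∈ s, Q z δ) ⟨1, one_pos, by simp⟩
      (fun s t hst ⟨δ, hδ, ht⟩ => ⟨δ, hδ, fun z hz => ht z (hst hz)⟩)
      (fun s t ⟨δ, hδ, hs⟩ ⟨δ', hδ', ht⟩ => ⟨min δ δ', lt_min hδ hδ', fun z hz => ?_⟩)
      (fun x hx => ?_)
    · rcases hz with hz | hz
      · exact hmono z _ _ (min_le_left _ _) (hs z hz)
      · exact hmono z _ _ (min_le_right _ _) (ht z hz)
    · obtain ⟨δ, hδ, hQ⟩ := hloc x hx.2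
      exact ⟨Metric.ball x δ, mem_nhdsWithin_of_mem_nhds (Metric.ball_mem_nhds x hδ), δ, hδ, hQ⟩
  refine ⟨δ, hδ, fun z hz => ?_⟩
  obtain ⟨g, hg, hgz⟩ := hR z hz
  exact hinv g hg z δ (hQ _ ⟨hgz, h.deck_smul_mem g hg z hz⟩)

theorem mem_interior_or_exists_bdry {x : ℍ} (hx : x ∈ h.cover) :
    x ∈ interior h.cover ∨ ∃ β : h.bdry, x ∈ β.1.line := by
  by_cases hi : x ∈ interior h.cover
  · exact Or.inl hi
  · obtain ⟨γ, hxγ, hγ⟩ := h.frontier_geodesic x ⟨subset_closure hx, hi⟩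
    exact Or.inr ⟨⟨γ, hγ⟩, hxγ⟩

variable (h) in
/-- Distinct boundary geodesics of the universal cover are uniformly far apart. -/
theorem exists_separation [CompactSpace S] : ∃ ε > 0, ∀ β β' : h.bdry, ∀ z ∈ β.1.line,
    ∀ w ∈ β'.1.line, dist z w < ε → β = β' := by
  obtain ⟨ε, hε, hQ⟩ := exists_uniform (h := h)
    (fun z δ => ∀ β β' : h.bdry, z ∈ β.1.line → ∀ w ∈ β'.1.line, dist z w < δ → β = β')
    (fun z δ δ' hδ hQ β β' hz w hw hzw => hQ β β' hz w hw (hzw.trans_le hδ))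
    (fun g hg z δ hQ β β' hz w hw hzw => by
      have := hQ ⟨g • β.1, smul_mem_bdry hg β.2⟩ ⟨g • β'.1, smul_mem_bdry hg β'.2⟩
        (Geodesic.smul_mem_line.2 hz) (g • w) (Geodesic.smul_mem_line.2 hw)
        (by rwa [dist_smul_gl])
      exact Subtype.ext (MulAction.injective g (congrArg Subtype.val this)))
    (fun x hx => by
      rcases mem_interior_or_exists_bdry hx with hi | ⟨β₀, hβ₀⟩
      · obtain ⟨r, hr, hball⟩ := Metric.isOpen_iff.1 isOpen_interior x hi
        exact ⟨r, hr, fun z hz β β' hzβ => absurd hzβ (notMem_line_of_mem_interior β.2 (hball hz))⟩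
      · obtain ⟨r, hr, hball⟩ := Metric.eventually_nhds_iff.1 (eventually_mem_interior β₀ hβ₀)
        -- Near `x` the interior of the cover fills one side of `β₀` and the cover has no points on
        -- the other, so a boundary geodesic passing there meets `β₀`.
        have key : ∀ y, dist y x < r → ∀ β : h.bdry, y ∈ β.1.line → β = β₀ := by
          intro y hy β hyβ
          have h1 : ¬ 0 < (h.side β₀ • y).re := fun hp =>
            notMem_line_of_mem_interior β.2 (hball hy hp) hyβ
          have h2 := side_nonneg β₀ (line_subset_of_mem_bdry β.2 hyβ)
          exact bdry_eq_of_mem hyβ ((mem_line_side β₀).2 (le_antisymm (not_lt.1 h1) h2))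
        refine ⟨r / 2, half_pos hr, fun z hz β β' hzβ w hw hzw => ?_⟩
        rw [key z (by linarith) β hzβ, key w ?_ β' hw]
        rw [dist_comm] at hzw
        linarith [dist_triangle w z x])
  exact ⟨ε, hε, fun β β' z hz w hw hzw =>
    hQ z (line_subset_of_mem_bdry β.2 hz) β β' hz w hw hzw⟩

variable (h) in
-- Points chosen on distinct boundary geodesics are at least `ε` apart, and a bounded separated set
-- in a proper space is finite.
theorem finite_bdry_inter [CompactSpace S] (z₀ : ℍ) (R : ℝ) :
    {β ∈ h.bdry | (β.line ∩ Metric.closedBall z₀ R).Nonempty}.Finite := by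
  obtain ⟨ε, hε, hsep⟩ := h.exists_separation
  have hex : ∀ β ∈ {β ∈ h.bdry | (β.line ∩ Metric.closedBall z₀ R).Nonempty},
      ∃ z, z ∈ β.line ∧ z ∈ Metric.closedBall z₀ R := fun β hβ => hβ.2
  choose! f hf hfb using hex
  have key : ∀ β ∈ {β ∈ h.bdry | (β.line ∩ Metric.closedBall z₀ R).Nonempty},
      ∀ β' ∈ {β ∈ h.bdry | (β.line ∩ Metric.closedBall z₀ R).Nonempty},
      dist (f β) (f β') < ε → β = β' := fun β hβ β' hβ' hd =>
    congrArg Subtype.val (hsep ⟨β, hβ.1⟩ ⟨β', hβ'.1⟩ _ (hf β hβ) _ (hf β' hβ') hd)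
  refine Set.Finite.of_finite_image (f := f) (finite_of_separated
    (Metric.isBounded_closedBall.subset (image_subset_iff.2 hfb)) hε ?_) ?_
  · rintro _ ⟨β, hβ, rfl⟩ _ ⟨β', hβ', rfl⟩ hd
    rw [key β hβ β' hβ' hd]
  · intro β hβ β' hβ' he
    exact key β hβ β' hβ' (by rw [he, dist_self]; exact hε)

/-- The deck group acts freely and discretely. -/
theorem exists_forall_isTriv {z₀ : ℍ} (hz₀ : z₀ ∈ interior h.cover) :
    ∃ r > 0, ∀ g ∈ h.deck, dist (g • z₀) z₀ < r → IsTriv g := by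
  have hz₀c := interior_subset hz₀
  obtain ⟨U, hU, hzU, hinj⟩ :=
    h.isCoveringMap_proj.isLocalHomeomorph.isLocallyInjective ⟨z₀, hz₀c⟩
  obtain ⟨r, hr, hball⟩ : ∃ r > 0, ∀ z, dist z z₀ < r → ∃ hz : z ∈ h.cover, (⟨z, hz⟩ : h.cover) ∈ U := by
    obtain ⟨V, hV, hVU⟩ := isOpen_induced_iff.1 hU
    have hz₀V : z₀ ∈ V := by
      have : (⟨z₀, hz₀c⟩ : h.cover) ∈ Subtype.val ⁻¹' V := hVU ▸ hzU
      exact this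
    obtain ⟨r, hr, hb⟩ := Metric.isOpen_iff.1 (hV.inter isOpen_interior) z₀ ⟨hz₀V, hz₀⟩
    refine ⟨r, hr, fun z hz => ⟨interior_subset (hb hz).2, ?_⟩⟩
    rw [← hVU]
    exact (hb hz).1
  refine ⟨r, hr, fun g hg hgz => ?_⟩
  -- Where `proj` is injective, a point and its image under `g` that both lie there coincide.
  -- Applied to `z₀` and to a second nearby point, this gives two fixed points.
  have key : ∀ z, dist z z₀ < r → dist (g • z) z₀ < r → g • z = z := by
    intro z h1 h2
    obtain ⟨hz1, hzU1⟩ := hball z h1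
    obtain ⟨hz2, hzU2⟩ := hball _ h2
    have : h.proj ⟨z, hz1⟩ = h.proj ⟨g • z, hz2⟩ := (h.proj_eq_iff _ _).2 ⟨g, hg, rfl⟩
    exact (congrArg Subtype.val (hinj hzU1 hzU2 this)).symm
  have hfix := key z₀ (by simpa using hr) hgz
  obtain ⟨w, hw, hwr⟩ : ∃ w, w ≠ z₀ ∧ dist w z₀ < r := by
    obtain ⟨w, hre, him⟩ : ∃ w : ℍ, w.re = z₀.re ∧ w.im = z₀.im * Real.exp (r / 2) :=
      ⟨⟨⟨z₀.re, z₀.im * Real.exp (r / 2)⟩, by have := z₀.im_pos; positivity⟩, rfl, rfl⟩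
    have hd : dist w z₀ = r / 2 := by
      rw [dist_of_re_eq hre, him, Real.log_mul z₀.im_ne_zero (Real.exp_ne_zero _), Real.log_exp,
        Real.dist_eq, add_sub_cancel_left, abs_of_pos (half_pos hr)]
    refine ⟨w, fun e => ?_, by rw [hd]; exact half_lt_self hr⟩
    rw [e, dist_self] at hd
    linarith
  refine smul_eq_self_of_fixes_two (h.deck_det_pos g hg) hw (key w hwr ?_) hfix
  rw [← hfix, dist_smul_gl]
  exact hwr

/-- Up to scalars, finitely many deck transformations move `z₀` a bounded distance. -/
theorem exists_finite_deck {z₀ : ℍ} (hz₀ : z₀ ∈ interior h.cover) (R : ℝ) :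
    ∃ F : Set (GL (Fin 2) ℝ), F.Finite ∧ F ⊆ h.deck ∧
      ∀ g ∈ h.deck, dist (g • z₀) z₀ ≤ R → ∃ φ ∈ F, IsTriv (φ⁻¹ * g) := by
  obtain ⟨r, hr, htriv⟩ := exists_forall_isTriv hz₀
  set A : Set ℍ := {z | ∃ g ∈ h.deck, z = g • z₀ ∧ dist (g • z₀) z₀ ≤ R} with hA
  have key : ∀ g ∈ h.deck, ∀ g' ∈ h.deck, dist (g • z₀) (g' • z₀) < r → IsTriv (g'⁻¹ * g) := by
    intro g hg g' hg' hd
    apply htriv _ (mul_mem (inv_mem hg') hg)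
    rw [← dist_smul_gl g', mul_smul, smul_inv_smul]
    exact hd
  have hfin : A.Finite := by
    refine finite_of_separated ((Metric.isBounded_closedBall (x := z₀) (r := R)).subset ?_) hr ?_
    · rintro _ ⟨g, hg, rfl, hd⟩
      exact hd
    · rintro _ ⟨g, hg, rfl, hd⟩ _ ⟨g', hg', rfl, hd'⟩ hdd
      have := (key g hg g' hg' hdd).smul_upperHalfPlane z₀
      rw [mul_smul, inv_smul_eq_iff] at this
      exact this
  choose! f hf hf1 hf2 using fun z (hz : z ∈ A) => hz
  refine ⟨f '' A, hfin.image f, image_subset_iff.2 hf, fun g hg hd => ?_⟩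
  have hgA : g • z₀ ∈ A := ⟨g, hg, rfl, hd⟩
  refine ⟨_, mem_image_of_mem f hgA, key g hg _ (hf _ hgA) ?_⟩
  rw [← hf1 _ hgA, dist_self]
  exact hr

/-- The reflection in a boundary geodesic. -/
def refl (β : h.bdry) : GL (Fin 2) ℝ := (h.side β)⁻¹ * axisRefl * h.side β

theorem side_refl_smul (β : h.bdry) (z : ℍ) :
    (h.side β • refl β • z).re = -(h.side β • z).re := by
  rw [refl, mul_smul, mul_smul, smul_inv_smul, axisRefl_smul_re]

theorem refl_smul_of_mem_line (β : h.bdry) {z : ℍ} (hz : z ∈ β.1.line) : refl β • z = z := by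
  rw [refl, mul_smul, mul_smul, axisRefl_smul_of_re_eq_zero ((mem_line_side β).1 hz),
    inv_smul_smul]

theorem refl_mul_self (β : h.bdry) : refl β * refl β = 1 := by
  calc refl β * refl β = (h.side β)⁻¹ * (axisRefl * axisRefl) * h.side β := by
        simp only [refl]; group
    _ = 1 := by rw [axisRefl_mul_self]; group

theorem refl_smul_refl_smul (β : h.bdry) (z : ℍ) : refl β • refl β • z = z := by
  rw [← mul_smul, refl_mul_self, one_smul]

theorem refl_det_neg (β : h.bdry) : ((refl β : GL (Fin 2) ℝ) : Matrix (Fin 2) (Fin 2) ℝ).det < 0 := by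
  have h1 : (refl β).det = axisRefl.det := by
    rw [refl, map_mul, map_mul, map_inv]
    rw [mul_right_comm, inv_mul_cancel, one_mul]
  have h2 := congrArg Units.val h1
  simp only [GeneralLinearGroup.val_det_apply] at h2
  rw [h2, axisRefl, coe_mat, det_fin_two_of]
  norm_num

theorem mem_bdry_iff_mem_boundaryLifts {γ : h.Geod} : γ ∈ h.boundaryLifts ↔ γ.1 ∈ h.bdry := Iff.rfl

/-- A boundary geodesic as a geodesic of the universal cover. -/
def toGeod (β : h.bdry) : h.Geod := ⟨β.1, mem_geodesicSet_iff.2 (line_subset_of_mem_bdry β.2)⟩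

theorem refl_mem_doubleGroup (β : h.bdry) : refl β ∈ h.doubleGroup :=
  Subgroup.subset_closure (Or.inr ⟨refl_det_neg β, toGeod β, β.2,
    fun _ hz => refl_smul_of_mem_line β hz⟩)

theorem deck_le_doubleGroup : h.deck ≤ h.doubleGroup := fun _ hg =>
  Subgroup.subset_closure (Or.inl hg)

variable (h) in
/-- The translates of the universal cover of `S` under the double group cover the plane, and every
small ball is covered by two of them. -/
theorem exists_ball_subset_translates [CompactSpace S] : ∃ δ > 0, ∀ z : ℍ,
    ∃ g₁ ∈ h.doubleGroup, ∃ g₂ ∈ h.doubleGroup, ∀ w, dist w z < δ →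
      g₁ • w ∈ h.cover ∨ g₂ • w ∈ h.cover := by
  obtain ⟨δ, hδ, hQ⟩ := exists_uniform (h := h)
    (fun z δ => ∃ g₁ ∈ h.doubleGroup, ∃ g₂ ∈ h.doubleGroup, ∀ w, dist w z < δ →
      g₁ • w ∈ h.cover ∨ g₂ • w ∈ h.cover)
    (fun z δ δ' hδ ⟨g₁, h1, g₂, h2, hw⟩ => ⟨g₁, h1, g₂, h2, fun w hwz => hw w (hwz.trans_le hδ)⟩)
    (fun g hg z δ ⟨g₁, h1, g₂, h2, hw⟩ => ⟨g₁ * g, mul_mem h1 (deck_le_doubleGroup hg), g₂ * g,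
      mul_mem h2 (deck_le_doubleGroup hg), fun w hwz => by
        rw [mul_smul, mul_smul]
        exact hw (g • w) (by rwa [dist_smul_gl])⟩)
    (fun x hx => by
      rcases mem_interior_or_exists_bdry hx with hi | ⟨β₀, hβ₀⟩
      · obtain ⟨r, hr, hball⟩ := Metric.isOpen_iff.1 isOpen_interior x hi
        refine ⟨r / 2, half_pos hr, fun z hz => ⟨1, one_mem _, 1, one_mem _, fun w hw => ?_⟩⟩
        rw [one_smul]
        refine Or.inl (interior_subset (hball ?_))
        rw [Metric.mem_ball]
        linarith [dist_triangle w z x]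
      · obtain ⟨r, hr, hball⟩ := Metric.eventually_nhds_iff.1 (eventually_mem_interior β₀ hβ₀)
        refine ⟨r / 2, half_pos hr, fun z hz => ⟨1, one_mem _, refl β₀, refl_mem_doubleGroup β₀,
          fun w hw => ?_⟩⟩
        have hwx : dist w x < r := by linarith [dist_triangle w z x]
        rw [one_smul]
        -- A point beyond `β₀` is reflected into the interior of the cover, since `refl β₀` fixes
        -- `x` and so preserves the distance to `x`.
        rcases lt_trichotomy (h.side β₀ • w).re 0 with h1 | h1 | h1
        · refine Or.inr (interior_subset (hball ?_ ?_))
          · rw [← refl_smul_of_mem_line β₀ hβ₀, dist_smul_gl]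
            exact hwx
          · rw [side_refl_smul]
            linarith
        · exact Or.inl (line_subset_of_mem_bdry β₀.2 ((mem_line_side β₀).2 h1))
        · exact Or.inl (interior_subset (hball hwx h1)))
  set U : Set ℍ := {z | ∃ g ∈ h.doubleGroup, g • z ∈ h.cover} with hU
  have hball : ∀ z ∈ U, ∃ g₁ ∈ h.doubleGroup, ∃ g₂ ∈ h.doubleGroup, ∀ w, dist w z < δ →
      g₁ • w ∈ h.cover ∨ g₂ • w ∈ h.cover := by
    rintro z ⟨g, hg, hgz⟩
    obtain ⟨g₁, h1, g₂, h2, hw⟩ := hQ _ hgz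
    refine ⟨g₁ * g, mul_mem h1 hg, g₂ * g, mul_mem h2 hg, fun w hwz => ?_⟩
    rw [mul_smul, mul_smul]
    exact hw (g • w) (by rwa [dist_smul_gl])
  have hball' : ∀ z ∈ U, ∀ w, dist w z < δ → w ∈ U := by
    intro z hz w hwz
    obtain ⟨g₁, h1, g₂, h2, hw⟩ := hball z hz
    rcases hw w hwz with hw | hw
    exacts [⟨g₁, h1, hw⟩, ⟨g₂, h2, hw⟩]
  -- The same `δ` serves at every point of `U`, so both `U` and its complement are open.
  have hclopen : IsClopen U := by
    refine ⟨⟨?_⟩, ?_⟩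
    · refine Metric.isOpen_iff.2 fun z hz => ⟨δ, hδ, fun w hw hwU => hz (hball' w hwU z ?_)⟩
      rwa [dist_comm]
    · exact Metric.isOpen_iff.2 fun z hz => ⟨δ, hδ, fun w hw => hball' z hz w hw⟩
  have huniv : U = univ := by
    obtain ⟨p, hp⟩ := h.interior_nonempty
    exact hclopen.eq_univ ⟨p, 1, one_mem _, by rw [one_smul]; exact interior_subset hp⟩
  exact ⟨δ, hδ, fun z => hball z (huniv ▸ mem_univ z)⟩

end HyperbolicStructure

end GeodesicCurrents

end

/-! ### Reduced words in the double group -/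

noncomputable section

namespace GeodesicCurrents

open UpperHalfPlane Filter Topology Set

/-- Different matrices may act alike on the plane, and a geodesic is determined by its line; hence
words only need to be compared through their action on points. -/
theorem Geodesic.smul_eq_smul_of_forall {g g' : GL (Fin 2) ℝ} (hgg' : ∀ z : ℍ, g • z = g' • z)
    (γ : Geodesic) : g • γ = g' • γ := by
  apply eq_of_line_subset
  intro z hz
  rw [mem_smul_line] at hz
  rw [← smul_inv_smul g z, hgg', smul_mem_line]
  exact hz

namespace HyperbolicStructure

variable {S : Type*} [TopologicalSpace S] {h : HyperbolicStructure S}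

theorem exists_two_mem_line (γ : Geodesic) : ∃ z ∈ γ.line, ∃ w ∈ γ.line, z ≠ w := by
  obtain ⟨T, hT⟩ := γ.exists_smul_eq_base
  refine ⟨T⁻¹ • pt 0, (Geodesic.mem_line_iff hT).2 (by simp), T⁻¹ • pt 1,
    (Geodesic.mem_line_iff hT).2 (by simp), fun e => ?_⟩
  have h1 := dist_pt 0 1
  rw [MulAction.injective _ e, dist_self] at h1
  norm_num at h1

/-- The product `refl β * r` preserves orientation and fixes `β` pointwise, so it is scalar. -/
theorem smul_eq_refl_smul {r : GL (Fin 2) ℝ} (hr : (r : Matrix (Fin 2) (Fin 2) ℝ).det < 0)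
    (β : h.bdry) (hfix : ∀ z ∈ β.1.line, r • z = z) (z : ℍ) : r • z = refl β • z := by
  obtain ⟨u, hu, v, hv, huv⟩ := exists_two_mem_line β.1
  have hdet : 0 < ((refl β * r : GL (Fin 2) ℝ) : Matrix (Fin 2) (Fin 2) ℝ).det := by
    rw [Units.val_mul, det_mul]
    exact mul_pos_of_neg_of_neg (refl_det_neg β) hr
  have key : ∀ w ∈ β.1.line, (refl β * r) • w = w := fun w hw => by
    rw [mul_smul, hfix w hw, refl_smul_of_mem_line β hw]
  have htriv : IsTriv (refl β * r) := smul_eq_self_of_fixes_two hdet huv (key u hu) (key v hv)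
  have := htriv.smul_upperHalfPlane z
  rw [mul_smul] at this
  rw [← refl_smul_refl_smul β (r • z), this]

theorem refl_smul_self (β : h.bdry) : refl β • β.1 = β.1 := by
  apply Geodesic.eq_of_line_subset
  intro z hz
  rw [Geodesic.mem_smul_line] at hz
  have := refl_smul_of_mem_line β hz
  rw [smul_inv_smul] at this
  rwa [← this] at hz

/-- The action of the deck group on the boundary geodesics. -/
def smulBdry {g : GL (Fin 2) ℝ} (hg : g ∈ h.deck) (β : h.bdry) : h.bdry :=
  ⟨g • β.1, smul_mem_bdry hg β.2⟩

theorem smulBdry_injective {g : GL (Fin 2) ℝ} (hg : g ∈ h.deck) :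
    Function.Injective (smulBdry hg) := fun _ _ he =>
  Subtype.ext (MulAction.injective g (congrArg Subtype.val he))

/-- The conjugate of `refl β` by `g` reverses orientation and fixes `g • β` pointwise, which
characterizes the reflection in `g • β`. -/
theorem smul_refl_smul {g : GL (Fin 2) ℝ} (hg : g ∈ h.deck) (β : h.bdry) (z : ℍ) :
    g • refl β • z = refl (smulBdry hg β) • g • z := by
  have hdet : ((g * refl β * g⁻¹ : GL (Fin 2) ℝ) : Matrix (Fin 2) (Fin 2) ℝ).det < 0 := by
    have : (g * refl β * g⁻¹).det = (refl β).det := by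
      rw [map_mul, map_mul, map_inv, mul_right_comm, mul_inv_cancel, one_mul]
    have h2 := congrArg Units.val this
    simp only [GeneralLinearGroup.val_det_apply] at h2
    rw [h2]
    exact refl_det_neg β
  rw [← smul_eq_refl_smul hdet (smulBdry hg β), mul_smul, mul_smul, inv_smul_smul]
  intro w hw
  rw [mul_smul, mul_smul, refl_smul_of_mem_line β (Geodesic.mem_smul_line.1 hw), smul_inv_smul]

/-- The product of the reflections in a list of boundary geodesics. -/
def word (w : List h.bdry) : GL (Fin 2) ℝ := (w.map refl).prod

theorem word_cons (β : h.bdry) (w : List h.bdry) : word (β :: w) = refl β * word w := by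
  simp [word]

theorem smul_word_smul {g : GL (Fin 2) ℝ} (hg : g ∈ h.deck) (w : List h.bdry) (z : ℍ) :
    g • word w • z = word (w.map (smulBdry hg)) • g • z := by
  induction w with
  | nil => simp [word]
  | cons β w ih =>
    rw [word_cons, mul_smul, smul_refl_smul hg, ih, List.map_cons, word_cons, mul_smul]

/-- Every element of the double group acts as a reduced word in the reflections times a deck
transformation. -/
theorem exists_word {g : GL (Fin 2) ℝ} (hg : g ∈ h.doubleGroup) :
    ∃ w : List h.bdry, w.IsChain (· ≠ ·) ∧ ∃ d ∈ h.deck, ∀ z : ℍ, g • z = word w • d • z := by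
  -- A deck transformation moves past a word by relabelling its letters; the relabelling is
  -- injective, so the word stays reduced.
  have hdeck : ∀ x ∈ h.deck, ∀ y : GL (Fin 2) ℝ,
      (∃ w : List h.bdry, w.IsChain (· ≠ ·) ∧ ∃ d ∈ h.deck, ∀ z : ℍ, y • z = word w • d • z) →
      ∃ w : List h.bdry, w.IsChain (· ≠ ·) ∧ ∃ d ∈ h.deck, ∀ z : ℍ,
        (x * y) • z = word w • d • z := by
    rintro x hx y ⟨w, hw, d, hd, hy⟩
    refine ⟨w.map (smulBdry hx), ?_, x * d, mul_mem hx hd, fun z => ?_⟩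
    · rw [List.isChain_map]
      exact hw.imp fun a b hab e => hab (smulBdry_injective hx e)
    · rw [mul_smul, hy, smul_word_smul hx, mul_smul]
  -- A reflection either cancels the first letter or is prepended to the word.
  have hrefl : ∀ (x : GL (Fin 2) ℝ) (β : h.bdry), (∀ z : ℍ, x • z = refl β • z) →
      ∀ y : GL (Fin 2) ℝ,
      (∃ w : List h.bdry, w.IsChain (· ≠ ·) ∧ ∃ d ∈ h.deck, ∀ z : ℍ, y • z = word w • d • z) →
      ∃ w : List h.bdry, w.IsChain (· ≠ ·) ∧ ∃ d ∈ h.deck, ∀ z : ℍ,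
        (x * y) • z = word w • d • z := by
    rintro x β hx y ⟨w, hw, d, hd, hy⟩
    cases w with
    | nil =>
      refine ⟨[β], List.isChain_singleton β, d, hd, fun z => ?_⟩
      rw [mul_smul, hx, hy, word_cons, mul_smul]
    | cons β' w =>
      by_cases hββ' : β = β'
      · subst hββ'
        refine ⟨w, hw.tail, d, hd, fun z => ?_⟩
        rw [mul_smul, hx, hy, word_cons, mul_smul, refl_smul_refl_smul]
      · refine ⟨β :: β' :: w, List.isChain_cons_cons.2 ⟨hββ', hw⟩, d, hd, fun z => ?_⟩
        rw [mul_smul, hx, hy, word_cons β, mul_smul]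
  have hgen : ∀ x ∈ ((h.deck : Set (GL (Fin 2) ℝ)) ∪
      {r | (r : Matrix (Fin 2) (Fin 2) ℝ).det < 0 ∧
        ∃ β ∈ h.boundaryLifts, ∀ z ∈ β.1.line, r • z = z}),
      x ∈ h.deck ∨ ∃ β : h.bdry, ∀ z : ℍ, x • z = refl β • z := by
    rintro x (hx | ⟨hdet, β, hβ, hfix⟩)
    · exact Or.inl hx
    · exact Or.inr ⟨⟨β.1, hβ⟩, smul_eq_refl_smul hdet ⟨β.1, hβ⟩ hfix⟩
  induction hg using Subgroup.closure_induction_left with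
  | one => exact ⟨[], List.isChain_nil, 1, one_mem _, fun z => by simp [word]⟩
  | mul_left x hx y hy ih =>
    rcases hgen x hx with hx | ⟨β, hβ⟩
    · exact hdeck x hx y ih
    · exact hrefl x β hβ y ih
  | inv_mul_cancel x hx y hy ih =>
    rcases hgen x hx with hx | ⟨β, hβ⟩
    · exact hdeck x⁻¹ (inv_mem hx) y ih
    · refine hrefl x⁻¹ β (fun z => ?_) y ih
      rw [inv_smul_eq_iff, hβ, refl_smul_refl_smul]

/-- A nonempty reduced word moves the universal cover across its first reflection axis. -/
theorem side_word_smul_nonpos {β : h.bdry} {w : List h.bdry} (hw : (β :: w).IsChain (· ≠ ·)) {z : ℍ}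
    (hz : z ∈ h.cover) : (h.side β • word (β :: w) • z).re ≤ 0 := by
  induction w generalizing β with
  | nil =>
    rw [word_cons, mul_smul, side_refl_smul]
    simpa [word] using side_nonneg β hz
  | cons β' w ih =>
    rw [word_cons, mul_smul, side_refl_smul, neg_nonpos]
    rw [List.isChain_cons_cons] at hw
    -- By induction the shorter word lands beyond `β'`, hence on the cover's side of `β`; the
    -- reflection in `β` then carries it across.
    exact side_nonneg_of_side_nonpos hw.1 (ih hw.2)

theorem side_nonpos_of_mem_line {β : h.bdry} {w : List h.bdry} (hw : (β :: w).IsChain (· ≠ ·))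
    {γ : Geodesic} (hγ : γ.line ⊆ h.cover) {z : ℍ} (hz : z ∈ (word (β :: w) • γ).line) :
    (h.side β • z).re ≤ 0 := by
  rw [Geodesic.mem_smul_line] at hz
  simpa using side_word_smul_nonpos hw (hγ hz)

/-- The translated line is both beyond the first letter `β` and inside the cover, so it is `β`,
which `refl β` preserves. Removing that letter leaves a shorter word with the same property. -/
theorem word_smul_eq_of_subset {w : List h.bdry} (hw : w.IsChain (· ≠ ·)) {γ : Geodesic}
    (hγ : γ.line ⊆ h.cover) (hwγ : (word w • γ).line ⊆ h.cover) : word w • γ = γ := by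
  induction w with
  | nil => simp [word]
  | cons β w ih =>
    have h1 : word (β :: w) • γ = β.1 := Geodesic.eq_of_line_subset fun z hz =>
      (mem_line_side β).2 (le_antisymm (side_nonpos_of_mem_line hw hγ hz) (side_nonneg β (hwγ hz)))
    have h2 : word w • γ = β.1 := by
      rw [word_cons, mul_smul] at h1
      apply MulAction.injective (refl β)
      change refl β • word w • γ = refl β • β.1
      rw [h1, refl_smul_self]
    have h3 := ih hw.tail (h2 ▸ line_subset_of_mem_bdry β.2)
    rw [h1, ← h2, h3]

/-- A line beyond `β` that meets the cover does so on `β`, and a line in a half-plane touching its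
boundary is the boundary. So the translate is `β`, and the previous lemma applies. -/
theorem word_smul_eq_of_mem {w : List h.bdry} (hw : w.IsChain (· ≠ ·)) {γ : Geodesic}
    (hγ : γ.line ⊆ h.cover) {y : ℍ} (hy : y ∈ (word w • γ).line) (hyc : y ∈ h.cover) :
    word w • γ = γ := by
  cases w with
  | nil => simp [word]
  | cons β w =>
    apply word_smul_eq_of_subset hw hγ
    have h1 : y ∈ β.1.line :=
      (mem_line_side β).2 (le_antisymm (side_nonpos_of_mem_line hw hγ hy) (side_nonneg β hyc))
    have h2 : word (β :: w) • γ = β.1 := by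
      refine Geodesic.eq_of_touches (T := axisRefl * h.side β) ?_ (fun z hz => ?_) hy h1
      · rw [mul_smul, side_smul, axisRefl_smul_base]
      · rw [mul_smul, axisRefl_smul_re]
        linarith [side_nonpos_of_mem_line hw hγ hz]
    rw [h2]
    exact line_subset_of_mem_bdry β.2

/-- A translate under the double group of a geodesic of the universal cover which meets the
universal cover is a translate under the deck group. -/
theorem exists_deck_smul_eq {g : GL (Fin 2) ℝ} (hg : g ∈ h.doubleGroup) {γ : Geodesic}
    (hγ : γ.line ⊆ h.cover) {y : ℍ} (hy : y ∈ (g • γ).line) (hyc : y ∈ h.cover) :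
    ∃ d ∈ h.deck, g • γ = d • γ := by
  obtain ⟨w, hw, d, hd, hgd⟩ := exists_word hg
  have h1 : g • γ = word w • d • γ := by
    rw [← mul_smul]
    exact Geodesic.smul_eq_smul_of_forall (fun z => by rw [hgd, mul_smul]) γ
  refine ⟨d, hd, ?_⟩
  rw [h1] at hy ⊢
  exact word_smul_eq_of_mem hw (smul_line_subset hd hγ) hy hyc

/-- Applying `g'⁻¹` moves the crossing point into the cover. The translate of `γ` is then a deck
translate, contained in the cover, and touching `β` forces equality. -/
theorem not_crosses_double {g g' : GL (Fin 2) ℝ} (hg : g ∈ h.doubleGroup) (hg' : g' ∈ h.doubleGroup)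
    {γ : Geodesic} (hγ : γ.line ⊆ h.cover) {β : Geodesic} (hβ : β ∈ h.bdry) :
    ¬ (g • γ).Crosses (g' • β) := by
  rintro ⟨hne, y, hy1, hy2⟩
  apply hne
  rw [Geodesic.mem_smul_line] at hy2
  have h1 : g'⁻¹ • y ∈ ((g'⁻¹ * g) • γ).line := by
    rw [mul_smul, Geodesic.smul_mem_line]
    exact hy1
  obtain ⟨d, hd, hgd⟩ := exists_deck_smul_eq (mul_mem (inv_mem hg') hg) hγ h1
    (line_subset_of_mem_bdry hβ hy2)
  have h2 := eq_of_touches ⟨β, hβ⟩ (hgd ▸ smul_line_subset hd hγ) h1 hy2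
  rw [mul_smul, inv_smul_eq_iff] at h2
  exact h2

variable (h) in
/-- A deck-invariant set of geodesics in the universal cover of which only finitely many meet any
given ball. -/
structure IsDiscreteFamily (s : Set Geodesic) : Prop where
  line_subset : ∀ γ ∈ s, γ.line ⊆ h.cover
  smul_mem : ∀ g ∈ h.deck, ∀ γ ∈ s, g • γ ∈ s
  finite_inter : ∀ z R, {γ ∈ s | (γ.line ∩ Metric.closedBall z R).Nonempty}.Finite

variable (h) in
/-- The union of the translates of `s` under the double group. -/
def saturation (s : Set Geodesic) : Set Geodesic := {γ' | ∃ g ∈ h.doubleGroup, ∃ γ ∈ s, g • γ = γ'}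

theorem smul_mem_saturation {s : Set Geodesic} {g : GL (Fin 2) ℝ} (hg : g ∈ h.doubleGroup)
    {γ : Geodesic} : g • γ ∈ h.saturation s ↔ γ ∈ h.saturation s := by
  constructor
  · rintro ⟨g', hg', γ', hγ', he⟩
    exact ⟨g⁻¹ * g', mul_mem (inv_mem hg) hg', γ', hγ', by rw [mul_smul, he, inv_smul_smul]⟩
  · rintro ⟨g', hg', γ', hγ', rfl⟩
    exact ⟨g * g', mul_mem hg hg', γ', hγ', mul_smul _ _ _⟩

theorem subset_saturation (s : Set Geodesic) : s ⊆ h.saturation s := fun γ hγ =>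
  ⟨1, one_mem _, γ, hγ, one_smul _ _⟩

namespace IsDiscreteFamily

variable {s : Set Geodesic} (hs : h.IsDiscreteFamily s)

include hs

theorem mem_of_mem_saturation {γ : Geodesic} (hγ : γ ∈ h.saturation s) {y : ℍ} (hy : y ∈ γ.line)
    (hyc : y ∈ h.cover) : γ ∈ s := by
  obtain ⟨g, hg, γ', hγ', rfl⟩ := hγ
  obtain ⟨d, hd, hgd⟩ := exists_deck_smul_eq hg (hs.line_subset _ hγ') hy hyc
  rw [hgd]
  exact hs.smul_mem d hd _ hγ'

/-- The reason why counting translates under the double group restricts to counting `s` itself. -/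
theorem saturation_inter : h.saturation s ∩ h.geodesicSet = s := by
  ext γ
  constructor
  · rintro ⟨h1, h2⟩
    obtain ⟨y, hy⟩ := γ.line_nonempty
    exact hs.mem_of_mem_saturation h1 hy (mem_geodesicSet_iff.1 h2 hy)
  · exact fun hγ => ⟨subset_saturation s hγ, mem_geodesicSet_iff.2 (hs.line_subset γ hγ)⟩

/-- Geodesics near `γ` meet a small ball about a point of `γ`. Two translates of the cover contain
this ball, and in each of them the family is discrete. -/
theorem exists_nhds_finite [CompactSpace S] (γ : Geodesic) :
    ∃ N ∈ 𝓝 γ, (h.saturation s ∩ N).Finite := by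
  obtain ⟨δ, hδ, hball⟩ := h.exists_ball_subset_translates
  obtain ⟨z, hz⟩ := γ.line_nonempty
  obtain ⟨g₁, h1, g₂, h2, hw⟩ := hball z
  refine ⟨_, Geodesic.eventually_inter_ball hz hδ,
    (((hs.finite_inter (g₁ • z) δ).image (g₁⁻¹ • ·)).union
      ((hs.finite_inter (g₂ • z) δ).image (g₂⁻¹ • ·))).subset ?_⟩
  have key : ∀ g ∈ h.doubleGroup, ∀ γ' ∈ h.saturation s, ∀ w ∈ γ'.line, dist w z < δ →
      g • w ∈ h.cover →
      γ' ∈ (g⁻¹ • ·) '' {γ ∈ s | (γ.line ∩ Metric.closedBall (g • z) δ).Nonempty} := by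
    intro g hg γ' hγ' w hwγ hwz hwc
    have hgw : g • w ∈ (g • γ').line := Geodesic.smul_mem_line.2 hwγ
    refine ⟨g • γ', ⟨hs.mem_of_mem_saturation ((smul_mem_saturation hg).2 hγ') hgw hwc, g • w, hgw,
      ?_⟩, inv_smul_smul _ _⟩
    rw [Metric.mem_closedBall, dist_smul_gl]
    exact hwz.le
  rintro γ' ⟨hγ', w, hwγ, hwz⟩
  rcases hw w hwz with hw | hw
  · exact Or.inl (key g₁ h1 γ' hγ' w hwγ hwz hw)
  · exact Or.inr (key g₂ h2 γ' hγ' w hwγ hwz hw)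

end IsDiscreteFamily

variable (h) in
theorem isDiscreteFamily_bdry [CompactSpace S] : h.IsDiscreteFamily h.bdry where
  line_subset _ hγ := line_subset_of_mem_bdry hγ
  smul_mem _ hg _ hγ := smul_mem_bdry hg hγ
  finite_inter z R := h.finite_bdry_inter z R

theorem IsDiscreteFamily.subset {s t : Set Geodesic} (hs : h.IsDiscreteFamily s) (hts : t ⊆ s)
    (hsmul : ∀ g ∈ h.deck, ∀ γ ∈ t, g • γ ∈ t) : h.IsDiscreteFamily t where
  line_subset γ hγ := hs.line_subset γ (hts hγ)
  smul_mem := hsmul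
  finite_inter z R := (hs.finite_inter z R).subset fun _ hγ => ⟨hts hγ.1, hγ.2⟩

end HyperbolicStructure

end GeodesicCurrents

end

/-! ### Counting measures, boundary curves and the decomposition -/

noncomputable section

namespace GeodesicCurrents

open UpperHalfPlane Filter Topology Set

theorem isClosed_of_locallyFinite {X : Type*} [TopologicalSpace X] [T1Space X] {s : Set X}
    (hs : ∀ x, ∃ N ∈ 𝓝 x, (s ∩ N).Finite) : IsClosed s := by
  rw [← isOpen_compl_iff, isOpen_iff_mem_nhds]
  intro x hx
  obtain ⟨N, hN, hfin⟩ := hs x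
  filter_upwards [hN, hfin.isClosed.isOpen_compl.mem_nhds (fun h' => hx h'.1)] with y hy hy' hys
  exact hy' ⟨hys, hy⟩

section PointMeasure

variable {X : Type*} [MeasurableSpace X]

/-- The sum of the Dirac masses at the points of `s`. -/
def ptMeasure (s : Set X) : Measure X := Measure.sum fun x : s => Measure.dirac x.1

theorem ptMeasure_apply (s : Set X) {A : Set X} (hA : MeasurableSet A) :
    ptMeasure s A = ((s ∩ A).encard : ENNReal) := by
  rw [ptMeasure, Measure.sum_apply _ hA, ← ENNReal.tsum_set_one]
  simp_rw [Measure.dirac_apply' _ hA]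
  rw [tsum_subtype s (fun x => A.indicator 1 x), tsum_subtype (s ∩ A) (fun _ => (1 : ENNReal))]
  congr 1
  ext x
  simp only [indicator, mem_inter_iff]
  split_ifs <;> simp_all

theorem map_ptMeasure {Y : Type*} [MeasurableSpace Y] {f : X → Y} (hf : Measurable f)
    (hinj : Function.Injective f) (s : Set X) : (ptMeasure s).map f = ptMeasure (f '' s) := by
  ext A hA
  rw [Measure.map_apply hf hA, ptMeasure_apply _ hA, ptMeasure_apply _ (hf hA),
    ← image_inter_preimage, hinj.encard_image]

theorem ptMeasure_restrict (s : Set X) {t : Set X} (ht : MeasurableSet t) :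
    (ptMeasure s).restrict t = ptMeasure (s ∩ t) := by
  ext A hA
  rw [Measure.restrict_apply hA, ptMeasure_apply _ (hA.inter ht), ptMeasure_apply _ hA,
    inter_assoc, inter_comm t]

theorem ptMeasure_lt_top {s A : Set X} (hA : MeasurableSet A) (hfin : (s ∩ A).Finite) :
    ptMeasure s A < ⊤ := by
  rw [ptMeasure_apply _ hA]
  exact ENat.toENNReal_lt_top.2 hfin.encard_lt_top

theorem isLocallyFinite_ptMeasure [TopologicalSpace X] [OpensMeasurableSpace X] {s : Set X}
    (hs : ∀ x, ∃ N ∈ 𝓝 x, (s ∩ N).Finite) : IsLocallyFiniteMeasure (ptMeasure s) := by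
  refine ⟨fun x => ?_⟩
  obtain ⟨N, hN, hfin⟩ := hs x
  obtain ⟨U, hUN, hU, hxU⟩ := mem_nhds_iff.1 hN
  exact ⟨U, hU.mem_nhds hxU, ptMeasure_lt_top hU.measurableSet
    (hfin.subset (inter_subset_inter_right _ hUN))⟩

theorem support_ptMeasure_subset [TopologicalSpace X] [OpensMeasurableSpace X] {s : Set X}
    (hs : IsClosed s) : (ptMeasure s).support ⊆ s := by
  refine Measure.support_subset_of_isClosed hs ?_
  rw [mem_ae_iff, ptMeasure_apply _ hs.measurableSet.compl]
  simp

/-- A measure carried by a countable set is the sum of its atoms. -/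
theorem eq_of_singletons [MeasurableSingletonClass X] {μ ν : Measure X} {L : Set X}
    (hL : L.Countable) (hμ : μ Lᶜ = 0) (hν : ν Lᶜ = 0) (hs : ∀ x ∈ L, μ {x} = ν {x}) : μ = ν := by
  have key : ∀ (m : Measure X), m Lᶜ = 0 → ∀ A, m A = ∑' x : (A ∩ L : Set X), m {x.1} := by
    intro m hm A
    have h1 : m A = m (A ∩ L) := by
      refine le_antisymm ?_ (measure_mono inter_subset_left)
      calc m A ≤ m (A ∩ L ∪ Lᶜ) := measure_mono fun x hx => by
            by_cases hxL : x ∈ L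
            exacts [Or.inl ⟨hx, hxL⟩, Or.inr hxL]
        _ ≤ m (A ∩ L) + m Lᶜ := measure_union_le _ _
        _ = m (A ∩ L) := by rw [hm, add_zero]
    have h2 := measure_biUnion (μ := m) (f := fun x : X => ({x} : Set X))
      (hL.mono (inter_subset_right : A ∩ L ⊆ L))
      (fun x _ y _ hxy => by simpa [Function.onFun] using hxy)
      (fun x _ => measurableSet_singleton x)
    rw [biUnion_of_singleton] at h2
    rw [h1, h2]
  ext A -
  rw [key μ hμ, key ν hν]
  exact tsum_congr fun x => hs x.1 x.2.2

end PointMeasure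

theorem measurable_smul_geodesic (g : GL (Fin 2) ℝ) : Measurable (g • · : Geodesic → Geodesic) :=
  (continuous_const_smul g).measurable

theorem isInvariant_ptMeasure {Δ : Subgroup (GL (Fin 2) ℝ)} {s : Set Geodesic}
    (hs : ∀ g ∈ Δ, ∀ γ ∈ s, g • γ ∈ s) : IsInvariant Δ (ptMeasure s) := by
  intro g hg A hA
  rw [← Measure.map_apply (measurable_smul_geodesic g) hA,
    map_ptMeasure (measurable_smul_geodesic g) (MulAction.injective g)]
  congr 2
  apply Subset.antisymm
  · rintro _ ⟨γ, hγ, rfl⟩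
    exact hs g hg γ hγ
  · exact fun γ hγ => ⟨g⁻¹ • γ, hs _ (inv_mem hg) γ hγ, smul_inv_smul _ _⟩

theorem isInvariant_restrict {Δ : Subgroup (GL (Fin 2) ℝ)} {μ : Measure Geodesic}
    (hμ : IsInvariant Δ μ) {t : Set Geodesic} (ht : MeasurableSet t)
    (htΔ : ∀ g ∈ Δ, ∀ γ, g • γ ∈ t ↔ γ ∈ t) : IsInvariant Δ (μ.restrict t) := by
  intro g hg A hA
  rw [Measure.restrict_apply hA, Measure.restrict_apply (measurable_smul_geodesic g hA),
    ← hμ g hg (A ∩ t) (hA.inter ht), preimage_inter]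
  congr 2
  ext γ
  exact (htΔ g hg γ).symm

namespace HyperbolicStructure

variable {S : Type*} [TopologicalSpace S] {h : HyperbolicStructure S}

variable (h) in
theorem isClosed_geodesicSet : IsClosed h.geodesicSet := by
  rw [← isOpen_compl_iff, isOpen_iff_mem_nhds]
  intro γ hγ
  obtain ⟨z, hz, hzc⟩ := not_subset.1 (fun h' => hγ (mem_geodesicSet_iff.2 h'))
  obtain ⟨ρ, hρ, hball⟩ := Metric.isOpen_iff.1 h.isClosed_cover.isOpen_compl z hzc
  filter_upwards [Geodesic.eventually_inter_ball hz hρ] with γ' ⟨w, hw, hwz⟩ hγ'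
  exact hball hwz (mem_geodesicSet_iff.1 hγ' hw)

/-- Local finiteness makes the saturation closed, so it contains the support, and
`not_crosses_double` applies to each of its members. -/
theorem isDoubleCurrent_ptMeasure [CompactSpace S] {s : Set Geodesic} (hs : h.IsDiscreteFamily s) :
    h.IsDoubleCurrent (ptMeasure (h.saturation s)) where
  isLocallyFinite := isLocallyFinite_ptMeasure hs.exists_nhds_finite
  invariant := isInvariant_ptMeasure fun _ hg _ hγ => (smul_mem_saturation hg).2 hγ
  not_crosses γ hγ g hg β hβ := by
    obtain ⟨g', hg', γ', hγ', rfl⟩ :=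
      support_ptMeasure_subset (isClosed_of_locallyFinite hs.exists_nhds_finite) hγ
    exact not_crosses_double hg' hg (hs.line_subset γ' hγ') hβ

theorem map_ptMeasure_val [CompactSpace S] {s : Set h.Geod}
    (hs : h.IsDiscreteFamily (Subtype.val '' s)) : (ptMeasure s).map Subtype.val =
      (ptMeasure (h.saturation (Subtype.val '' s))).restrict h.geodesicSet := by
  rw [map_ptMeasure measurable_subtype_coe Subtype.val_injective,
    ptMeasure_restrict _ h.isClosed_geodesicSet.measurableSet, hs.saturation_inter]

theorem exists_nhds_finite_geod [CompactSpace S] {s : Set h.Geod}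
    (hs : h.IsDiscreteFamily (Subtype.val '' s)) (γ : h.Geod) : ∃ N ∈ 𝓝 γ, (s ∩ N).Finite := by
  obtain ⟨N, hN, hfin⟩ := hs.exists_nhds_finite γ.1
  refine ⟨Subtype.val ⁻¹' N, continuous_subtype_val.continuousAt hN, ?_⟩
  refine Set.Finite.of_finite_image (hfin.subset ?_) Subtype.val_injective.injOn
  rintro _ ⟨x, ⟨hx, hxN⟩, rfl⟩
  exact ⟨subset_saturation _ (mem_image_of_mem _ hx), hxN⟩

theorem ptMeasure_mem_currents [CompactSpace S] {s : Set h.Geod}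
    (hs : h.IsDiscreteFamily (Subtype.val '' s)) : ptMeasure s ∈ h.currents where
  isLocallyFinite := isLocallyFinite_ptMeasure (exists_nhds_finite_geod hs)
  invariant := by
    rw [map_ptMeasure measurable_subtype_coe Subtype.val_injective]
    exact isInvariant_ptMeasure hs.smul_mem
  restriction _ := ⟨_, isDoubleCurrent_ptMeasure hs, map_ptMeasure_val hs⟩

/-- The action of the deck group on the geodesics of the universal cover. -/
def smulGeod {g : GL (Fin 2) ℝ} (hg : g ∈ h.deck) (γ : h.Geod) : h.Geod :=
  ⟨g • γ.1, mem_geodesicSet_iff.2 (smul_line_subset hg (mem_geodesicSet_iff.1 γ.2))⟩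

theorem smulGeod_mem_deckOrbit {g : GL (Fin 2) ℝ} (hg : g ∈ h.deck) (γ : h.Geod) :
    smulGeod hg γ ∈ h.deckOrbit γ := ⟨g, hg, rfl⟩

theorem mem_deckOrbit_self (γ : h.Geod) : γ ∈ h.deckOrbit γ := ⟨1, one_mem _, one_smul _ _⟩

theorem deckOrbit_eq {γ γ' : h.Geod} (hγ : γ' ∈ h.deckOrbit γ) :
    h.deckOrbit γ' = h.deckOrbit γ := by
  obtain ⟨g, hg, hgγ⟩ := hγ
  ext γ''
  constructor
  · rintro ⟨g', hg', h'⟩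
    exact ⟨g' * g, mul_mem hg' hg, by rw [mul_smul, hgγ, h']⟩
  · rintro ⟨g', hg', h'⟩
    exact ⟨g' * g⁻¹, mul_mem hg' (inv_mem hg), by rw [mul_smul, ← hgγ, inv_smul_smul, h']⟩

theorem smul_mem_image_deckOrbit {g : GL (Fin 2) ℝ} (hg : g ∈ h.deck) {γ₀ : h.Geod} {γ : Geodesic}
    (hγ : γ ∈ Subtype.val '' h.deckOrbit γ₀) : g • γ ∈ Subtype.val '' h.deckOrbit γ₀ := by
  obtain ⟨γ, ⟨g', hg', hγ'⟩, rfl⟩ := hγ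
  exact ⟨smulGeod hg γ, ⟨g * g', mul_mem hg hg', by rw [mul_smul, hγ']; rfl⟩, rfl⟩

theorem smulGeod_mem_boundaryLifts {g : GL (Fin 2) ℝ} (hg : g ∈ h.deck) {γ : h.Geod} :
    smulGeod hg γ ∈ h.boundaryLifts ↔ γ ∈ h.boundaryLifts := by
  refine ⟨fun hγ => ?_, fun hγ => smul_mem_bdry hg hγ⟩
  have := smul_mem_bdry (inv_mem hg) (mem_bdry_iff_mem_boundaryLifts.1 hγ)
  rw [smulGeod, inv_smul_smul] at this
  exact this

theorem deckOrbit_subset_boundaryLifts {γ : h.Geod} (hγ : γ ∈ h.boundaryLifts) :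
    h.deckOrbit γ ⊆ h.boundaryLifts := by
  rintro γ' ⟨g, hg, hgγ⟩
  obtain rfl : smulGeod hg γ = γ' := Subtype.ext hgγ
  exact (smulGeod_mem_boundaryLifts hg).2 hγ

theorem BoundaryCurve.subset_boundaryLifts (β : h.BoundaryCurve) : β.1 ⊆ h.boundaryLifts := by
  obtain ⟨O, γ, hγ, rfl⟩ := β
  exact deckOrbit_subset_boundaryLifts hγ

theorem BoundaryCurve.eq_deckOrbit (β : h.BoundaryCurve) {γ : h.Geod} (hγ : γ ∈ β.1) :
    β.1 = h.deckOrbit γ := by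
  obtain ⟨O, γ', hγ', rfl⟩ := β
  exact (deckOrbit_eq hγ).symm

theorem BoundaryCurve.eq_of_mem {β β' : h.BoundaryCurve} {γ : h.Geod} (hγ : γ ∈ β.1)
    (hγ' : γ ∈ β'.1) : β = β' :=
  Subtype.ext ((β.eq_deckOrbit hγ).trans (β'.eq_deckOrbit hγ').symm)

theorem BoundaryCurve.exists_mem (β : h.BoundaryCurve) : ∃ γ, γ ∈ β.1 := by
  obtain ⟨O, γ, hγ, rfl⟩ := β
  exact ⟨γ, mem_deckOrbit_self γ⟩

theorem exists_boundaryCurve {γ : h.Geod} (hγ : γ ∈ h.boundaryLifts) :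
    ∃ β : h.BoundaryCurve, γ ∈ β.1 :=
  ⟨⟨h.deckOrbit γ, γ, hγ, rfl⟩, mem_deckOrbit_self γ⟩

variable (h) in
theorem image_boundaryLifts : Subtype.val '' h.boundaryLifts = h.bdry := by
  ext γ
  constructor
  · rintro ⟨γ, hγ, rfl⟩
    exact hγ
  · exact fun hγ => ⟨toGeod ⟨γ, hγ⟩, hγ, rfl⟩

theorem BoundaryCurve.isDiscreteFamily [CompactSpace S] (β : h.BoundaryCurve) :
    h.IsDiscreteFamily (Subtype.val '' β.1) := by
  refine h.isDiscreteFamily_bdry.subset ?_ ?_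
  · rw [← h.image_boundaryLifts]
    exact image_mono β.subset_boundaryLifts
  · intro g hg γ hγ
    obtain ⟨γ₀, hγ₀⟩ := β.exists_mem
    rw [β.eq_deckOrbit hγ₀] at hγ ⊢
    exact smul_mem_image_deckOrbit hg hγ

theorem curveMeasure_eq (β : h.BoundaryCurve) : h.curveMeasure β = ptMeasure β.1 := rfl

theorem curveMeasure_mem_currents [CompactSpace S] (β : h.BoundaryCurve) :
    h.curveMeasure β ∈ h.currents :=
  ptMeasure_mem_currents β.isDiscreteFamily

/-- By cocompactness every boundary curve has a lift meeting one fixed ball, and finitely many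
boundary geodesics do. -/
instance finite_boundaryCurve [CompactSpace S] : Finite h.BoundaryCurve := by
  obtain ⟨z₀, -⟩ := h.interior_nonempty
  obtain ⟨R, hR⟩ := h.exists_dist_le z₀
  have hex : ∀ β : h.BoundaryCurve, ∃ γ ∈ β.1,
      γ.1 ∈ {β ∈ h.bdry | (β.line ∩ Metric.closedBall z₀ R).Nonempty} := by
    intro β
    obtain ⟨γ, hγ⟩ := β.exists_mem
    have hγb := β.subset_boundaryLifts hγ
    obtain ⟨z, hz⟩ := γ.1.line_nonempty
    obtain ⟨g, hg, hgz⟩ := hR z (line_subset_of_mem_bdry hγb hz)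
    refine ⟨smulGeod hg γ, ?_, (smulGeod_mem_boundaryLifts hg).2 hγb, g • z,
      Geodesic.smul_mem_line.2 hz, hgz⟩
    rw [β.eq_deckOrbit hγ]
    exact smulGeod_mem_deckOrbit hg γ
  choose f hf hf' using hex
  have := (h.finite_bdry_inter z₀ R).to_subtype
  refine Finite.of_injective (fun β => (⟨_, hf' β⟩ :
    {β ∈ h.bdry | (β.line ∩ Metric.closedBall z₀ R).Nonempty})) fun β β' he => ?_
  have h1 : f β = f β' := Subtype.ext (congrArg (fun x => x.1) he)
  exact BoundaryCurve.eq_of_mem (hf β) (h1 ▸ hf β')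

theorem isClosed_boundaryLifts [CompactSpace S] : IsClosed h.boundaryLifts :=
  isClosed_of_locallyFinite (exists_nhds_finite_geod (by
    rw [h.image_boundaryLifts]; exact h.isDiscreteFamily_bdry))

theorem countable_boundaryLifts [CompactSpace S] : h.boundaryLifts.Countable := by
  obtain ⟨z₀, -⟩ := h.interior_nonempty
  have h1 : h.bdry ⊆ ⋃ n : ℕ, {β ∈ h.bdry | (β.line ∩ Metric.closedBall z₀ n).Nonempty} := by
    intro β hβ
    obtain ⟨z, hz⟩ := β.line_nonempty
    obtain ⟨n, hn⟩ := exists_nat_ge (dist z z₀)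
    exact mem_iUnion.2 ⟨n, hβ, z, hz, hn⟩
  have h2 : h.bdry.Countable :=
    (countable_iUnion fun n : ℕ => (h.finite_bdry_inter z₀ n).countable).mono h1
  rw [← h.image_boundaryLifts] at h2
  exact countable_of_injective_of_countable_image Subtype.val_injective.injOn h2

/-- Makes the coefficient of a boundary curve independent of the lift at which the atom is read off.
-/
theorem currents_singleton {c : Measure h.Geod} (hc : c ∈ h.currents) {γ γ' : h.Geod}
    (hγ : γ' ∈ h.deckOrbit γ) : c {γ'} = c {γ} := by
  obtain ⟨g, hg, hgγ⟩ := hγ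
  have h1 := hc.invariant g hg {γ'.1} (measurableSet_singleton _)
  rw [Measure.map_apply measurable_subtype_coe (measurableSet_singleton _),
    Measure.map_apply measurable_subtype_coe
      (measurable_smul_geodesic g (measurableSet_singleton _))] at h1
  have h2 : (Subtype.val ⁻¹' {γ'.1} : Set h.Geod) = {γ'} := by
    ext x; simp [Subtype.ext_iff]
  have h3 : (Subtype.val ⁻¹' ((g • ·) ⁻¹' {γ'.1}) : Set h.Geod) = {γ} := by
    ext x
    simp only [mem_preimage, mem_singleton_iff, ← hgγ]
    rw [(MulAction.injective g).eq_iff, Subtype.ext_iff]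
  rw [h2, h3] at h1
  exact h1.symm

theorem currents_singleton_lt_top {c : Measure h.Geod} (hc : c ∈ h.currents) (γ : h.Geod) :
    c {γ} < ⊤ := by
  obtain ⟨s, hs, hs'⟩ := hc.isLocallyFinite.finiteAtNhds γ
  exact (measure_mono (singleton_subset_iff.2 (mem_of_mem_nhds hs))).trans_lt hs'

theorem isClosed_saturation_bdry [CompactSpace S] : IsClosed (h.saturation h.bdry) :=
  isClosed_of_locallyFinite h.isDiscreteFamily_bdry.exists_nhds_finite

/-- For the extension to remain a current on the double, the removed set must be invariant under the
double group. The saturation of the boundary is, and within the geodesics of the cover it consists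
of the boundary lifts only. -/
theorem restrict_mem_currents [CompactSpace S] {c : Measure h.Geod} (hc : c ∈ h.currents) :
    c.restrict h.boundaryLiftsᶜ ∈ h.currents := by
  have hmeas : MeasurableSet (h.saturation h.bdry)ᶜ := isClosed_saturation_bdry.measurableSet.compl
  have hpre : Subtype.val ⁻¹' (h.saturation h.bdry)ᶜ = h.boundaryLiftsᶜ := by
    rw [preimage_compl]
    congr 1
    ext γ
    constructor
    · intro hγ
      have : γ.1 ∈ h.saturation h.bdry ∩ h.geodesicSet := ⟨hγ, γ.2⟩
      rw [h.isDiscreteFamily_bdry.saturation_inter] at this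
      exact this
    · exact fun hγ => subset_saturation _ hγ
  have hmap : (c.restrict h.boundaryLiftsᶜ).map Subtype.val =
      (c.map Subtype.val).restrict (h.saturation h.bdry)ᶜ := by
    rw [Measure.restrict_map measurable_subtype_coe hmeas, hpre]
  have hsat : ∀ g ∈ h.doubleGroup, ∀ γ, g • γ ∈ (h.saturation h.bdry)ᶜ ↔
      γ ∈ (h.saturation h.bdry)ᶜ := fun g hg γ => not_congr (smul_mem_saturation hg)
  obtain ⟨h1, h2, h3⟩ := hc
  refine ⟨inferInstance, ?_, fun hne => ?_⟩
  · rw [hmap]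
    exact isInvariant_restrict h2 hmeas fun g hg => hsat g (deck_le_doubleGroup hg)
  · obtain ⟨μ, ⟨hμ1, hμ2, hμ3⟩, hμ⟩ := h3 hne
    refine ⟨μ.restrict (h.saturation h.bdry)ᶜ, ⟨inferInstance,
      isInvariant_restrict hμ2 hmeas hsat, fun γ hγ =>
        hμ3 γ (Measure.support_mono Measure.restrict_le_self hγ)⟩, ?_⟩
    rw [hmap, hμ, Measure.restrict_restrict hmeas,
      Measure.restrict_restrict h.isClosed_geodesicSet.measurableSet, inter_comm]

/-- The linear combination of the boundary curves with coefficients `u`. -/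
def boundarySum (u : h.BoundaryCurve →₀ ℝ≥0) : Measure h.Geod :=
  u.sum fun β a => a • h.curveMeasure β

theorem boundarySum_singleton [CompactSpace S] (u : h.BoundaryCurve →₀ ℝ≥0) {β : h.BoundaryCurve}
    {γ : h.Geod} (hγ : γ ∈ β.1) : boundarySum u {γ} = u β := by
  have := Fintype.ofFinite h.BoundaryCurve
  rw [boundarySum, Finsupp.sum_fintype _ _ (by simp), Measure.finsetSum_apply]
  rw [Finset.sum_eq_single β]
  · rw [Measure.smul_apply, curveMeasure_eq, ptMeasure_apply _ (measurableSet_singleton γ),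
      inter_singleton_of_mem hγ]
    simp
  · intro β' _ hne
    rw [Measure.smul_apply, curveMeasure_eq, ptMeasure_apply _ (measurableSet_singleton γ),
      inter_singleton_eq_empty.2 (fun hγ' => hne (BoundaryCurve.eq_of_mem hγ' hγ))]
    simp
  · simp

theorem boundarySum_compl [CompactSpace S] (u : h.BoundaryCurve →₀ ℝ≥0) :
    boundarySum u h.boundaryLiftsᶜ = 0 := by
  have := Fintype.ofFinite h.BoundaryCurve
  rw [boundarySum, Finsupp.sum_fintype _ _ (by simp), Measure.finsetSum_apply]
  refine Finset.sum_eq_zero fun β _ => ?_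
  rw [Measure.smul_apply, curveMeasure_eq,
    ptMeasure_apply _ isClosed_boundaryLifts.measurableSet.compl,
    show β.1 ∩ h.boundaryLiftsᶜ = ∅ from
      disjoint_iff_inter_eq_empty.1 (disjoint_compl_right_iff_subset.2 β.subset_boundaryLifts)]
  simp

theorem boundarySum_mem_currents [CompactSpace S] (u : h.BoundaryCurve →₀ ℝ≥0) :
    boundarySum u ∈ h.currents :=
  Submodule.sum_mem _ fun β _ => Submodule.smul_mem _ _ (curveMeasure_mem_currents β)

theorem exists_boundarySum_eq_restrict [CompactSpace S] {c : Measure h.Geod}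
    (hc : c ∈ h.currents) : ∃ u, boundarySum u = c.restrict h.boundaryLifts := by
  choose f hf using fun β : h.BoundaryCurve => β.exists_mem
  -- The coefficient of a curve is the atom of `c` at one chosen lift, finite by local finiteness.
  let u : h.BoundaryCurve →₀ ℝ≥0 :=
    Finsupp.equivFunOnFinite.symm fun β => (c {f β}).toNNReal
  have hL := isClosed_boundaryLifts (h := h).measurableSet
  refine ⟨u, eq_of_singletons countable_boundaryLifts (boundarySum_compl u) ?_ fun γ hγ => ?_⟩
  · rw [Measure.restrict_apply hL.compl, compl_inter_self, measure_empty]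
  · obtain ⟨β, hβ⟩ := exists_boundaryCurve hγ
    rw [boundarySum_singleton u hβ, Measure.restrict_apply (measurableSet_singleton γ),
      inter_eq_left.2 (singleton_subset_iff.2 hγ)]
    change ((c {f β}).toNNReal : ENNReal) = _
    rw [ENNReal.coe_toNNReal (currents_singleton_lt_top hc _).ne]
    apply currents_singleton hc
    rw [← β.eq_deckOrbit hβ]
    exact hf β

theorem restrict_compl_mem_internal [CompactSpace S] (c : h.currents) :
    (⟨_, restrict_mem_currents c.2⟩ : h.currents) ∈ h.internalCurrents := by
  intro β hβ
  change ((c : Measure h.Geod).restrict h.boundaryLiftsᶜ) {β} = 0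
  rw [Measure.restrict_apply (measurableSet_singleton β),
    singleton_inter_eq_empty.2 (notMem_compl_iff.2 hβ), measure_empty]

theorem internal_apply_boundaryLifts [CompactSpace S] {c : h.currents}
    (hc : c ∈ h.internalCurrents) : (c : Measure h.Geod) h.boundaryLifts = 0 := by
  rw [← biUnion_of_singleton h.boundaryLifts, measure_biUnion_null_iff countable_boundaryLifts]
  exact hc

/-- The coefficients of the boundary curves and the internal part of a current are unique. -/
theorem existsUnique_finsupp [CompactSpace S] (c : h.currents) :
    ∃! p : (h.BoundaryCurve →₀ ℝ≥0) × h.internalCurrents,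
      boundarySum p.1 + ((p.2 : h.currents) : Measure h.Geod) = c := by
  have hL := isClosed_boundaryLifts (h := h).measurableSet
  obtain ⟨u, hu⟩ := exists_boundarySum_eq_restrict c.2
  -- Both components can be read off from `c`: the coefficients are its atoms, the internal part is
  -- its restriction off the boundary lifts.
  have huniq : ∀ p : (h.BoundaryCurve →₀ ℝ≥0) × h.internalCurrents,
      boundarySum p.1 + ((p.2 : h.currents) : Measure h.Geod) = c →
      (∀ β : h.BoundaryCurve, ∀ γ ∈ β.1, (p.1 β : ENNReal) = (c : Measure h.Geod) {γ}) ∧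
      ((p.2 : h.currents) : Measure h.Geod) = (c : Measure h.Geod).restrict h.boundaryLiftsᶜ := by
    rintro ⟨v, d, hd⟩ hp
    change boundarySum v + (d : Measure h.Geod) = c at hp
    rw [← hp]
    constructor
    · intro β γ hγ
      rw [Measure.add_apply, boundarySum_singleton v hγ, hd γ (β.subset_boundaryLifts hγ), add_zero]
    · ext A hA
      rw [Measure.restrict_apply hA, Measure.add_apply,
        measure_mono_null inter_subset_right (boundarySum_compl v), zero_add]
      refine le_antisymm ?_ (measure_mono inter_subset_left)
      calc (d : Measure h.Geod) A ≤ (d : Measure h.Geod) (A ∩ h.boundaryLiftsᶜ ∪ h.boundaryLifts) :=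
            measure_mono fun x hx => by
              by_cases hxL : x ∈ h.boundaryLifts
              exacts [Or.inr hxL, Or.inl ⟨hx, hxL⟩]
        _ ≤ _ := measure_union_le _ _
        _ = _ := by rw [internal_apply_boundaryLifts hd, add_zero]
  have hex : boundarySum u + (c : Measure h.Geod).restrict h.boundaryLiftsᶜ = c := by
    rw [hu, Measure.restrict_add_restrict_compl hL]
  refine ⟨(u, ⟨⟨_, restrict_mem_currents c.2⟩, restrict_compl_mem_internal c⟩), hex, ?_⟩
  intro p hp
  obtain ⟨h1, h2⟩ := huniq p hp
  obtain ⟨h3, -⟩ := huniq (u, ⟨⟨_, restrict_mem_currents c.2⟩, restrict_compl_mem_internal c⟩) hex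
  refine Prod.ext (Finsupp.ext fun β => ?_) (Subtype.ext (Subtype.ext h2))
  obtain ⟨γ, hγ⟩ := β.exists_mem
  exact ENNReal.coe_injective ((h1 β γ hγ).trans (h3 β γ hγ).symm)

theorem mem_boundaryCurrents_iff {c : h.currents} :
    c ∈ h.boundaryCurrents ↔ ∃ u, boundarySum u = (c : Measure h.Geod) :=
  Finsupp.mem_span_range_iff_exists_finsupp

theorem existsUnique_add [CompactSpace S] (c : h.currents) :
    ∃! p : h.boundaryCurrents × h.internalCurrents,
      (p.1 : h.currents) + (p.2 : h.currents) = c := by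
  obtain ⟨⟨u, d⟩, hud, huniq⟩ := existsUnique_finsupp c
  refine ⟨(⟨⟨boundarySum u, boundarySum_mem_currents u⟩, mem_boundaryCurrents_iff.2 ⟨u, rfl⟩⟩, d),
    Subtype.ext hud, ?_⟩
  rintro ⟨⟨b, hb⟩, d'⟩ hp
  obtain ⟨v, hv⟩ := mem_boundaryCurrents_iff.1 hb
  have h1 := huniq (v, d') (by
    change boundarySum v + ((d' : h.currents) : Measure h.Geod) = c
    rw [hv]
    exact congrArg Subtype.val hp)
  rw [Prod.mk.injEq] at h1
  refine Prod.ext (Subtype.ext (Subtype.ext ?_)) h1.2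
  change (b : Measure h.Geod) = boundarySum u
  rw [← hv, h1.1]

/-- Turns membership in the span into the vanishing of one mass, which test functions can detect. -/
theorem mem_boundaryCurrents_iff_apply [CompactSpace S] {c : h.currents} :
    c ∈ h.boundaryCurrents ↔ (c : Measure h.Geod) h.boundaryLiftsᶜ = 0 := by
  rw [mem_boundaryCurrents_iff]
  constructor
  · rintro ⟨u, hu⟩
    rw [← hu, boundarySum_compl]
  · intro hc
    obtain ⟨u, hu⟩ := exists_boundarySum_eq_restrict c.2
    exact ⟨u, hu.trans (Measure.restrict_eq_self_of_ae_mem hc)⟩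

end HyperbolicStructure

end GeodesicCurrents

end

/-! ### Closedness, the Borel property and a reduction of density -/

noncomputable section

namespace GeodesicCurrents

open UpperHalfPlane Filter Topology Set

/-- Bump functions with compact support on a locally compact Hausdorff space. -/
theorem exists_bump {X : Type*} [TopologicalSpace X] [T2Space X] [LocallyCompactSpace X] {x : X}
    {U : Set X} (hU : U ∈ 𝓝 x) : ∃ f : CompactlySupportedContinuousMap X ℝ,
      (∀ᶠ y in 𝓝 x, f y = 1) ∧ (∀ y ∉ U, f y = 0) ∧ ∀ y, 0 ≤ f y ∧ f y ≤ 1 := by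
  obtain ⟨V, hVU, hV, hxV⟩ := mem_nhds_iff.1 hU
  obtain ⟨K, hK, hxK, hKV⟩ := exists_compact_subset hV hxV
  obtain ⟨f, hf1, hf0, hfs, hf⟩ := exists_continuous_one_zero_of_isCompact hK hV.isClosed_compl
    (disjoint_compl_right_iff_subset.2 hKV)
  refine ⟨⟨f, hfs⟩, ?_, fun y hy => hf0 (fun h' => hy (hVU h')), hf⟩
  filter_upwards [isOpen_interior.mem_nhds hxK] with y hy
  exact hf1 (interior_subset hy)

namespace HyperbolicStructure

variable {S : Type*} [TopologicalSpace S] {h : HyperbolicStructure S}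

instance : LocallyCompactSpace h.Geod :=
  h.isClosed_geodesicSet.isClosedEmbedding_subtypeVal.locallyCompactSpace

theorem integrable_currents (c : h.currents) (f : CompactlySupportedContinuousMap h.Geod ℝ) :
    Integrable f (c : Measure h.Geod) := by
  have := c.2.isLocallyFinite
  exact f.continuous.integrable_of_hasCompactSupport f.hasCompactSupport

theorem continuous_integral (f : CompactlySupportedContinuousMap h.Geod ℝ) :
    Continuous fun c : h.currents => ∫ γ, f γ ∂(c : Measure h.Geod) := by
  have h1 : Continuous fun (c : h.currents) (f : CompactlySupportedContinuousMap h.Geod ℝ) =>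
      ∫ γ, f γ ∂(c : Measure h.Geod) := continuous_induced_dom
  exact continuous_pi_iff.1 h1 f

theorem tendsto_currents {ι : Type*} {l : Filter ι} {u : ι → h.currents} {c : h.currents}
    (hu : ∀ f : CompactlySupportedContinuousMap h.Geod ℝ,
      Tendsto (fun i => ∫ γ, f γ ∂(u i : Measure h.Geod)) l (𝓝 (∫ γ, f γ ∂(c : Measure h.Geod)))) :
    Tendsto u l (𝓝 c) := by
  rw [nhds_induced, tendsto_comap_iff, tendsto_pi_nhds]
  exact hu

variable (h) in
-- The boundary lifts form a closed set, so its complement is covered by neighbourhoods on which a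
-- test function vanishing on the lifts equals `1`. Killing all such functions makes the complement
-- locally null.
theorem isClosed_boundaryCurrents [CompactSpace S] :
    IsClosed (h.boundaryCurrents : Set h.currents) := by
  have key : (h.boundaryCurrents : Set h.currents) =
      ⋂ (f : CompactlySupportedContinuousMap h.Geod ℝ) (_ : ∀ γ ∈ h.boundaryLifts, f γ = 0),
        {c : h.currents | ∫ γ, f γ ∂(c : Measure h.Geod) = 0} := by
    ext c
    simp only [SetLike.mem_coe, mem_iInter, Set.mem_ofPred_eq, mem_boundaryCurrents_iff_apply]
    constructor
    · intro hc f hf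
      refine integral_eq_zero_of_ae ?_
      refine measure_mono_null (fun γ hγ => ?_) hc
      exact fun hL => hγ (hf γ hL)
    · intro hc
      refine measure_null_of_locally_null _ fun γ hγ => ?_
      obtain ⟨f, hf1, hf0, hf⟩ := exists_bump (isClosed_boundaryLifts.isOpen_compl.mem_nhds hγ)
      refine ⟨_, mem_nhdsWithin_of_mem_nhds hf1, ?_⟩
      have h0 := hc f fun γ' hγ' => hf0 γ' fun h' => h' hγ'
      rw [integral_eq_zero_iff_of_nonneg (fun γ => (hf γ).1) (integrable_currents c f)] at h0
      refine measure_mono_null (fun γ' hγ' => ?_) h0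
      intro h'
      have h1 : f γ' = 1 := hγ'
      have h2 : f γ' = 0 := h'
      rw [h1] at h2
      exact one_ne_zero h2
  rw [key]
  exact isClosed_iInter fun f => isClosed_iInter fun _ =>
    isClosed_singleton.preimage (continuous_integral f)

/-- The integral of such an `f` bounds the atom at `x` from above. Conversely, outer regularity
gives an open set of small mass around `x`, and a bump inside it is the required `f`. -/
theorem singleton_eq_zero_iff (c : h.currents) (x : h.Geod) :
    (c : Measure h.Geod) {x} = 0 ↔ ∀ k : ℕ, ∃ f : CompactlySupportedContinuousMap h.Geod ℝ,
      (∀ γ, 0 ≤ f γ) ∧ 1 ≤ f x ∧ ∫ γ, f γ ∂(c : Measure h.Geod) < 1 / ((k : ℝ) + 1) := by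
  have hmk : ∀ f : CompactlySupportedContinuousMap h.Geod ℝ, (∀ γ, 0 ≤ f γ) → 1 ≤ f x →
      (c : Measure h.Geod).real {x} ≤ ∫ γ, f γ ∂(c : Measure h.Geod) := by
    intro f hf hx
    have h1 := mul_meas_ge_le_integral_of_nonneg (Eventually.of_forall hf)
      (integrable_currents c f) 1
    rw [one_mul] at h1
    refine le_trans ?_ h1
    have := c.2.isLocallyFinite
    refine measureReal_mono (singleton_subset_iff.2 hx) ?_
    refine ((f.hasCompactSupport.isCompact.measure_lt_top).trans_le' (measure_mono ?_)).ne
    intro y hy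
    refine subset_tsupport _ fun h0 => ?_
    have h1 : (1 : ℝ) ≤ f y := hy
    rw [h0] at h1
    exact absurd h1 (by norm_num)
  constructor
  · intro hx k
    have := c.2.isLocallyFinite
    obtain ⟨U, hxU, hU, hlt⟩ := Set.exists_isOpen_lt_of_lt (μ := (c : Measure h.Geod)) {x}
      (ENNReal.ofReal (1 / ((k : ℝ) + 1))) (by rw [hx]; exact ENNReal.ofReal_pos.2 (by positivity))
    obtain ⟨f, hf1, hf0, hf⟩ := exists_bump (hU.mem_nhds (singleton_subset_iff.1 hxU))
    refine ⟨f, fun γ => (hf γ).1, hf1.self_of_nhds.ge, ?_⟩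
    calc ∫ γ, f γ ∂(c : Measure h.Geod) ≤ ∫ γ, U.indicator 1 γ ∂(c : Measure h.Geod) := by
          refine integral_mono (integrable_currents c f) ?_ fun γ => ?_
          · exact (integrable_indicator_iff hU.measurableSet).2
              (integrableOn_const (hlt.trans ENNReal.ofReal_lt_top).ne)
          · by_cases hγ : γ ∈ U
            · rw [indicator_of_mem hγ]; exact (hf γ).2
            · rw [indicator_of_notMem hγ, hf0 γ hγ]
      _ = (c : Measure h.Geod).real U := integral_indicator_one hU.measurableSet
      _ < _ := by
        rw [Measure.real]
        exact (ENNReal.lt_ofReal_iff_toReal_lt (hlt.trans ENNReal.ofReal_lt_top).ne).1 hlt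
  · intro hk
    by_contra hne
    have hpos : 0 < (c : Measure h.Geod).real {x} :=
      ENNReal.toReal_pos hne (currents_singleton_lt_top c.2 x).ne
    obtain ⟨k, hk'⟩ := exists_nat_one_div_lt hpos
    obtain ⟨f, hf, hfx, hlt⟩ := hk k
    linarith [hmk f hf hfx]

variable (h) in
-- The union over test functions is uncountable but consists of open sets; only the boundary lifts
-- and `k` need to be countable.
theorem measurableSet_internalCurrents [CompactSpace S] :
    MeasurableSet[borel h.currents] (h.internalCurrents : Set h.currents) := by
  let _ : MeasurableSpace h.currents := borel h.currents
  have : BorelSpace h.currents := ⟨rfl⟩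
  have key : (h.internalCurrents : Set h.currents) = ⋂ x ∈ h.boundaryLifts, ⋂ k : ℕ,
      ⋃ (f : CompactlySupportedContinuousMap h.Geod ℝ) (_ : (∀ γ, 0 ≤ f γ) ∧ 1 ≤ f x),
        {c : h.currents | ∫ γ, f γ ∂(c : Measure h.Geod) < 1 / ((k : ℝ) + 1)} := by
    ext c
    simp only [mem_iInter, mem_iUnion, Set.mem_ofPred_eq, exists_prop, and_assoc]
    exact forall₂_congr fun x _ => singleton_eq_zero_iff c x
  rw [key]
  refine MeasurableSet.biInter countable_boundaryLifts fun x _ => MeasurableSet.iInter fun k => ?_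
  exact (isOpen_iUnion fun f => isOpen_iUnion fun _ =>
    isOpen_Iio.preimage (continuous_integral f)).measurableSet

/-- Density of the internal currents follows if the boundary curves are limits of such. -/
theorem dense_internalCurrents_of [CompactSpace S]
    (hlim : ∀ β : h.BoundaryCurve, ∃ u : ℕ → h.internalCurrents,
      ∀ f : CompactlySupportedContinuousMap h.Geod ℝ,
        Tendsto (fun n => ∫ γ, f γ ∂((u n : h.currents) : Measure h.Geod)) atTop
          (𝓝 (∫ γ, f γ ∂(h.curveMeasure β)))) :
    Dense (h.internalCurrents : Set h.currents) := by
  have := Fintype.ofFinite h.BoundaryCurve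
  choose u hu using hlim
  intro c
  obtain ⟨⟨a, d⟩, had, -⟩ := existsUnique_finsupp c
  change boundarySum a + ((d : h.currents) : Measure h.Geod) = c at had
  -- The boundary part of `c` with each curve replaced by its `n`-th approximation, the coefficients
  -- and the internal part being kept.
  let v : ℕ → h.internalCurrents := fun n => ∑ β, a β • u β n + d
  have hint : ∀ (f : CompactlySupportedContinuousMap h.Geod ℝ) (w : h.BoundaryCurve → h.currents),
      ∫ γ, f γ ∂((∑ β, a β • (w β : Measure h.Geod)) + ((d : h.currents) : Measure h.Geod)) =
      ∑ β, (a β : ℝ) * ∫ γ, f γ ∂(w β : Measure h.Geod) +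
        ∫ γ, f γ ∂((d : h.currents) : Measure h.Geod) := by
    intro f w
    have hi : ∀ β ∈ Finset.univ, Integrable f (a β • (w β : Measure h.Geod)) :=
      fun β _ => integrable_currents (a β • w β) f
    rw [integral_add_measure (integrable_finsetSum_measure.2 hi) (integrable_currents _ f),
      integral_finsetSum_measure hi]
    congr 1
    refine Finset.sum_congr rfl fun β _ => ?_
    rw [integral_smul_nnreal_measure]
    rfl
  refine mem_closure_of_tendsto (f := fun n => (v n : h.currents)) (b := atTop)
    (tendsto_currents fun f => ?_) (Eventually.of_forall fun n => (v n).2)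
  have h1 : ∀ n, ((v n : h.currents) : Measure h.Geod) =
      (∑ β, a β • ((u β n : h.currents) : Measure h.Geod)) + ((d : h.currents) : Measure h.Geod) := by
    intro n
    simp [v]
  have h2 : (c : Measure h.Geod) = (∑ β, a β • ((⟨_, curveMeasure_mem_currents β⟩ : h.currents) :
      Measure h.Geod)) + ((d : h.currents) : Measure h.Geod) := by
    rw [← had, boundarySum, Finsupp.sum_fintype _ _ (by simp)]
  rw [h2, hint f fun β => ⟨_, curveMeasure_mem_currents β⟩]
  simp_rw [h1, hint f fun β => (u β _ : h.currents)]
  exact (tendsto_finsetSum _ fun β _ => (hu β f).const_mul _).add_const _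

end HyperbolicStructure

end GeodesicCurrents

end

/-! ### Distance from the imaginary axis -/

noncomputable section

namespace GeodesicCurrents

open UpperHalfPlane Filter Topology Set

theorem Geodesic.smul_mk_eq {g : GL (Fin 2) ℝ} {x y x' y' : OnePoint ℝ} {hxy : x ≠ y} (hx : g • x = x')
    (hy : g • y = y') : g • mk x y hxy = mk x' y' (by rw [← hx, ← hy]; simpa using hxy) := by
  subst hx hy
  rw [smul_mk]

/-- An orientation-preserving isometry which fixes `0` and `∞` is a dilation. -/
theorem exists_dilation {G : GL (Fin 2) ℝ} (hG : 0 < (G : Matrix (Fin 2) (Fin 2) ℝ).det)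
    (h0 : G • ((0 : ℝ) : OnePoint ℝ) = ((0 : ℝ) : OnePoint ℝ))
    (hi : G • (OnePoint.infty : OnePoint ℝ) = OnePoint.infty) :
    ∃ κ : ℝ, (∀ x : ℝ, G • (x : OnePoint ℝ) = ((Real.exp κ * x : ℝ) : OnePoint ℝ)) ∧
      ∀ t, G • pt t = pt (t + κ) := by
  have h01 : G 0 1 = 0 := by simpa using Geodesic.smul_coe_eq_zero h0
  have h10 : G 1 0 = 0 := Geodesic.smul_infty_eq_infty hi
  rw [Matrix.det_fin_two, h01, zero_mul, sub_zero] at hG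
  have h11 : G 1 1 ≠ 0 := fun e => by simp [e] at hG
  have hpos : 0 < G 0 0 / G 1 1 := by
    rw [div_pos_iff]
    exact mul_pos_iff.1 hG
  refine ⟨Real.log (G 0 0 / G 1 1), fun x => ?_, fun t => ?_⟩
  · rw [Real.exp_log hpos, OnePoint.smul_some_eq_ite]
    simp [h01, h10, h11, div_mul_eq_mul_div]
  · have hdet : 0 < (G.det : ℝ) := by
      change 0 < (G : Matrix (Fin 2) (Fin 2) ℝ).det
      rw [Matrix.det_fin_two, h01, zero_mul, sub_zero]
      exact hG
    apply UpperHalfPlane.ext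
    rw [coe_smul_of_det_pos hdet]
    apply Complex.ext
    · simp [num, denom, h01, h10, Complex.div_re]
    · have : (pt (t + Real.log (G 0 0 / G 1 1))).im = Real.exp t * (G 0 0 / G 1 1) := by
        rw [pt_im, Real.exp_add, Real.exp_log hpos]
      change _ = (pt (t + Real.log (G 0 0 / G 1 1))).im
      rw [this]
      simp [num, denom, h01, h10, Complex.div_im, Complex.normSq]
      field_simp

/-- With `exists_dist_pt_le`, this identifies bounded neighbourhoods of the imaginary axis with the
wedges `|re| ≤ K * im`, up to the values of the constants. -/
theorem abs_re_le_of_dist_le {z : ℍ} {s R : ℝ} (hz : dist z (pt s) ≤ R) :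
    |z.re| ≤ Real.cosh R * z.im := by
  have h1 : Real.cosh (dist z (pt s)) ≤ Real.cosh R := by
    rw [Real.cosh_le_cosh, abs_of_nonneg dist_nonneg]
    exact hz.trans (le_abs_self R)
  rw [cosh_dist, Complex.dist_eq_re_im, Real.sq_sqrt (by positivity)] at h1
  have hi := z.im_pos
  have hs := (pt s).im_pos
  simp only [coe_re, coe_im, pt_re, sub_zero] at h1
  have h2 : z.re ^ 2 + (z.im - (pt s).im) ^ 2 ≤ (Real.cosh R - 1) * (2 * z.im * (pt s).im) := by
    rw [← le_sub_iff_add_le', div_le_iff₀ (by positivity)] at h1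
    exact h1
  have hc : 0 < Real.cosh R := Real.cosh_pos R
  refine abs_le_of_sq_le_sq ?_ (by positivity)
  nlinarith [sq_nonneg (Real.cosh R * z.im - (pt s).im), sq_nonneg z.im]

/-- The nearest point of the axis has the same Euclidean norm `v`, and the `cosh` of the distance
`d` to it is `v / z.im ≤ 1 + K`. Then `d + 1 ≤ exp d ≤ 2 * cosh d`. -/
theorem exists_dist_pt_le {z : ℍ} {K : ℝ} (hz : |z.re| ≤ K * z.im) :
    ∃ s, dist z (pt s) ≤ 2 + 2 * K := by
  have hi := z.im_pos
  have hK : 0 ≤ K := by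
    by_contra hK
    nlinarith [abs_nonneg z.re]
  have hv0 : 0 < z.re ^ 2 + z.im ^ 2 := by positivity
  set v := Real.sqrt (z.re ^ 2 + z.im ^ 2) with hv
  have hvpos : 0 < v := Real.sqrt_pos.2 hv0
  have hv2 : v ^ 2 = z.re ^ 2 + z.im ^ 2 := Real.sq_sqrt hv0.le
  have hvle : v ≤ (1 + K) * z.im := by
    refine abs_le_of_sq_le_sq' ?_ (by positivity) |>.2
    have := sq_abs z.re
    nlinarith [abs_nonneg z.re, mul_nonneg hK (sq_nonneg z.im)]
  have hp : (pt (Real.log v)).im = v := by rw [pt_im, Real.exp_log hvpos]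
  refine ⟨Real.log v, ?_⟩
  have h1 : Real.cosh (dist z (pt (Real.log v))) ≤ 1 + K := by
    rw [cosh_dist, Complex.dist_eq_re_im, Real.sq_sqrt (by positivity)]
    simp only [coe_re, coe_im, pt_re, sub_zero]
    rw [hp, ← le_sub_iff_add_le', div_le_iff₀ (by positivity)]
    nlinarith
  have h2 := Real.add_one_le_exp (dist z (pt (Real.log v)))
  have h3 := Real.exp_pos (-dist z (pt (Real.log v)))
  rw [Real.cosh_eq] at h1
  linarith

/-- Along a geodesic, the signed distance from the imaginary axis is the inverse hyperbolic sine of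
a linear combination of exponentials. -/
theorem re_smul_pt (M : GL (Fin 2) ℝ) : ∃ d > 0, ∀ t, (M • pt t).re =
    (M 0 0 * M 1 0 * Real.exp t + M 0 1 * M 1 1 * Real.exp (-t)) / d * (M • pt t).im := by
  have hd := det_ne_zero M
  have e : (M.det : ℝ) = M 0 0 * M 1 1 - M 0 1 * M 1 0 := by
    simp [Matrix.det_fin_two]
  refine ⟨|M 0 0 * M 1 1 - M 0 1 * M 1 0|, abs_pos.2 hd, fun t => ?_⟩
  rw [re_smul_eq, im_smul_eq_div_normSq, e, pt_im, aff, klein, pt_re, pt_im, Real.exp_neg]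
  have := (normSq_denom_pos' M (pt t)).ne'
  have hd' := abs_ne_zero.2 hd
  have := (Real.exp_pos t).ne'
  generalize |M 0 0 * M 1 1 - M 0 1 * M 1 0| = d at hd' ⊢
  field_simp
  ring

theorem nonneg_of_exp_combo {a b : ℝ} (hab : ∀ t, 0 ≤ a * Real.exp t + b * Real.exp (-t)) :
    0 ≤ a := by
  by_contra ha
  push Not at ha
  have h1 : 0 < |b| / -a + 1 := by
    have : 0 ≤ |b| / -a := div_nonneg (abs_nonneg b) (by linarith)
    linarith
  have h0 : 0 ≤ |b| / -a := div_nonneg (abs_nonneg b) (by linarith)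
  -- At this `t` the first term equals `a - |b|`, while the second is at most `|b|`.
  have h2 := hab (Real.log (|b| / -a + 1))
  rw [Real.exp_neg, Real.exp_log h1] at h2
  have h3 : a * (|b| / -a + 1) = -|b| + a := by
    rw [div_neg, mul_add, mul_neg, mul_div_cancel₀ _ ha.ne, mul_one]
  have h4 : b * (|b| / -a + 1)⁻¹ ≤ |b| := by
    calc b * (|b| / -a + 1)⁻¹ ≤ |b| * (|b| / -a + 1)⁻¹ :=
          mul_le_mul_of_nonneg_right (le_abs_self b) (inv_pos.2 h1).le
      _ ≤ |b| * 1 := mul_le_mul_of_nonneg_left (inv_le_one_of_one_le₀ (by linarith)) (abs_nonneg b)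
      _ = |b| := mul_one _
  linarith

theorem nonneg_of_exp_combo' {a b : ℝ} (hab : ∀ t, 0 ≤ a * Real.exp t + b * Real.exp (-t)) :
    0 ≤ b :=
  nonneg_of_exp_combo (a := b) (b := a) fun t => by
    have := hab (-t)
    rw [neg_neg] at this
    linarith

/-- Quasi-convexity of the distance from the imaginary axis. -/
theorem exp_combo_le {a b : ℝ} (hab : ∀ t, 0 ≤ a * Real.exp t + b * Real.exp (-t)) {r s t : ℝ}
    (hrt : r ≤ t) (hts : t ≤ s) : a * Real.exp t + b * Real.exp (-t) ≤
      (a * Real.exp r + b * Real.exp (-r)) + (a * Real.exp s + b * Real.exp (-s)) := by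
  have ha := nonneg_of_exp_combo hab
  have hb := nonneg_of_exp_combo' hab
  have h1 := mul_le_mul_of_nonneg_left (Real.exp_le_exp.2 hts) ha
  have h2 := mul_le_mul_of_nonneg_left (Real.exp_le_exp.2 (neg_le_neg hrt)) hb
  have h3 := mul_nonneg ha (Real.exp_pos r).le
  have h4 := mul_nonneg hb (Real.exp_pos (-s)).le
  linarith

end GeodesicCurrents

end

/-! ### Deck transformations along boundary geodesics -/

noncomputable section

namespace GeodesicCurrents

open UpperHalfPlane Filter Topology Set

namespace HyperbolicStructure

variable {S : Type*} [TopologicalSpace S] {h : HyperbolicStructure S}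

/-- Boundary geodesics with a common endpoint are equal, as they are asymptotic. -/
theorem bdry_eq_of_common_end [CompactSpace S] (β β' : h.bdry) {ξ : OnePoint ℝ}
    (hξ : ξ ∈ β.1.1) (hξ' : ξ ∈ β'.1.1) : β = β' := by
  obtain ⟨ε, hε, hsep⟩ := h.exists_separation
  obtain ⟨η, hη⟩ := Sym2.mem_iff_exists.1 hξ
  obtain ⟨η', hη'⟩ := Sym2.mem_iff_exists.1 hξ'
  have hne : η ≠ ξ := fun e => β.1.2 (by rw [hη, e]; simp)
  have hne' : η' ≠ ξ := fun e => β'.1.2 (by rw [hη', e]; simp)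
  have hβ : β.1 = Geodesic.mk η ξ hne := Subtype.ext (hη.trans Sym2.eq_swap)
  have hβ' : β'.1 = Geodesic.mk η' ξ hne' := Subtype.ext (hη'.trans Sym2.eq_swap)
  obtain ⟨T, hT0, hTi⟩ := Geodesic.exists_smul_mk η ξ hne
  obtain ⟨a, ha⟩ : ∃ a : ℝ, T • η' = (a : OnePoint ℝ) := by
    induction hT : T • η' using OnePoint.rec with
    | infty => exact absurd (MulAction.injective T (hT.trans hTi.symm)) hne'
    | coe a => exact ⟨a, rfl⟩
  have hTβ : T • β.1 = Geodesic.base := by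
    rw [hβ]; exact Geodesic.smul_mk_eq hT0 hTi
  have hTβ' : T • β'.1 = Geodesic.mk a OnePoint.infty (OnePoint.coe_ne_infty a) := by
    rw [hβ']; exact Geodesic.smul_mk_eq ha hTi
  -- With the common end at `∞` the two lines are `re = 0` and `re = a`. At height `exp t` the
  -- `cosh` of their distance is the expression below, which tends to `1`, against
  -- `exists_separation`.
  have hlim : Tendsto (fun t : ℝ => 1 + a ^ 2 / 2 * Real.exp (-(2 * t))) atTop (𝓝 (1 + a ^ 2 / 2 * 0)) :=
    ((Real.tendsto_exp_neg_atTop_nhds_zero.comp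
      (tendsto_id.const_mul_atTop (by norm_num : (0 : ℝ) < 2))).const_mul _).const_add _
  rw [mul_zero, add_zero] at hlim
  have h1 : 1 < Real.cosh ε := Real.one_lt_cosh.2 hε.ne'
  obtain ⟨t, ht⟩ := (hlim.eventually_lt_const h1).exists
  let w : ℍ := ⟨⟨a, Real.exp t⟩, Real.exp_pos t⟩
  have hw : w.im = Real.exp t := rfl
  have hw' : w.re = a := rfl
  refine hsep β β' (T⁻¹ • pt t) ?_ (T⁻¹ • w) ?_ ?_
  · rw [← Geodesic.smul_mem_line (g := T), smul_inv_smul, hTβ, Geodesic.mem_line_base, pt_re]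
  · rw [← Geodesic.smul_mem_line (g := T), smul_inv_smul, hTβ', Geodesic.mem_line_infty, hw']
  · rw [dist_smul_gl]
    have h2 : Real.cosh (dist (pt t) w) = 1 + a ^ 2 / 2 * Real.exp (-(2 * t)) := by
      rw [cosh_dist, Complex.dist_eq_re_im, Real.sq_sqrt (by positivity)]
      simp only [coe_re, coe_im, pt_re, pt_im, hw, hw', sub_self]
      rw [Real.exp_neg, two_mul t, Real.exp_add]
      have := (Real.exp_pos t).ne'
      field_simp
      ring
    rw [← h2, Real.cosh_lt_cosh, abs_of_nonneg dist_nonneg, abs_of_pos hε] at ht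
    exact ht

/-- A deck transformation which preserves a boundary geodesic translates along it. -/
theorem exists_dilation_of_smul_eq (β : h.bdry) {g : GL (Fin 2) ℝ} (hg : g ∈ h.deck)
    (hgβ : g • β.1 = β.1) :
    ∃ κ : ℝ, (∀ x : ℝ, h.side β • g • (h.side β)⁻¹ • (x : OnePoint ℝ) =
        ((Real.exp κ * x : ℝ) : OnePoint ℝ)) ∧
      ∀ t, g • (h.side β)⁻¹ • pt t = (h.side β)⁻¹ • pt (t + κ) := by
  set T := h.side β with hT
  set G := T * g * T⁻¹ with hG
  have hdet : 0 < (G : Matrix (Fin 2) (Fin 2) ℝ).det := by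
    have h1 : G.det = g.det := by
      rw [hG, map_mul, map_mul, map_inv, mul_right_comm, mul_inv_cancel, one_mul]
    have h2 := congrArg Units.val h1
    simp only [GeneralLinearGroup.val_det_apply] at h2
    rw [h2]
    exact h.deck_det_pos g hg
  have hbase : G • Geodesic.base = Geodesic.base := by
    rw [hG, mul_smul, mul_smul, ← side_smul β, inv_smul_smul, hgβ]
  have hbase' := congrArg Subtype.val hbase
  change s(G • ((0 : ℝ) : OnePoint ℝ), G • (OnePoint.infty : OnePoint ℝ)) =
    s(((0 : ℝ) : OnePoint ℝ), OnePoint.infty) at hbase'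
  have hfix : G • ((0 : ℝ) : OnePoint ℝ) = ((0 : ℝ) : OnePoint ℝ) ∧
      G • (OnePoint.infty : OnePoint ℝ) = OnePoint.infty := by
    rcases Sym2.eq_iff.1 hbase' with h1 | ⟨h1, h2⟩
    · exact h1
    -- Swapping the ends while preserving orientation would exchange the two sides of `β`, but the
    -- cover lies on one of them.
    · exfalso
      have h11 : G 1 1 = 0 := by simpa using Geodesic.smul_coe_eq_infty h1
      have h00 := Geodesic.smul_infty_eq_zero h2
      rw [Matrix.det_fin_two, h00, h11] at hdet
      obtain ⟨z, hz⟩ := h.interior_nonempty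
      have hz1 : 0 < (T • z).re := side_pos β hz
      have hz2 : 0 ≤ (G • T • z).re := by
        rw [hG, mul_smul, mul_smul, inv_smul_smul]
        exact side_nonneg β ((smul_mem_cover hg).2 (interior_subset hz))
      rw [re_smul_nonneg, aff, h00, h11, klein] at hz2
      nlinarith
  obtain ⟨κ, h1, h2⟩ := exists_dilation hdet hfix.1 hfix.2
  refine ⟨κ, fun x => ?_, fun t => ?_⟩
  · rw [← h1, hG, mul_smul, mul_smul]
  · rw [← h2, hG, mul_smul, mul_smul, inv_smul_smul]

/-- Every boundary geodesic is the axis of a deck transformation. -/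
theorem exists_deck_translation [CompactSpace S] (β : h.bdry) :
    ∃ b ∈ h.deck, ∃ κ > 0, (∀ x : ℝ, h.side β • b • (h.side β)⁻¹ • (x : OnePoint ℝ) =
        ((Real.exp κ * x : ℝ) : OnePoint ℝ)) ∧
      ∀ t, b • (h.side β)⁻¹ • pt t = (h.side β)⁻¹ • pt (t + κ) := by
  set T := h.side β with hT
  have hmem : ∀ t, T⁻¹ • pt t ∈ β.1.line := fun t => by
    rw [mem_line_side, ← hT, smul_inv_smul, pt_re]
  obtain ⟨R, hR⟩ := h.exists_dist_le (pt 0)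
  -- Points at unit spacing along `β` are moved into a fixed ball. Finitely many boundary geodesics
  -- meet that ball, so infinitely many indices send `β` to the same one, and quotients of the
  -- corresponding `g j` preserve `β`.
  choose! g hg hgR using fun j : ℕ => hR (T⁻¹ • pt j) (line_subset_of_mem_bdry β.2 (hmem j))
  have hfin := h.finite_bdry_inter (pt 0) R
  have hmaps : ∀ j : ℕ, g j • β.1 ∈
      {β ∈ h.bdry | (β.line ∩ Metric.closedBall (pt 0) R).Nonempty} := fun j =>
    ⟨smul_mem_bdry (hg j) β.2, g j • T⁻¹ • pt j, Geodesic.smul_mem_line.2 (hmem j), hgR j⟩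
  have := hfin.to_subtype
  obtain ⟨y, hy⟩ := Finite.exists_infinite_fiber (fun j : ℕ => (⟨_, hmaps j⟩ :
    {β ∈ h.bdry | (β.line ∩ Metric.closedBall (pt 0) R).Nonempty}))
  have hinf : Set.Infinite {j : ℕ | g j • β.1 = y.1} := by
    have := Set.infinite_coe_iff.1 hy
    refine this.mono fun j hj => ?_
    exact congrArg Subtype.val hj
  obtain ⟨i, hi⟩ := hinf.nonempty
  -- A gap `j - i > 2 * R` rules out translation length `0`: otherwise `g i` would bring the points
  -- with parameters `i` and `j` within `2 * R` of each other.
  obtain ⟨N, hN⟩ := exists_nat_gt (i + 2 * R)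
  obtain ⟨j, hj, hjN⟩ := hinf.exists_gt N
  have hjN' : (N : ℝ) < j := by exact_mod_cast hjN
  have hg0 : (g i)⁻¹ * g j ∈ h.deck := mul_mem (inv_mem (hg i)) (hg j)
  have hstab : ((g i)⁻¹ * g j) • β.1 = β.1 := by
    have h1 : g j • β.1 = y.1 := hj
    have h2 : g i • β.1 = y.1 := hi
    rw [mul_smul, h1, ← h2, inv_smul_smul]
  have hpos : ∃ b ∈ h.deck, b • β.1 = β.1 ∧ ∃ κ ≠ 0,
      (∀ t, b • T⁻¹ • pt t = T⁻¹ • pt (t + κ)) := by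
    obtain ⟨κ, h1, h2⟩ := exists_dilation_of_smul_eq β hg0 hstab
    refine ⟨_, hg0, hstab, κ, ?_, h2⟩
    rintro rfl
    have h3 := h2 j
    rw [← hT, add_zero, mul_smul, inv_smul_eq_iff] at h3
    have h4 : dist (g i • T⁻¹ • pt j) (g i • T⁻¹ • pt i) ≤ R + R := by
      rw [← h3]
      exact (dist_triangle_right _ _ _).trans (add_le_add (hgR j) (hgR i))
    rw [dist_smul_gl, dist_smul_gl, dist_pt] at h4
    have := le_abs_self ((j : ℝ) - i)
    linarith
  obtain ⟨b, hb, hbβ, κ, hκ, hbt⟩ := hpos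
  have huniq : ∀ κ', (∀ t, b • T⁻¹ • pt t = T⁻¹ • pt (t + κ')) → κ' = κ := by
    intro κ' h'
    have h1 := (h' 0).symm.trans (hbt 0)
    have h2 := congrArg UpperHalfPlane.im (MulAction.injective _ h1)
    simpa using h2
  rcases lt_or_gt_of_ne hκ with hneg | hpos
  · obtain ⟨κ', h1, h2⟩ := exists_dilation_of_smul_eq β (inv_mem hb)
      (inv_smul_eq_iff.2 hbβ.symm)
    refine ⟨b⁻¹, inv_mem hb, κ', ?_, h1, h2⟩
    have h3 := h2 κ
    rw [← hT, inv_smul_eq_iff, hbt] at h3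
    have h4 := congrArg UpperHalfPlane.im (MulAction.injective _ h3)
    simp only [pt_im, Real.exp_eq_exp] at h4
    linarith
  · obtain ⟨κ', h1, h2⟩ := exists_dilation_of_smul_eq β hb hbβ
    exact ⟨b, hb, κ', by rw [huniq κ' h2]; exact hpos, h1, h2⟩

/-- No boundary geodesic is invariant under the whole deck group. -/
theorem exists_deck_smul_ne [CompactSpace S] (β : h.bdry) : ∃ a ∈ h.deck, a • β.1 ≠ β.1 := by
  by_contra! hall
  set T := h.side β with hT
  have hmem : T⁻¹ • pt 0 ∈ β.1.line := by rw [mem_line_side, ← hT, smul_inv_smul, pt_re]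
  obtain ⟨R, hR⟩ := h.exists_dist_le (T⁻¹ • pt 0)
  -- If the deck group preserved `β`, cocompactness would hold the cover within distance `R` of `β`,
  -- hence in a wedge.
  have hbd : ∀ z ∈ h.cover, |(T • z).re| ≤ Real.cosh R * (T • z).im := by
    intro z hz
    obtain ⟨g, hg, hgz⟩ := hR z hz
    have h1 : g⁻¹ • T⁻¹ • pt 0 ∈ β.1.line := by
      rw [← hall g⁻¹ (inv_mem hg), Geodesic.smul_mem_line]
      exact hmem
    rw [mem_line_side] at h1
    obtain ⟨s, hs⟩ := exists_eq_pt h1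
    apply abs_re_le_of_dist_le (s := s)
    rw [← hs, dist_smul_gl, ← dist_smul_gl g, smul_inv_smul]
    exact hgz
  let w : ℍ := ⟨⟨Real.cosh R + 1, 1⟩, one_pos⟩
  have hw : T⁻¹ • w ∉ h.cover := fun hw => by
    have h1 := hbd _ hw
    rw [smul_inv_smul] at h1
    change |Real.cosh R + 1| ≤ Real.cosh R * 1 at h1
    linarith [le_abs_self (Real.cosh R + 1)]
  -- A point outside the wedge yields another boundary geodesic. It remains at bounded distance from
  -- `β` in both directions, which forces it to coincide with `β`.
  obtain ⟨β', hβ'⟩ := exists_side_neg hw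
  have hne : β' ≠ β := by
    rintro rfl
    rw [← hT, smul_inv_smul] at hβ'
    change Real.cosh R + 1 < 0 at hβ'
    linarith [Real.cosh_pos R]
  apply hne
  set M := T * (h.side β')⁻¹ with hM
  have hcov : ∀ t, (h.side β')⁻¹ • pt t ∈ h.cover := fun t =>
    line_subset_of_mem_bdry β'.2 ((mem_line_side β').2 (by rw [smul_inv_smul, pt_re]))
  obtain ⟨d, hd, hMt⟩ := re_smul_pt M
  have hbd' : ∀ t, |M 0 0 * M 1 0 * Real.exp t + M 0 1 * M 1 1 * Real.exp (-t)| ≤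
      Real.cosh R * d := by
    intro t
    have h1 := hbd _ (hcov t)
    rw [← mul_smul, ← hM, hMt, abs_mul, abs_of_pos (M • pt t).im_pos, abs_div, abs_of_pos hd] at h1
    have h2 := le_of_mul_le_mul_right h1 (M • pt t).im_pos
    rwa [div_le_iff₀ hd] at h2
  -- Boundedness kills the coefficient of `exp t`; replacing `t` by `-t` kills the other one.
  have hz : ∀ a b C : ℝ, (∀ t, |a * Real.exp t + b * Real.exp (-t)| ≤ C) → a = 0 := by
    intro a b C hab
    by_contra ha
    have hC : 0 ≤ C := (abs_nonneg _).trans (hab 0)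
    have h0 : 0 ≤ (C + |b|) / |a| := by positivity
    have h1 := hab (Real.log ((C + |b|) / |a| + 1))
    rw [Real.exp_neg, Real.exp_log (by linarith)] at h1
    have h2 : |a * ((C + |b|) / |a| + 1)| = C + |b| + |a| := by
      rw [abs_mul, abs_of_nonneg (by linarith : 0 ≤ (C + |b|) / |a| + 1), mul_add,
        mul_div_cancel₀ _ (abs_ne_zero.2 ha), mul_one]
    have h3 : |b * ((C + |b|) / |a| + 1)⁻¹| ≤ |b| := by
      rw [abs_mul, abs_inv, abs_of_nonneg (by linarith : 0 ≤ (C + |b|) / |a| + 1)]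
      exact mul_le_of_le_one_right (abs_nonneg b) (inv_le_one_of_one_le₀ (by linarith))
    have h4 := abs_sub_abs_le_abs_sub (a * ((C + |b|) / |a| + 1)) (-(b * ((C + |b|) / |a| + 1)⁻¹))
    rw [abs_neg, sub_neg_eq_add] at h4
    have := abs_pos.2 ha
    linarith
  have ha := hz _ _ _ hbd'
  have hb := hz (M 0 1 * M 1 1) (M 0 0 * M 1 0) (Real.cosh R * d) fun t => by
    have := hbd' (-t)
    rwa [neg_neg, add_comm] at this
  have h0 := hMt 0
  rw [ha, hb] at h0
  refine bdry_eq_of_mem (x := (h.side β')⁻¹ • pt 0)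
    ((mem_line_side β').2 (by rw [smul_inv_smul, pt_re])) ((mem_line_side β).2 ?_)
  rw [← mul_smul, ← hT, ← hM, h0]
  simp

end HyperbolicStructure

end GeodesicCurrents

end

/-! ### Fixed points of the products `b ^ n * a` -/

noncomputable section

namespace GeodesicCurrents

open UpperHalfPlane Filter Topology Set

/-- The fixed points of a family of Möbius transformations degenerating to a parabolic-like limit,
as the roots of quadratic equations. -/
theorem exists_roots (q r s : ℝ) (hr : r ≠ 0) {ε : ℕ → ℝ} (hε : ∀ n, 0 < ε n)
    (hε0 : Tendsto ε atTop (𝓝 0)) :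
    ∃ x y : ℕ → ℝ, Tendsto x atTop (𝓝 (-q)) ∧ Tendsto (fun n => ε n * y n) atTop (𝓝 (1 / r)) ∧
      ∀ᶠ n in atTop, x n + q = ε n * x n * (r * x n + s) ∧
        y n + q = ε n * y n * (r * y n + s) := by
  -- Both equations read `ε r u² - B u - q = 0`. The sequence `y` is the root that escapes to
  -- infinity; `x` is the other one, written through the product of the roots so that its limit as
  -- `ε → 0` is visible.
  set B : ℕ → ℝ := fun n => 1 - ε n * s with hB
  set Δ : ℕ → ℝ := fun n => B n ^ 2 + 4 * ε n * r * q with hΔ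
  set D : ℕ → ℝ := fun n => B n + Real.sqrt (Δ n) with hD
  have hBl : Tendsto B atTop (𝓝 1) := by
    have := (hε0.mul_const s).const_sub 1
    rwa [zero_mul, sub_zero] at this
  have hΔl : Tendsto Δ atTop (𝓝 1) := by
    have := (hBl.pow 2).add (((hε0.const_mul 4).mul_const r).mul_const q)
    simpa using this
  have hDl : Tendsto D atTop (𝓝 2) := by
    have := hBl.add ((Real.continuous_sqrt.tendsto 1).comp hΔl)
    rw [Real.sqrt_one] at this
    convert this using 2
    · rfl
    · norm_num
  refine ⟨fun n => -2 * q / D n, fun n => D n / (2 * ε n * r), ?_, ?_, ?_⟩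
  · have := (tendsto_const_nhds (x := -2 * q)).div hDl (by norm_num)
    rw [show -2 * q / 2 = -q by ring] at this
    exact this
  · have := hDl.div_const (2 * r)
    convert this using 2 with n
    · have := (hε n).ne'
      field_simp
    · field_simp
  · filter_upwards [hDl.eventually_const_lt (by norm_num : (0 : ℝ) < 2),
      hΔl.eventually_const_lt (by norm_num : (0 : ℝ) < 1)] with n hn hn'
    have h1 : Real.sqrt (Δ n) ^ 2 = Δ n := Real.sq_sqrt hn'.le
    have h2 : D n ^ 2 = 2 * B n * D n + 4 * ε n * r * q := by
      linear_combination h1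
    have h3 : B n = 1 - ε n * s := rfl
    have h4 := (hε n).ne'
    have h5 := hn.ne'
    rw [h3] at h2
    constructor
    · field_simp
      linear_combination q * h2
    · field_simp
      linear_combination -h2

/-- The curve `f` is abstract so as to cover points of a line, points of the circle at infinity and,
when constant, objects fixed by `g`. -/
theorem zpow_smul_of_forall {G X : Type*} [Group G] [MulAction G X] {g : G} {f : ℝ → X} {ℓ : ℝ}
    (hf : ∀ t, g • f t = f (t + ℓ)) (k : ℤ) (t : ℝ) : g ^ k • f t = f (t + k * ℓ) := by
  induction k using Int.induction_on generalizing t with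
  | zero => simp
  | succ n ih =>
    rw [_root_.zpow_add_one, mul_smul, hf, ih]
    congr 1
    push_cast
    ring
  | pred n ih =>
    rw [_root_.zpow_sub_one, mul_smul, inv_smul_eq_iff.2 (show f t = g • f (t - ℓ) by rw [hf]; simp), ih]
    congr 1
    push_cast
    ring

/-- The orbit of `v` accumulates at both fixed points of the dilation; this will put the ends of the
axes into the closed ideal boundary. -/
theorem mem_of_forall_dilation {C : Set (OnePoint ℝ)} (hC : IsClosed C) {v ℓ : ℝ} (hv : v ≠ 0)
    (hℓ : ℓ ≠ 0) (h : ∀ j : ℤ, ((Real.exp (j * ℓ) * v : ℝ) : OnePoint ℝ) ∈ C) :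
    ((0 : ℝ) : OnePoint ℝ) ∈ C ∧ OnePoint.infty ∈ C := by
  wlog hpos : 0 < ℓ generalizing ℓ
  · refine this (neg_ne_zero.2 hℓ) (fun j => ?_) (by
      rcases lt_or_gt_of_ne hℓ with h' | h'
      · linarith
      · exact absurd h' hpos)
    have := h (-j)
    push_cast at this
    rwa [neg_mul, ← mul_neg] at this
  have hlim : Tendsto (fun n : ℕ => (n : ℝ) * ℓ) atTop atTop :=
    tendsto_natCast_atTop_atTop.atTop_mul_const hpos
  constructor
  · refine hC.mem_of_tendsto (f := fun n : ℕ => ((Real.exp (-((n : ℝ) * ℓ)) * v : ℝ) : OnePoint ℝ))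
      (b := atTop) ?_ (Eventually.of_forall fun n => ?_)
    · refine (OnePoint.continuous_coe.tendsto (0 : ℝ)).comp ?_
      have := (Real.tendsto_exp_neg_atTop_nhds_zero.comp hlim).mul_const v
      rwa [zero_mul] at this
    · have := h (-n)
      push_cast at this
      rwa [neg_mul] at this
  · refine hC.mem_of_tendsto (f := fun n : ℕ => ((Real.exp ((n : ℝ) * ℓ) * v : ℝ) : OnePoint ℝ))
      (b := atTop) ?_ (Eventually.of_forall fun n => ?_)
    · refine tendsto_infty_of_abs fun M => ?_
      filter_upwards [((Real.tendsto_exp_atTop.comp hlim).atTop_mul_const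
        (abs_pos.2 hv)).eventually_ge_atTop M] with n hn x hx
      rw [OnePoint.coe_eq_coe] at hx
      rw [← hx, abs_mul, Real.abs_exp]
      exact hn
    · have := h n
      push_cast at this
      exact this

theorem smul_coe_of_eq {A : GL (Fin 2) ℝ} {x e : ℝ}
    (hx : A 0 0 * x + A 0 1 = e * x * (A 1 0 * x + A 1 1)) :
    A • (x : OnePoint ℝ) = ((e * x : ℝ) : OnePoint ℝ) := by
  have hd := det_ne_zero A
  have h1 : A 1 0 * x + A 1 1 ≠ 0 := by
    intro h1
    rw [h1, mul_zero] at hx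
    have h2 : A 0 1 = -(A 0 0 * x) := by linarith
    have h3 : A 1 1 = -(A 1 0 * x) := by linarith
    rw [h2, h3] at hd
    exact hd (by ring)
  rw [OnePoint.smul_some_eq_ite, if_neg h1, hx, mul_div_cancel_right₀ _ h1]

namespace HyperbolicStructure

variable {S : Type*} [TopologicalSpace S] {h : HyperbolicStructure S}

variable (h) in
/-- A translation `b` along a boundary geodesic `β`, another deck transformation `a` and the fixed
points of the products `b ^ n * a`. -/
structure AxisFamily (β : h.bdry) where
  b : GL (Fin 2) ℝ
  a : GL (Fin 2) ℝ
  b_mem : b ∈ h.deck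
  a_mem : a ∈ h.deck
  κ : ℝ
  κ_pos : 0 < κ
  smul_coe : ∀ x : ℝ, h.side β • b • (h.side β)⁻¹ • (x : OnePoint ℝ) =
    ((Real.exp κ * x : ℝ) : OnePoint ℝ)
  smul_pt : ∀ t, b • (h.side β)⁻¹ • pt t = (h.side β)⁻¹ • pt (t + κ)
  a_smul_ne : a • β.1 ≠ β.1
  x : ℕ → ℝ
  y : ℕ → ℝ
  x_ne : ∀ n, x n ≠ 0
  y_ne : ∀ n, y n ≠ 0
  x_ne_y : ∀ n, x n ≠ y n
  x₀ : ℝ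
  tendsto_x : Tendsto x atTop (𝓝 x₀)
  c : ℝ
  c_ne : c ≠ 0
  tendsto_y : Tendsto (fun n : ℕ => Real.exp (-(n * κ)) * y n) atTop (𝓝 c)
  N : ℕ
  fix_x : ∀ n ≥ N, (b ^ n * a) • (h.side β)⁻¹ • (x n : OnePoint ℝ) = (h.side β)⁻¹ • (x n : OnePoint ℝ)
  fix_y : ∀ n ≥ N, (b ^ n * a) • (h.side β)⁻¹ • (y n : OnePoint ℝ) = (h.side β)⁻¹ • (y n : OnePoint ℝ)

theorem inv_side_smul_coe_mem (β : h.bdry) :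
    (h.side β)⁻¹ • ((0 : ℝ) : OnePoint ℝ) ∈ β.1.1 ∧
      (h.side β)⁻¹ • (OnePoint.infty : OnePoint ℝ) ∈ β.1.1 := by
  have h1 : β.1 = (h.side β)⁻¹ • Geodesic.base := by rw [← side_smul β, inv_smul_smul]
  have h2 : β.1.1 = s((h.side β)⁻¹ • ((0 : ℝ) : OnePoint ℝ),
      (h.side β)⁻¹ • (OnePoint.infty : OnePoint ℝ)) := congrArg Subtype.val h1
  rw [h2]
  exact ⟨Sym2.mem_mk_left _ _, Sym2.mem_mk_right _ _⟩

theorem smul_mem_smul {g : GL (Fin 2) ℝ} {γ : Geodesic} {ξ : OnePoint ℝ} (hξ : ξ ∈ γ.1) :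
    g • ξ ∈ (g • γ).1 := Sym2.mem_map.2 ⟨ξ, hξ, rfl⟩

theorem zpow_smul_coe {β : h.bdry} {b : GL (Fin 2) ℝ} {κ : ℝ}
    (hb : ∀ x : ℝ, h.side β • b • (h.side β)⁻¹ • (x : OnePoint ℝ) =
      ((Real.exp κ * x : ℝ) : OnePoint ℝ)) (k : ℤ) (x : ℝ) :
    b ^ k • (h.side β)⁻¹ • (x : OnePoint ℝ) =
      (h.side β)⁻¹ • ((Real.exp (k * κ) * x : ℝ) : OnePoint ℝ) := by
  have h1 := zpow_smul_of_forall (g := b) (ℓ := κ)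
    (f := fun t => (h.side β)⁻¹ • ((Real.exp t * x : ℝ) : OnePoint ℝ)) (fun t => by
      rw [eq_inv_smul_iff, hb, Real.exp_add, mul_left_comm, mul_assoc]) k 0
  simpa using h1

/-- Distinct boundary geodesics share no end, so `a` takes no end of `β` to an end of `β`; with `β`
as imaginary axis this makes three entries of `A` nonzero. Since `b` is multiplication by `exp κ`, a
fixed point `u` of `b ^ n * a` satisfies `A • u = exp (-n κ) * u`, the quadratic equation of
`exists_roots`. -/
theorem nonempty_axisFamily [CompactSpace S] (β : h.bdry) : Nonempty (h.AxisFamily β) := by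
  obtain ⟨b, hb, κ, hκ, hbx, hbt⟩ := exists_deck_translation β
  obtain ⟨a, ha, haβ⟩ := exists_deck_smul_ne β
  set A := h.side β * a * (h.side β)⁻¹ with hA
  have hne : ∀ ξ ∈ β.1.1, ∀ η ∈ β.1.1, a • ξ ≠ η := by
    intro ξ hξ η hη e
    refine haβ (congrArg Subtype.val (bdry_eq_of_common_end ⟨a • β.1, smul_mem_bdry ha β.2⟩ β
      (ξ := η) ?_ hη))
    rw [← e]
    exact smul_mem_smul hξ
  have hAne : ∀ ξ η : OnePoint ℝ, (h.side β)⁻¹ • ξ ∈ β.1.1 → (h.side β)⁻¹ • η ∈ β.1.1 →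
      A • ξ ≠ η := by
    intro ξ η hξ hη e
    refine hne _ hξ _ hη ?_
    rw [eq_inv_smul_iff, ← e, hA, mul_smul, mul_smul]
  obtain ⟨hm0, hmi⟩ := inv_side_smul_coe_mem β
  have hp : A 0 0 ≠ 0 := fun e => hAne _ _ hmi hm0 (by
    have h10 : A 1 0 ≠ 0 := fun e' => det_ne_zero A (by rw [e, e']; ring)
    rw [OnePoint.smul_infty_eq_ite, if_neg h10, e, zero_div])
  have hr : A 1 0 ≠ 0 := fun e => hAne _ _ hmi hmi (by
    rw [OnePoint.smul_infty_eq_ite, if_pos e])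
  have hq : A 0 1 ≠ 0 := fun e => hAne _ _ hm0 hm0 (by
    have h11 : A 1 1 ≠ 0 := fun e' => det_ne_zero A (by rw [e, e']; ring)
    rw [OnePoint.smul_some_eq_ite, if_neg (by simpa using h11), e, mul_zero, zero_add, zero_div])
  have hlim : Tendsto (fun n : ℕ => (n : ℝ) * κ) atTop atTop :=
    tendsto_natCast_atTop_atTop.atTop_mul_const hκ
  obtain ⟨x, y, hx, hy, hxy⟩ := exists_roots (A 0 1 / A 0 0) (A 1 0 / A 0 0) (A 1 1 / A 0 0)
    (div_ne_zero hr hp) (ε := fun n : ℕ => Real.exp (-(n * κ))) (fun n => Real.exp_pos _)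
    (Real.tendsto_exp_neg_atTop_nhds_zero.comp hlim)
  have hc : 1 / (A 1 0 / A 0 0) ≠ 0 := one_div_ne_zero (div_ne_zero hr hp)
  have hx0 : -(A 0 1 / A 0 0) ≠ 0 := neg_ne_zero.2 (div_ne_zero hq hp)
  have hxy0 : Tendsto (fun n : ℕ => Real.exp (-(n * κ)) * (y n - x n)) atTop
      (𝓝 (1 / (A 1 0 / A 0 0))) := by
    have := hy.sub ((Real.tendsto_exp_neg_atTop_nhds_zero.comp hlim).mul hx)
    rw [zero_mul, sub_zero] at this
    convert this using 2 with n
    exact mul_sub _ _ _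
  obtain ⟨N, hN⟩ := eventually_atTop.1 (((hx.eventually_ne hx0).and (hy.eventually_ne hc)).and
    ((hxy0.eventually_ne hc).and hxy))
  have hfix : ∀ (n : ℕ) (u : ℝ), u + A 0 1 / A 0 0 =
      Real.exp (-(n * κ)) * u * (A 1 0 / A 0 0 * u + A 1 1 / A 0 0) →
      (b ^ n * a) • (h.side β)⁻¹ • (u : OnePoint ℝ) = (h.side β)⁻¹ • (u : OnePoint ℝ) := by
    intro n u hu
    have h1 : A • (u : OnePoint ℝ) = ((Real.exp (-(n * κ)) * u : ℝ) : OnePoint ℝ) := by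
      apply smul_coe_of_eq
      field_simp at hu
      linear_combination hu
    have h2 : a • (h.side β)⁻¹ • (u : OnePoint ℝ) =
        (h.side β)⁻¹ • ((Real.exp (-(n * κ)) * u : ℝ) : OnePoint ℝ) := by
      rw [eq_inv_smul_iff, ← h1, hA, mul_smul, mul_smul]
    rw [mul_smul, h2, ← zpow_natCast, zpow_smul_coe hbx, ← mul_assoc, ← Real.exp_add]
    simp
  have hev : ∀ᶠ n : ℕ in atTop, ¬ n < N := (eventually_ge_atTop N).mono fun n hn => not_lt.2 hn
  -- Below `N` the ends are replaced by the defaults `1` and `2`, which are nonzero and distinct;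
  -- the limits are not affected.
  have hy' : Tendsto (fun n : ℕ => Real.exp (-(n * κ)) * if n < N then 2 else y n) atTop
      (𝓝 (1 / (A 1 0 / A 0 0))) := hy.congr' (hev.mono fun n hn => by
        simp only [if_neg hn])
  exact ⟨{
    b := b
    a := a
    b_mem := hb
    a_mem := ha
    κ := κ
    κ_pos := hκ
    smul_coe := hbx
    smul_pt := hbt
    a_smul_ne := haβ
    x := fun n => if n < N then 1 else x n
    y := fun n => if n < N then 2 else y n
    x_ne := fun n => by
      split_ifs with hn
      · exact one_ne_zero
      · exact (hN n (not_lt.1 hn)).1.1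
    y_ne := fun n => by
      split_ifs with hn
      · exact two_ne_zero
      · exact fun e => (hN n (not_lt.1 hn)).1.2 (by rw [e, mul_zero])
    x_ne_y := fun n => by
      split_ifs with hn
      · norm_num
      · exact fun e => (hN n (not_lt.1 hn)).2.1 (by rw [e, sub_self, mul_zero])
    x₀ := _
    tendsto_x := hx.congr' (hev.mono fun n hn => (if_neg hn).symm)
    c := _
    c_ne := hc
    tendsto_y := hy'
    N := N
    fix_x := fun n hn => by
      rw [if_neg (not_lt.2 hn)]
      exact hfix n _ (hN n hn).2.2.1
    fix_y := fun n hn => by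
      rw [if_neg (not_lt.2 hn)]
      exact hfix n _ (hN n hn).2.2.2 }⟩

end HyperbolicStructure

end GeodesicCurrents

end

/-! ### The axes and their approach to the boundary geodesic -/

noncomputable section

namespace GeodesicCurrents

open UpperHalfPlane Filter Topology Set

theorem Geodesic.exists_nhds_prod {x y : OnePoint ℝ} (hxy : x ≠ y) {V : Set Geodesic}
    (hV : V ∈ 𝓝 (mk x y hxy)) : ∃ U₁ ∈ 𝓝 x, ∃ U₂ ∈ 𝓝 y, ∀ u ∈ U₁, ∀ v ∈ U₂, ∀ huv : u ≠ v,
      mk u v huv ∈ V := by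
  rw [nhds_mk, mem_comap] at hV
  obtain ⟨W, hW, hWV⟩ := hV
  have h1 := (isOpenQuotientMap_sym2_mk (X := OnePoint ℝ)).continuous.tendsto (x, y) hW
  rw [mem_map, nhds_prod_eq, mem_prod_iff] at h1
  obtain ⟨U₁, hU₁, U₂, hU₂, hU⟩ := h1
  exact ⟨U₁, hU₁, U₂, hU₂, fun u hu v hv huv => hWV (hU (mk_mem_prod hu hv))⟩

theorem Geodesic.exists_radius_of_mem_nhds_base {V : Set Geodesic} (hV : V ∈ 𝓝 base) :
    ∃ η > 0, ∃ B : ℝ, ∀ u v : ℝ, |u| < η → B < |v| →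
      ∀ huv : (u : OnePoint ℝ) ≠ v, mk u v huv ∈ V := by
  obtain ⟨U₁, hU₁, U₂, hU₂, hU⟩ := exists_nhds_prod _ hV
  obtain ⟨η, hη, hηU⟩ := Metric.mem_nhds_iff.1 (OnePoint.continuous_coe.continuousAt hU₁)
  have hlim : Tendsto (fun v : ℝ => (v : OnePoint ℝ)) (comap (|·|) atTop) (𝓝 OnePoint.infty) :=
    tendsto_infty_of_abs fun M => by
      filter_upwards [preimage_mem_comap (eventually_ge_atTop M)] with v hv x hx
      rw [OnePoint.coe_eq_coe] at hx
      rwa [← hx]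
  obtain ⟨t, ht, htU⟩ := mem_comap.1 (hlim hU₂)
  obtain ⟨B, hB⟩ := mem_atTop_sets.1 ht
  refine ⟨η, hη, B, fun u v hu hv huv => hU _ (hηU ?_) _ (htU (hB _ hv.le)) huv⟩
  simpa using hu

namespace HyperbolicStructure

variable {S : Type*} [TopologicalSpace S] {h : HyperbolicStructure S}

theorem end_mem_idealBoundary {γ : Geodesic} (hγ : γ.line ⊆ h.cover) {ξ : OnePoint ℝ}
    (hξ : ξ ∈ γ.1) : ξ ∈ h.idealBoundary := mem_geodesicSet_iff.2 hγ ξ hξ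

namespace AxisFamily

variable {β : h.bdry} (D : h.AxisFamily β)

/-- The axis of `b ^ n * a`. -/
def geo (n : ℕ) : Geodesic :=
  (h.side β)⁻¹ • Geodesic.mk (D.x n) (D.y n) (OnePoint.coe_injective.ne (D.x_ne_y n))

/-- The hyperbolic element `b ^ n * a`. -/
def elt (n : ℕ) : GL (Fin 2) ℝ := D.b ^ n * D.a

theorem elt_mem (n : ℕ) : D.elt n ∈ h.deck := mul_mem (pow_mem D.b_mem n) D.a_mem

theorem zpow_smul_pt (k : ℤ) (t : ℝ) :
    D.b ^ k • (h.side β)⁻¹ • pt t = (h.side β)⁻¹ • pt (t + k * D.κ) :=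
  zpow_smul_of_forall (f := fun t => (h.side β)⁻¹ • pt t) D.smul_pt k t

theorem pt_mem (t : ℝ) : (h.side β)⁻¹ • pt t ∈ β.1.line := by
  rw [mem_line_side, smul_inv_smul, pt_re]

theorem b_smul : D.b • β.1 = β.1 := by
  have h1 : (⟨D.b • β.1, smul_mem_bdry D.b_mem β.2⟩ : h.bdry) = β :=
    bdry_eq_of_mem (x := D.b • (h.side β)⁻¹ • pt 0) (Geodesic.smul_mem_line.2 (pt_mem 0))
      (by rw [D.smul_pt]; exact pt_mem _)
  exact congrArg Subtype.val h1

theorem zpow_smul_bdry (k : ℤ) : D.b ^ k • β.1 = β.1 := by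
  have := zpow_smul_of_forall (g := D.b) (f := fun _ : ℝ => β.1) (ℓ := 0) (fun _ => D.b_smul) k 0
  exact this

theorem elt_smul_ne (n : ℕ) : D.elt n • β.1 ≠ β.1 := by
  intro e
  apply D.a_smul_ne
  rw [elt, mul_smul, ← zpow_natCast] at e
  rw [← inv_smul_eq_iff.2 e.symm, ← _root_.zpow_neg, D.zpow_smul_bdry]

theorem elt_smul_geo {n : ℕ} (hn : D.N ≤ n) : D.elt n • D.geo n = D.geo n := by
  have h1 : D.geo n = Geodesic.mk ((h.side β)⁻¹ • (D.x n : OnePoint ℝ))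
      ((h.side β)⁻¹ • (D.y n : OnePoint ℝ))
      ((MulAction.injective _).ne (OnePoint.coe_injective.ne (D.x_ne_y n))) :=
    Geodesic.smul_mk_eq rfl rfl
  rw [h1]
  exact Geodesic.smul_mk_eq (D.fix_x n hn) (D.fix_y n hn)

/-- The element `b ^ n * a` translates along its axis. -/
theorem exists_translation {n : ℕ} (hn : D.N ≤ n) : ∃ (T : GL (Fin 2) ℝ) (ℓ : ℝ), ℓ ≠ 0 ∧
    T • (h.side β)⁻¹ • (D.x n : OnePoint ℝ) = ((0 : ℝ) : OnePoint ℝ) ∧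
    T • (h.side β)⁻¹ • (D.y n : OnePoint ℝ) = OnePoint.infty ∧
    (∀ u : ℝ, T • D.elt n • T⁻¹ • (u : OnePoint ℝ) = ((Real.exp ℓ * u : ℝ) : OnePoint ℝ)) ∧
    ∀ t, D.elt n • T⁻¹ • pt t = T⁻¹ • pt (t + ℓ) := by
  obtain ⟨T, hT0, hTi⟩ := Geodesic.exists_smul_mk ((h.side β)⁻¹ • (D.x n : OnePoint ℝ))
    ((h.side β)⁻¹ • (D.y n : OnePoint ℝ))
    ((MulAction.injective _).ne (OnePoint.coe_injective.ne (D.x_ne_y n)))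
  set G := T * D.elt n * T⁻¹ with hG
  have hdet : 0 < (G : Matrix (Fin 2) (Fin 2) ℝ).det := by
    have h1 : G.det = (D.elt n).det := by
      rw [hG, map_mul, map_mul, map_inv, mul_right_comm, mul_inv_cancel, one_mul]
    have h2 := congrArg Units.val h1
    simp only [GeneralLinearGroup.val_det_apply] at h2
    rw [h2]
    exact h.deck_det_pos _ (D.elt_mem n)
  obtain ⟨ℓ, h1, h2⟩ := exists_dilation hdet
    (by rw [hG, mul_smul, mul_smul, inv_smul_eq_iff.2 hT0.symm, elt, D.fix_x n hn, hT0])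
    (by rw [hG, mul_smul, mul_smul, inv_smul_eq_iff.2 hTi.symm, elt, D.fix_y n hn, hTi])
  have h3 : ∀ t, D.elt n • T⁻¹ • pt t = T⁻¹ • pt (t + ℓ) := fun t => by
    rw [← h2, hG, mul_smul, mul_smul, inv_smul_smul]
  refine ⟨T, ℓ, ?_, hT0, hTi, fun u => by rw [← h1, hG, mul_smul, mul_smul], h3⟩
  -- With translation length `0` two points would be fixed and `b ^ n * a` would be scalar, although
  -- it moves `β`.
  rintro rfl
  have htriv : IsTriv (D.elt n) := smul_eq_self_of_fixes_two (h.deck_det_pos _ (D.elt_mem n))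
    (z := T⁻¹ • pt 0) (w := T⁻¹ • pt 1) (fun e => by
      have := congrArg UpperHalfPlane.im (MulAction.injective _ e)
      rw [pt_im, pt_im, Real.exp_eq_exp] at this
      exact zero_ne_one this) (by simpa using h3 0) (by simpa using h3 1)
  exact D.elt_smul_ne n (htriv.smul_geodesic _)

/-- An end of `β` is different from the ends of the axis, so its translates under powers of `b ^ n *
a` accumulate at both of them; the ideal boundary is closed and contains these translates. -/
theorem geo_mem_geodesicSet {n : ℕ} (hn : D.N ≤ n) : D.geo n ∈ h.geodesicSet := by
  obtain ⟨T, ℓ, hℓ, hT0, hTi, hTu, -⟩ := D.exists_translation hn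
  obtain ⟨v, hv⟩ : ∃ v : ℝ, T • (h.side β)⁻¹ • (OnePoint.infty : OnePoint ℝ) = (v : OnePoint ℝ) := by
    induction hT : T • (h.side β)⁻¹ • (OnePoint.infty : OnePoint ℝ) using OnePoint.rec with
    | infty =>
      exact absurd (MulAction.injective _ (MulAction.injective _ (hT.trans hTi.symm)))
        (OnePoint.infty_ne_coe _)
    | coe a => exact ⟨a, rfl⟩
  have hv0 : v ≠ 0 := by
    rintro rfl
    exact OnePoint.infty_ne_coe _ (MulAction.injective _ (MulAction.injective _
      (hv.trans hT0.symm)))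
  have hC : IsClosed ((T⁻¹ • · : OnePoint ℝ → OnePoint ℝ) ⁻¹' h.idealBoundary) :=
    isClosed_idealBoundary.preimage (continuous_smul_onePoint T⁻¹)
  have hmem : ∀ j : ℤ, ((Real.exp (j * ℓ) * v : ℝ) : OnePoint ℝ) ∈
      (T⁻¹ • · : OnePoint ℝ → OnePoint ℝ) ⁻¹' h.idealBoundary := by
    intro j
    have h1 := zpow_smul_of_forall (g := D.elt n) (ℓ := ℓ)
      (f := fun t => T⁻¹ • ((Real.exp t * v : ℝ) : OnePoint ℝ)) (fun t => by
        rw [eq_inv_smul_iff, hTu, Real.exp_add, mul_left_comm, mul_assoc]) j 0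
    simp only [Real.exp_zero, one_mul, zero_add] at h1
    rw [mem_preimage, ← h1, ← hv, inv_smul_smul]
    have hj : D.elt n ^ j ∈ h.deck := zpow_mem (D.elt_mem n) j
    exact end_mem_idealBoundary (smul_line_subset hj (line_subset_of_mem_bdry β.2))
      (smul_mem_smul (inv_side_smul_coe_mem β).2)
  obtain ⟨h0, hi⟩ := mem_of_forall_dilation hC hv0 hℓ hmem
  intro ξ hξ
  have hξ' : ξ ∈ s((h.side β)⁻¹ • (D.x n : OnePoint ℝ), (h.side β)⁻¹ • (D.y n : OnePoint ℝ)) := hξ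
  rcases Sym2.mem_iff.1 hξ' with rfl | rfl
  · rw [inv_smul_eq_iff.2 hT0.symm |>.symm]
    exact h0
  · rw [inv_smul_eq_iff.2 hTi.symm |>.symm]
    exact hi

theorem zpow_smul_geo (k : ℤ) (n : ℕ) : D.b ^ k • D.geo n =
    (h.side β)⁻¹ • Geodesic.mk ((Real.exp (k * D.κ) * D.x n : ℝ) : OnePoint ℝ)
      ((Real.exp (k * D.κ) * D.y n : ℝ) : OnePoint ℝ) (OnePoint.coe_injective.ne
        ((mul_right_injective₀ (Real.exp_pos _).ne').ne (D.x_ne_y n))) := by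
  rw [eq_inv_smul_iff, geo, ← mul_smul, ← mul_smul]
  apply Geodesic.smul_mk_eq
  · rw [mul_smul, mul_smul, zpow_smul_coe D.smul_coe, smul_inv_smul]
  · rw [mul_smul, mul_smul, zpow_smul_coe D.smul_coe, smul_inv_smul]

theorem zpow_smul_geo_injective (n : ℕ) : Function.Injective fun k : ℤ => D.b ^ k • D.geo n := by
  intro k l hkl
  simp only [zpow_smul_geo] at hkl
  have h1 := congrArg Geodesic.ends (smul_left_cancel _ hkl)
  change s(((Real.exp (k * D.κ) * D.x n : ℝ) : OnePoint ℝ),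
      ((Real.exp (k * D.κ) * D.y n : ℝ) : OnePoint ℝ)) =
    s(((Real.exp (l * D.κ) * D.x n : ℝ) : OnePoint ℝ),
      ((Real.exp (l * D.κ) * D.y n : ℝ) : OnePoint ℝ)) at h1
  -- If the two ends agree only after a swap, the product of the ends still shows that the squares
  -- of the dilation factors agree.
  have hsq : Real.exp (k * D.κ) ^ 2 = Real.exp (l * D.κ) ^ 2 := by
    rcases Sym2.eq_iff.1 h1 with ⟨h2, -⟩ | ⟨h2, h3⟩
    · rw [OnePoint.coe_eq_coe] at h2
      rw [mul_right_cancel₀ (D.x_ne n) h2]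
    · rw [OnePoint.coe_eq_coe] at h2 h3
      apply mul_right_cancel₀ (mul_ne_zero (D.x_ne n) (D.y_ne n))
      linear_combination Real.exp (k * D.κ) * D.y n * h2 + Real.exp (l * D.κ) * D.y n * h3
  have h4 := (pow_left_inj₀ (Real.exp_pos _).le (Real.exp_pos _).le two_ne_zero).1 hsq
  exact_mod_cast mul_right_cancel₀ D.κ_pos.ne' (Real.exp_injective h4)

theorem tendsto_nat_mul_κ : Tendsto (fun n : ℕ => (n : ℝ) * D.κ) atTop atTop :=
  tendsto_natCast_atTop_atTop.atTop_mul_const D.κ_pos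

/-- Most of the translates of the axes under the powers of `b` are close to `β`. -/
theorem exists_forall_mem_nhds {V : Set Geodesic} (hV : V ∈ 𝓝 β.1) : ∃ M : ℕ, ∀ n k : ℕ, M ≤ k →
    k + M ≤ n → D.b ^ (-(k : ℤ)) • D.geo n ∈ V := by
  have hβ : (h.side β)⁻¹ • Geodesic.base = β.1 := by rw [← side_smul β, inv_smul_smul]
  have hV' : ((h.side β)⁻¹ • · : Geodesic → Geodesic) ⁻¹' V ∈ 𝓝 Geodesic.base :=
    (continuous_const_smul (h.side β)⁻¹).continuousAt (by rw [hβ]; exact hV)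
  obtain ⟨η, hη, B, hηB⟩ := Geodesic.exists_radius_of_mem_nhds_base hV'
  obtain ⟨n₁, hn₁⟩ := eventually_atTop.1
    ((D.tendsto_x.abs.eventually_lt_const (lt_add_one |D.x₀|)).and
      (D.tendsto_y.abs.eventually_const_lt (half_lt_self (abs_pos.2 D.c_ne))))
  have hx0 : 0 < |D.x₀| + 1 := by positivity
  have hc0 : 0 < |D.c| / 2 := half_pos (abs_pos.2 D.c_ne)
  have hl1 := (Real.tendsto_exp_neg_atTop_nhds_zero.comp D.tendsto_nat_mul_κ).mul_const (|D.x₀| + 1)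
  rw [zero_mul] at hl1
  have hl2 := (Real.tendsto_exp_atTop.comp D.tendsto_nat_mul_κ).atTop_mul_const hc0
  obtain ⟨M, hM1, hM2, hM3⟩ := ((hl1.eventually_lt_const hη).and
    ((hl2.eventually_gt_atTop B).and (eventually_ge_atTop n₁))).exists
  refine ⟨M, fun n k hk hkn => ?_⟩
  obtain ⟨hx, hy⟩ := hn₁ n (by omega)
  have hk' : (M : ℝ) * D.κ ≤ k * D.κ :=
    mul_le_mul_of_nonneg_right (Nat.cast_le.2 hk) D.κ_pos.le
  have hkn' : (k : ℝ) * D.κ + M * D.κ ≤ n * D.κ := by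
    rw [← add_mul]
    exact mul_le_mul_of_nonneg_right (by exact_mod_cast hkn) D.κ_pos.le
  -- The ends become `exp (-k κ) * x n`, near `0` once `k ≥ M`, and `exp ((n - k) κ)` times the
  -- convergent factor `exp (-n κ) * y n`, near `∞` once `n - k ≥ M`.
  rw [zpow_smul_geo]
  refine hηB _ _ ?_ ?_ _
  · rw [abs_mul, Real.abs_exp]
    refine lt_of_le_of_lt ?_ hM1
    refine mul_le_mul (Real.exp_le_exp.2 ?_) hx.le (abs_nonneg _) (Real.exp_pos _).le
    push_cast
    linarith
  · have h1 : Real.exp ((-(k : ℤ) : ℤ) * D.κ) * D.y n =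
        Real.exp (n * D.κ - k * D.κ) * (Real.exp (-(n * D.κ)) * D.y n) := by
      rw [← mul_assoc, ← Real.exp_add]
      congr 2
      push_cast
      ring
    rw [h1, abs_mul, Real.abs_exp]
    refine lt_of_lt_of_le hM2 ?_
    exact mul_le_mul (Real.exp_le_exp.2 (by linarith)) hy.le hc0.le (Real.exp_pos _).le

/-- All axes pass through a fixed ball. -/
theorem exists_near : ∃ R, ∀ᶠ n in atTop, ∃ w ∈ (D.geo n).line,
    dist w ((h.side β)⁻¹ • pt 0) ≤ R := by
  have hy : Tendsto (fun n => (D.y n : OnePoint ℝ)) atTop (𝓝 OnePoint.infty) := by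
    refine tendsto_infty_of_abs fun M => ?_
    have hc0 : 0 < |D.c| / 2 := half_pos (abs_pos.2 D.c_ne)
    filter_upwards [D.tendsto_y.abs.eventually_const_lt (half_lt_self (abs_pos.2 D.c_ne)),
      ((Real.tendsto_exp_atTop.comp D.tendsto_nat_mul_κ).atTop_mul_const hc0).eventually_ge_atTop M]
      with n hn hn' x hx
    rw [OnePoint.coe_eq_coe] at hx
    subst hx
    refine hn'.trans ?_
    rw [abs_mul, Real.abs_exp, Real.exp_neg, ← div_eq_inv_mul, lt_div_iff₀ (Real.exp_pos _)] at hn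
    rw [mul_comm]
    exact hn.le
  -- The axes converge to the geodesic from `x₀` to `∞`, so they eventually meet a ball about any of
  -- its points.
  have hlim := Geodesic.tendsto_mk (fun n => OnePoint.coe_injective.ne (D.x_ne_y n))
    (OnePoint.coe_ne_infty D.x₀) ((OnePoint.continuous_coe.tendsto _).comp D.tendsto_x) hy
  have hlim' := ((continuous_const_smul (h.side β)⁻¹).tendsto _).comp hlim
  obtain ⟨z, hz⟩ := ((h.side β)⁻¹ • Geodesic.mk (D.x₀ : OnePoint ℝ) OnePoint.infty
    (OnePoint.coe_ne_infty D.x₀)).line_nonempty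
  refine ⟨1 + dist z ((h.side β)⁻¹ • pt 0), ?_⟩
  filter_upwards [hlim'.eventually (Geodesic.eventually_inter_ball hz one_pos)] with n ⟨w, hw, hwz⟩
  exact ⟨w, hw, (dist_triangle _ z _).trans (add_le_add_left (Metric.mem_ball.1 hwz).le _)⟩

end AxisFamily

end HyperbolicStructure

end GeodesicCurrents

end

/-! ### Counting the translates of an axis that meet a ball -/

noncomputable section

namespace GeodesicCurrents

open UpperHalfPlane Filter Topology Set

theorem exists_int_translate_between {ℓ : ℝ} (hℓ : ℓ ≠ 0) (t t₀ : ℝ) :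
    ∃ j : ℤ, min t₀ (t₀ + ℓ) ≤ t + j * ℓ ∧ t + j * ℓ ≤ max t₀ (t₀ + ℓ) := by
  refine ⟨⌈(t₀ - t) / ℓ⌉, ?_⟩
  have h1 := Int.le_ceil ((t₀ - t) / ℓ)
  have h2 := (Int.ceil_lt_add_one ((t₀ - t) / ℓ)).le
  rcases lt_or_gt_of_ne hℓ with h | h
  · rw [min_eq_right (by linarith), max_eq_left (by linarith)]
    rw [div_le_iff_of_neg h] at h1
    rw [← sub_le_iff_le_add, le_div_iff_of_neg h] at h2
    constructor <;> linarith
  · rw [min_eq_left (by linarith), max_eq_right (by linarith)]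
    rw [div_le_iff₀ h] at h1
    rw [← sub_le_iff_le_add, le_div_iff₀ h] at h2
    constructor <;> linarith

namespace HyperbolicStructure

variable {S : Type*} [TopologicalSpace S] {h : HyperbolicStructure S}

namespace AxisFamily

variable {β : h.bdry} (D : h.AxisFamily β)

/-- A fundamental segment of an axis stays within a bounded distance of the orbit of a point of `β`
under the powers of `b`. -/
theorem exists_near_zpow (R : ℝ) : ∃ (E : ℝ) (M : ℕ), ∀ n ≥ D.N,
    (∃ w ∈ (D.geo n).line, dist w ((h.side β)⁻¹ • pt 0) ≤ R) → ∀ u ∈ (D.geo n).line,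
      ∃ j k : ℤ, -(M : ℤ) ≤ k ∧ k ≤ n + M ∧
        dist (D.elt n ^ j • u) (D.b ^ k • (h.side β)⁻¹ • pt 0) ≤ E := by
  set p := (h.side β)⁻¹ • pt 0 with hp
  -- The point `w` is within `R` of `p`, and its image under `b ^ n * a` is within `R'` of `b ^ n •
  -- p`: both ends of a fundamental segment of the axis are near `β`.
  set R' := R + dist (D.a • p) p with hR'
  set K := Real.cosh R + Real.cosh R' with hK
  set E := 2 + 2 * K + D.κ with hE
  obtain ⟨M, hM⟩ := exists_nat_ge ((2 * R + 2 * R' + E) / D.κ)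
  rw [div_le_iff₀ D.κ_pos] at hM
  refine ⟨E, M, ?_⟩
  rintro n hn ⟨w, hw, hwp⟩ u hu
  have hpk : ∀ k : ℤ, D.b ^ k • p = (h.side β)⁻¹ • pt (k * D.κ) := fun k => by
    rw [hp, D.zpow_smul_pt, zero_add]
  have hw' : dist (D.elt n • w) (D.b ^ (n : ℤ) • p) ≤ R' := by
    rw [elt, mul_smul, zpow_natCast, dist_smul_gl]
    refine (dist_triangle _ (D.a • p) _).trans ?_
    rw [dist_smul_gl]
    exact add_le_add_left hwp _
  obtain ⟨T, ℓ, hℓ, hT0, hTi, -, hTt⟩ := D.exists_translation hn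
  have hgeo : T • D.geo n = Geodesic.base := by
    rw [geo, ← mul_smul]
    exact Geodesic.smul_mk_eq (by rw [mul_smul, hT0]) (by rw [mul_smul, hTi])
  have hcov := mem_geodesicSet_iff.1 (D.geo_mem_geodesicSet hn)
  have hline : ∀ z ∈ (D.geo n).line, ∃ t, z = T⁻¹ • pt t := fun z hz => by
    obtain ⟨t, ht⟩ := exists_eq_pt ((Geodesic.mem_line_iff hgeo).1 hz)
    exact ⟨t, by rw [← ht, inv_smul_smul]⟩
  have hmem : ∀ t, T⁻¹ • pt t ∈ (D.geo n).line := fun t =>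
    (Geodesic.mem_line_iff hgeo).2 (by rw [smul_inv_smul, pt_re])
  obtain ⟨t₀, rfl⟩ := hline w hw
  obtain ⟨t, rfl⟩ := hline u hu
  rw [hTt] at hw'
  -- A power of `b ^ n * a` moves `u` into the segment between `w` and its image.
  obtain ⟨j, hj1, hj2⟩ := exists_int_translate_between hℓ t t₀
  have hju : D.elt n ^ j • T⁻¹ • pt t = T⁻¹ • pt (t + j * ℓ) :=
    zpow_smul_of_forall (f := fun t => T⁻¹ • pt t) hTt j t
  -- the distance from `β` is quasi-convex along the axis
  obtain ⟨d, hd, hre⟩ := re_smul_pt (h.side β * T⁻¹)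
  set A := (h.side β * T⁻¹) 0 0 * (h.side β * T⁻¹) 1 0
  set B := (h.side β * T⁻¹) 0 1 * (h.side β * T⁻¹) 1 1
  have hnonneg : ∀ t, 0 ≤ A * Real.exp t + B * Real.exp (-t) := fun t => by
    have h1 := side_nonneg β (hcov (hmem t))
    rw [← mul_smul, hre] at h1
    have h2 := nonneg_of_mul_nonneg_left h1 ((h.side β * T⁻¹) • pt t).im_pos
    have := mul_nonneg h2 hd.le
    rwa [div_mul_cancel₀ _ hd.ne'] at this
  have hbound : ∀ (t s C : ℝ), dist (T⁻¹ • pt t) ((h.side β)⁻¹ • pt s) ≤ C →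
      A * Real.exp t + B * Real.exp (-t) ≤ Real.cosh C * d := by
    intro t s C hC
    rw [← dist_smul_gl (h.side β), smul_inv_smul, ← mul_smul] at hC
    have h1 := (le_abs_self _).trans (abs_re_le_of_dist_le hC)
    rw [hre] at h1
    have h2 := le_of_mul_le_mul_right h1 ((h.side β * T⁻¹) • pt t).im_pos
    rwa [div_le_iff₀ hd] at h2
  have hb1 := hbound t₀ 0 R hwp
  have hb2 := hbound (t₀ + ℓ) (n * D.κ) R' (by rw [hpk] at hw'; exact_mod_cast hw')
  have hb : A * Real.exp (t + j * ℓ) + B * Real.exp (-(t + j * ℓ)) ≤ K * d := by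
    have h1 := exp_combo_le hnonneg hj1 hj2
    rcases le_total t₀ (t₀ + ℓ) with h' | h'
    · rw [min_eq_left h', max_eq_right h'] at h1
      rw [hK, add_mul]
      linarith
    · rw [min_eq_right h', max_eq_left h'] at h1
      rw [hK, add_mul]
      linarith
  obtain ⟨s, hs⟩ : ∃ s, dist (h.side β • T⁻¹ • pt (t + j * ℓ)) (pt s) ≤ 2 + 2 * K := by
    apply exists_dist_pt_le
    rw [abs_of_nonneg (side_nonneg β (hcov (hmem _))), ← mul_smul, hre]
    refine mul_le_mul_of_nonneg_right ?_ (UpperHalfPlane.im_pos _).le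
    rwa [div_le_iff₀ hd]
  -- The nearby point of `β` is rounded down to the orbit of `p` under `b`, at a cost of at most
  -- `κ`.
  have hk1 := Int.floor_le (s / D.κ)
  have hk2 := (Int.lt_floor_add_one (s / D.κ)).le
  set k := ⌊s / D.κ⌋
  rw [le_div_iff₀ D.κ_pos] at hk1
  rw [div_le_iff₀ D.κ_pos] at hk2
  have hkE : dist (T⁻¹ • pt (t + j * ℓ)) (D.b ^ k • p) ≤ E := by
    rw [hpk, ← dist_smul_gl (h.side β), smul_inv_smul]
    refine (dist_triangle _ (pt s) _).trans (add_le_add hs ?_)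
    rw [dist_pt, abs_of_nonneg (by linarith)]
    linarith
  have hdT : ∀ s t, dist (T⁻¹ • pt s) (T⁻¹ • pt t) = |s - t| := fun s t => by
    rw [dist_smul_gl, dist_pt]
  have hdb : ∀ k l : ℤ, dist (D.b ^ k • p) (D.b ^ l • p) = |k * D.κ - l * D.κ| := fun k l => by
    rw [hpk, hpk, dist_smul_gl, dist_pt]
  have hp0 : D.b ^ (0 : ℤ) • p = p := by rw [_root_.zpow_zero, one_smul]
  -- the length of the fundamental segment
  have hlen : |ℓ| ≤ R + n * D.κ + R' := by
    have h1 := dist_triangle4 (T⁻¹ • pt t₀) p (D.b ^ (n : ℤ) • p) (T⁻¹ • pt (t₀ + ℓ))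
    have h2 := hdb 0 n
    rw [hp0] at h2
    rw [hdT, h2, dist_comm (D.b ^ (n : ℤ) • p)] at h1
    have h3 : |((0 : ℤ) : ℝ) * D.κ - ((n : ℤ) : ℝ) * D.κ| = n * D.κ := by
      rw [Int.cast_zero, zero_mul, zero_sub, abs_neg, Int.cast_natCast]
      exact abs_of_nonneg (mul_nonneg (Nat.cast_nonneg n) D.κ_pos.le)
    have h4 : |t₀ - (t₀ + ℓ)| = |ℓ| := by rw [sub_add_cancel_left, abs_neg]
    rw [h3, h4] at h1
    linarith
  have hd1 : dist (T⁻¹ • pt t₀) (T⁻¹ • pt (t + j * ℓ)) ≤ |ℓ| := by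
    rw [hdT, abs_le]
    rcases le_total t₀ (t₀ + ℓ) with h' | h'
    · rw [min_eq_left h', max_eq_right h'] at *
      constructor <;> linarith [le_abs_self ℓ]
    · rw [min_eq_right h', max_eq_left h'] at *
      constructor <;> linarith [neg_abs_le ℓ]
  have hd2 : dist (T⁻¹ • pt (t₀ + ℓ)) (T⁻¹ • pt (t + j * ℓ)) ≤ |ℓ| := by
    rw [hdT, abs_le]
    rcases le_total t₀ (t₀ + ℓ) with h' | h'
    · rw [min_eq_left h', max_eq_right h'] at *
      constructor <;> linarith [le_abs_self ℓ]
    · rw [min_eq_right h', max_eq_left h'] at *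
      constructor <;> linarith [neg_abs_le ℓ]
  -- The bounds on `k` compare distances along `β`, from `b ^ n • p` and from `p`, with paths
  -- running through the axis; their total is at most `n κ + 2 R + 2 R' + E`.
  refine ⟨j, k, ?_, ?_, by rwa [hju]⟩
  · have h1 := dist_triangle4 (D.b ^ (n : ℤ) • p) (T⁻¹ • pt (t₀ + ℓ)) (T⁻¹ • pt (t + j * ℓ))
      (D.b ^ k • p)
    rw [hdb, dist_comm (D.b ^ (n : ℤ) • p)] at h1
    have h2 := le_abs_self (((n : ℤ) : ℝ) * D.κ - k * D.κ)
    rw [Int.cast_natCast] at h1 h2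
    have h3 : (-(M : ℝ)) * D.κ ≤ k * D.κ := by
      have := dist_nonneg.trans hwp
      have := dist_nonneg.trans hw'
      linarith
    exact_mod_cast le_of_mul_le_mul_right h3 D.κ_pos
  · have h1 := dist_triangle4 p (T⁻¹ • pt t₀) (T⁻¹ • pt (t + j * ℓ)) (D.b ^ k • p)
    have h0 := hdb 0 k
    rw [hp0] at h0
    rw [h0, dist_comm p] at h1
    have h2 := neg_abs_le (((0 : ℤ) : ℝ) * D.κ - k * D.κ)
    rw [Int.cast_zero, zero_mul, zero_sub] at h1 h2
    have h3 : (k : ℝ) * D.κ ≤ (n + M) * D.κ := by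
      have := dist_nonneg.trans hwp
      have := dist_nonneg.trans hw'
      linarith
    exact_mod_cast le_of_mul_le_mul_right h3 D.κ_pos

/-- The translates of an axis which meet a given ball. -/
theorem exists_finite_translates (R : ℝ) (z : ℍ) (r : ℝ) :
    ∃ (F : Set (GL (Fin 2) ℝ)) (M : ℕ), F.Finite ∧ F ⊆ h.deck ∧ ∀ n ≥ D.N,
      (∃ w ∈ (D.geo n).line, dist w ((h.side β)⁻¹ • pt 0) ≤ R) → ∀ g ∈ h.deck,
        ((g • D.geo n).line ∩ Metric.closedBall z r).Nonempty →
        ∃ φ ∈ F, ∃ k : ℤ, -(M : ℤ) ≤ k ∧ k ≤ n + M ∧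
          g • D.geo n = φ • D.b ^ (-k) • D.geo n := by
  obtain ⟨z₀, hz₀⟩ := h.interior_nonempty
  obtain ⟨E, M, hE⟩ := D.exists_near_zpow R
  set p := (h.side β)⁻¹ • pt 0 with hp
  obtain ⟨F, hF, hFd, hFz⟩ := exists_finite_deck hz₀ (dist z₀ p + (E + r) + dist z z₀)
  refine ⟨F, M, hF, hFd, fun n hn hw g hg => ?_⟩
  rintro ⟨v, hv, hvz⟩
  obtain ⟨j, k, hk1, hk2, hjk⟩ := hE n hn hw (g⁻¹ • v) (Geodesic.mem_smul_line.1 hv)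
  have hej : D.elt n ^ (-j) • D.geo n = D.geo n := by
    have := zpow_smul_of_forall (g := D.elt n) (f := fun _ : ℝ => D.geo n) (ℓ := 0)
      (fun _ => D.elt_smul_geo hn) (-j) 0
    exact this
  -- Powers of `b ^ n * a` preserve the axis, so `g` may be replaced by `g'`. Now `g' * b ^ k` moves
  -- `z₀` a bounded distance, hence agrees up to a scalar with one of finitely many `φ`.
  set g' := g * D.elt n ^ (-j) with hg'
  have hg'd : g' ∈ h.deck := mul_mem hg (zpow_mem (D.elt_mem n) _)
  have hg'geo : g' • D.geo n = g • D.geo n := by rw [hg', mul_smul, hej]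
  have h1 : dist (g' • D.b ^ k • p) v ≤ E := by
    rw [← dist_smul_gl g', ← mul_smul g', hg', mul_assoc, _root_.zpow_neg, inv_mul_cancel, mul_one,
      smul_inv_smul, dist_comm, ← _root_.zpow_neg, ← hg'] at hjk
    exact hjk
  have h2 : dist ((g' * D.b ^ k) • z₀) z₀ ≤ dist z₀ p + (E + r) + dist z z₀ := by
    have h3 := dist_triangle4 ((g' * D.b ^ k) • z₀) ((g' * D.b ^ k) • p) z z₀
    rw [dist_smul_gl, mul_smul (g') (D.b ^ k) p] at h3
    have h4 := dist_triangle (g' • D.b ^ k • p) v z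
    have h5 : dist v z ≤ r := hvz
    linarith
  obtain ⟨φ, hφ, htriv⟩ := hFz _ (mul_mem hg'd (zpow_mem D.b_mem k)) h2
  refine ⟨φ, hφ, k, hk1, hk2, ?_⟩
  have h3 := htriv.smul_geodesic (D.b ^ (-k) • D.geo n)
  rw [mul_smul, mul_smul, _root_.zpow_neg, smul_inv_smul, hg'geo, inv_smul_eq_iff] at h3
  rw [h3, _root_.zpow_neg]

end AxisFamily

end HyperbolicStructure

end GeodesicCurrents

end

/-! ### Closed geodesics running along a boundary curve -/

noncomputable section

namespace GeodesicCurrents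

open UpperHalfPlane Filter Topology Set

theorem ncard_Icc_int_le {a b : ℤ} {m : ℕ} (hab : b + 1 - a ≤ m) : (Icc a b).ncard ≤ m := by
  rw [← Finset.coe_Icc, ncard_coe_finset, Int.card_Icc]
  omega

namespace HyperbolicStructure

variable {S : Type*} [TopologicalSpace S] {h : HyperbolicStructure S}

theorem exists_nhds_bdry [CompactSpace S] (β : h.bdry) : ∃ V ∈ 𝓝 β.1, ∀ γ ∈ V, γ ∈ h.bdry → γ = β.1 := by
  obtain ⟨N, hN, hfin⟩ := h.isDiscreteFamily_bdry.exists_nhds_finite β.1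
  have hfin' : ((h.saturation h.bdry ∩ N) \ {β.1}).Finite := hfin.sdiff
  refine ⟨N ∩ ((h.saturation h.bdry ∩ N) \ {β.1})ᶜ,
    inter_mem hN (hfin'.isClosed.isOpen_compl.mem_nhds fun hβ => hβ.2 rfl), ?_⟩
  rintro γ ⟨hγN, hγ⟩ hγb
  by_contra hne
  exact hγ ⟨⟨subset_saturation _ hγb, hγN⟩, hne⟩

namespace AxisFamily

variable {β : h.bdry} (D : h.AxisFamily β)

/-- A translate of the axis under a power of `b` is so close to `β` that, if the axis were a
boundary geodesic, both would equal `β`. But `b ^ n * a` preserves the axis and moves `β`. -/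
theorem eventually_notMem_bdry [CompactSpace S] : ∀ᶠ n in atTop, D.geo n ∉ h.bdry := by
  obtain ⟨V, hV, hVβ⟩ := exists_nhds_bdry β
  obtain ⟨M, hM⟩ := D.exists_forall_mem_nhds hV
  filter_upwards [eventually_ge_atTop (M + M), eventually_ge_atTop D.N] with n hn hn' hgeo
  have hd : D.b ^ (-(M : ℤ)) ∈ h.deck := zpow_mem D.b_mem _
  have h1 := hVβ _ (hM n M le_rfl hn) (smul_mem_bdry hd hgeo)
  rw [← D.zpow_smul_bdry (-(M : ℤ))] at h1
  have h2 : D.geo n = β.1 := smul_left_cancel _ h1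
  have h3 := D.elt_smul_geo hn'
  rw [h2] at h3
  exact D.elt_smul_ne n h3

end AxisFamily

/-- For every boundary geodesic there is a sequence of closed geodesics, the `n`-th of which runs
about `n` times along it and stays away from it otherwise. -/
theorem exists_seq_geod [CompactSpace S] (β : h.bdry) : ∃ γ : ℕ → h.Geod,
    (∀ n, h.IsDiscreteFamily (Subtype.val '' h.deckOrbit (γ n))) ∧
    (∀ n, Disjoint (h.deckOrbit (γ n)) h.boundaryLifts) ∧
    (∀ Q : Set h.Geod, IsCompact Q → ∃ C : ℕ, ∀ n, (h.deckOrbit (γ n) ∩ Q).ncard ≤ C * (n + 1)) ∧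
    (∀ Q : Set h.Geod, IsCompact Q → Disjoint Q (h.deckOrbit (toGeod β)) →
      ∃ C : ℕ, ∀ n, (h.deckOrbit (γ n) ∩ Q).ncard ≤ C) ∧
    ∀ V ∈ 𝓝 (toGeod β), IsCompact V → ∃ M : ℕ, ∀ n, n ≤ (h.deckOrbit (γ n) ∩ V).ncard + M := by
  obtain ⟨D⟩ := nonempty_axisFamily β
  obtain ⟨R, hR⟩ := D.exists_near
  obtain ⟨N, hN⟩ := eventually_atTop.1 (hR.and ((eventually_ge_atTop D.N).and
    D.eventually_notMem_bdry))
  obtain ⟨z₀, -⟩ := h.interior_nonempty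
  -- The shift by `N` makes all the eventual properties hold from the first index on.
  let γ : ℕ → h.Geod := fun n =>
    ⟨D.geo (n + N), D.geo_mem_geodesicSet (hN _ (Nat.le_add_left N n)).2.1⟩
  have htrans : ∀ r : ℝ, ∃ (F : Set (GL (Fin 2) ℝ)) (M : ℕ), F.Finite ∧ F ⊆ h.deck ∧
      ∀ n, ∀ γ' ∈ h.deckOrbit (γ n), (γ'.1.line ∩ Metric.closedBall z₀ r).Nonempty →
        ∃ φ ∈ F, ∃ k : ℤ, -(M : ℤ) ≤ k ∧ k ≤ n + N + M ∧
          γ'.1 = φ • D.b ^ (-k) • (γ n).1 := by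
    intro r
    obtain ⟨F, M, hF, hFd, hFM⟩ := D.exists_finite_translates R z₀ r
    refine ⟨F, M, hF, hFd, ?_⟩
    rintro n γ' ⟨g, hg, hgγ⟩ hne
    rw [← hgγ] at hne ⊢
    obtain ⟨hn1, hn2, -⟩ := hN (n + N) (Nat.le_add_left N n)
    obtain ⟨φ, hφ, k, hk1, hk2, hk⟩ := hFM (n + N) hn2 hn1 g hg hne
    exact ⟨φ, hφ, k, hk1, by push_cast at hk2; exact hk2, hk⟩
  have hfin : ∀ (F : Set (GL (Fin 2) ℝ)), F.Finite → ∀ (I : Set ℤ), I.Finite → ∀ (n : ℕ)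
      (s : Set Geodesic), (∀ γ' ∈ s, ∃ φ ∈ F, ∃ k ∈ I, γ' = φ • D.b ^ (-k) • (γ n).1) →
      s.Finite ∧ s.ncard ≤ F.ncard * I.ncard := by
    intro F hF I hI n s hs
    have hsub : s ⊆ (fun p : GL (Fin 2) ℝ × ℤ => p.1 • D.b ^ (-p.2) • (γ n).1) '' (F ×ˢ I) := by
      intro γ' hγ'
      obtain ⟨φ, hφ, k, hk, rfl⟩ := hs γ' hγ'
      exact ⟨(φ, k), ⟨hφ, hk⟩, rfl⟩
    have hFI := hF.prod hI
    refine ⟨(hFI.image _).subset hsub, ?_⟩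
    rw [← ncard_prod]
    exact (ncard_le_ncard hsub (hFI.image _)).trans (ncard_image_le hFI)
  have hdisc : ∀ n, h.IsDiscreteFamily (Subtype.val '' h.deckOrbit (γ n)) := fun n =>
    { line_subset := by
        rintro _ ⟨γ', -, rfl⟩
        exact mem_geodesicSet_iff.1 γ'.2
      smul_mem := fun g hg γ' hγ' => smul_mem_image_deckOrbit hg hγ'
      finite_inter := by
        intro z r
        obtain ⟨F, M, hF, -, hFM⟩ := htrans (r + dist z z₀)
        refine (hfin F hF (Icc (-(M : ℤ)) (n + N + M)) (finite_Icc _ _) n _ ?_).1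
        rintro _ ⟨⟨γ', hγ', rfl⟩, hne⟩
        obtain ⟨φ, hφ, k, hk1, hk2, hk⟩ := hFM n γ' hγ' (hne.mono (inter_subset_inter_right _
          (Metric.closedBall_subset_closedBall' le_rfl)))
        exact ⟨φ, hφ, k, ⟨hk1, hk2⟩, hk⟩ }
  have hcompact : ∀ Q : Set h.Geod, IsCompact Q → ∃ (F : Set (GL (Fin 2) ℝ)) (M : ℕ),
      F.Finite ∧ F ⊆ h.deck ∧ ∀ n, ∀ γ' ∈ h.deckOrbit (γ n) ∩ Q,
        ∃ φ ∈ F, ∃ k : ℤ, -(M : ℤ) ≤ k ∧ k ≤ n + N + M ∧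
          γ'.1 = φ • D.b ^ (-k) • (γ n).1 := by
    intro Q hQ
    obtain ⟨r, hr⟩ := Geodesic.exists_closedBall_of_isCompact (hQ.image continuous_subtype_val) z₀
    obtain ⟨F, M, hF, hFd, hFM⟩ := htrans r
    exact ⟨F, M, hF, hFd, fun n γ' hγ' => hFM n γ' hγ'.1 (hr _ (mem_image_of_mem _ hγ'.2))⟩
  have hncard : ∀ s : Set h.Geod, (Subtype.val '' s).ncard = s.ncard := fun s =>
    ncard_image_of_injective s Subtype.val_injective
  refine ⟨γ, hdisc, fun n => ?_, fun Q hQ => ?_, fun Q hQ hdisj => ?_, fun V hV hVc => ?_⟩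
  · rw [disjoint_left]
    rintro γ' ⟨g, hg, hgγ⟩ hγ'
    refine (hN (n + N) (Nat.le_add_left N n)).2.2 ?_
    have h1 : g⁻¹ • γ'.1 ∈ h.bdry := smul_mem_bdry (inv_mem hg) hγ'
    rwa [← hgγ, inv_smul_smul] at h1
  · obtain ⟨F, M, hF, -, hFM⟩ := hcompact Q hQ
    refine ⟨F.ncard * (N + 2 * M + 1), fun n => ?_⟩
    rw [← hncard]
    refine (hfin F hF (Icc (-(M : ℤ)) (n + N + M)) (finite_Icc _ _) n _ ?_).2.trans ?_
    · rintro _ ⟨γ', hγ', rfl⟩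
      obtain ⟨φ, hφ, k, hk1, hk2, hk⟩ := hFM n γ' hγ'
      exact ⟨φ, hφ, k, ⟨hk1, hk2⟩, hk⟩
    · rw [mul_assoc]
      refine Nat.mul_le_mul_left _ (ncard_Icc_int_le ?_)
      push_cast
      nlinarith
  · obtain ⟨F, M, hF, hFd, hFM⟩ := hcompact Q hQ
    have hQc : IsClosed (Subtype.val '' Q) := (hQ.image continuous_subtype_val).isClosed
    have hV : {γ' : Geodesic | ∀ φ ∈ F, φ • γ' ∉ Subtype.val '' Q} ∈ 𝓝 β.1 := by
      refine (eventually_all_finite hF).2 fun φ hφ => ?_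
      refine (continuous_const_smul φ).continuousAt.eventually (hQc.isOpen_compl.mem_nhds ?_)
      rintro ⟨γ', hγ', he⟩
      exact disjoint_left.1 hdisj hγ' ⟨φ, hFd hφ, he.symm⟩
    -- For `k` in the middle of its range, `b ^ (-k)` takes the axis so close to `β` that its
    -- translates under `F` miss `Q`. Only two end intervals of `k` remain, of a length independent
    -- of `n`.
    obtain ⟨M', hM'⟩ := D.exists_forall_mem_nhds hV
    refine ⟨F.ncard * ((M + M' + 1) + (M + M' + 1)), fun n => ?_⟩
    rw [← hncard]
    refine (hfin F hF (Icc (-(M : ℤ)) M' ∪ Icc (n + N - M' : ℤ) (n + N + M))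
      ((finite_Icc _ _).union (finite_Icc _ _)) n _ ?_).2.trans ?_
    · rintro _ ⟨γ', hγ', rfl⟩
      obtain ⟨φ, hφ, k, hk1, hk2, hk⟩ := hFM n γ' hγ'
      refine ⟨φ, hφ, k, ?_, hk⟩
      by_contra hkn
      have hk3 : (M' : ℤ) < k ∧ k < n + N - M' := by
        constructor
        · by_contra hk'
          exact hkn (Or.inl ⟨hk1, not_lt.1 hk'⟩)
        · by_contra hk'
          exact hkn (Or.inr ⟨not_lt.1 hk', hk2⟩)
      lift k to ℕ using by omega
      refine hM' (n + N) k (by omega) (by omega) φ hφ ?_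
      change φ • D.b ^ (-(k : ℤ)) • (γ n).1 ∈ _
      rw [← hk]
      exact mem_image_of_mem _ hγ'.2
    · refine Nat.mul_le_mul_left _ ((ncard_union_le _ _).trans (Nat.add_le_add ?_ ?_))
      · exact ncard_Icc_int_le (by push_cast; omega)
      · exact ncard_Icc_int_le (by push_cast; omega)
  · obtain ⟨F, M, hF, hFd, hFM⟩ := hcompact V hVc
    obtain ⟨W, hW, hWV⟩ := mem_nhds_subtype _ _ _ |>.1 hV
    obtain ⟨M', hM'⟩ := D.exists_forall_mem_nhds hW
    refine ⟨2 * M', fun n => ?_⟩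
    have hfinV : (h.deckOrbit (γ n) ∩ V).Finite := by
      refine Set.Finite.of_finite_image (f := Subtype.val) ?_ Subtype.val_injective.injOn
      refine (hfin F hF (Icc (-(M : ℤ)) (n + N + M)) (finite_Icc _ _) n _ ?_).1
      rintro _ ⟨γ', hγ', rfl⟩
      obtain ⟨φ, hφ, k, hk1, hk2, hk⟩ := hFM n γ' hγ'
      exact ⟨φ, hφ, k, ⟨hk1, hk2⟩, hk⟩
    have hd : ∀ k : ℕ, D.b ^ (-(k : ℤ)) ∈ h.deck := fun k => zpow_mem D.b_mem _
    -- The translates by `b ^ (-k)` with `k` in the middle range are distinct and close to `β`,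
    -- hence lie in `V`.
    have h1 := ncard_le_ncard_of_injOn (s := (Finset.Icc M' (n + N - M') : Set ℕ))
      (t := h.deckOrbit (γ n) ∩ V) (fun k => smulGeod (hd k) (γ n)) (fun k hk => by
        rw [Finset.mem_coe, Finset.mem_Icc] at hk
        refine ⟨smulGeod_mem_deckOrbit _ _, hWV ?_⟩
        -- The second case comes only from truncated subtraction and is contradictory.
        by_cases hkn : k + M' ≤ n + N
        · exact hM' (n + N) k hk.1 hkn
        · omega) (fun k _ l _ hkl => by
        have h2 : D.b ^ (-(k : ℤ)) • D.geo (n + N) = D.b ^ (-(l : ℤ)) • D.geo (n + N) :=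
          congrArg Subtype.val hkl
        have h3 := D.zpow_smul_geo_injective (n + N) h2
        omega) hfinV
    rw [ncard_coe_finset, Nat.card_Icc] at h1
    omega

end HyperbolicStructure

end GeodesicCurrents

end

/-! ### Boundary curves as limits of internal currents -/

noncomputable section

namespace GeodesicCurrents

open UpperHalfPlane Filter Topology Set

theorem ptMeasure_real {X : Type*} [MeasurableSpace X] (s : Set X) {A : Set X}
    (hA : MeasurableSet A) : (ptMeasure s).real A = (s ∩ A).ncard := by
  rw [Measure.real, ptMeasure_apply s hA, ncard]
  rcases (s ∩ A).finite_or_infinite with hf | hf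
  · rw [hf.encard_eq_coe_toFinset_card]
    simp
  · rw [hf.encard_eq]
    simp

/-- If the mass of `m n` grows linearly near the set `P` and stays bounded away from it, then the
integrals of functions vanishing on `P` are asymptotically negligible. -/
theorem tendsto_integral_div {X : Type*} [TopologicalSpace X] [T2Space X] [MeasurableSpace X]
    [BorelSpace X] {m : ℕ → Measure X} (hm : ∀ n, IsFiniteMeasureOnCompacts (m n)) {P : Set X}
    {w : ℕ → ℝ} (h1 : ∀ Q : Set X, IsCompact Q → ∃ C : ℕ, ∀ n, (m n).real Q ≤ C * (n + 1))
    (h2 : ∀ Q : Set X, IsCompact Q → Disjoint Q P → ∃ C : ℕ, ∀ n, (m n).real Q ≤ C)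
    (h3 : ∃ M : ℕ, ∀ n : ℕ, n - M ≤ w n) (f : CompactlySupportedContinuousMap X ℝ)
    (hf : ∀ x ∈ P, f x = 0) : Tendsto (fun n => (∫ x, f x ∂m n) / w n) atTop (𝓝 0) := by
  have hK : IsCompact (tsupport f) := f.hasCompactSupport.isCompact
  obtain ⟨C₁, hC₁⟩ := h1 _ hK
  obtain ⟨B, hB⟩ := f.hasCompactSupport.exists_bound_of_continuous f.continuous
  obtain ⟨M, hM⟩ := h3
  rw [Metric.tendsto_atTop]
  intro δ hδ
  -- Where `|f| < ε` the mass is at most `C₁ * (n + 1)`, and this `ε` makes its contribution at most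
  -- `δ / 4 * (n + 1)`.
  set ε : ℝ := δ / (4 * (C₁ + 1)) with hε
  have hεpos : 0 < ε := by positivity
  have hεC : ε * C₁ ≤ δ / 4 := by
    rw [hε, div_mul_eq_mul_div, div_le_div_iff₀ (by positivity) (by norm_num)]
    nlinarith [Nat.cast_nonneg (α := ℝ) C₁]
  -- The set where `|f| ≥ ε` is compact and disjoint from `P`, so its mass stays bounded.
  set Q : Set X := {x | ε ≤ |f x|} with hQ
  have hQK : Q ⊆ tsupport f := fun x hx => subset_tsupport _ fun h0 => by
    have hx' : ε ≤ |f x| := hx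
    rw [h0, abs_zero] at hx'
    linarith
  have hQc : IsCompact Q := hK.of_isClosed_subset
    (isClosed_le continuous_const f.continuous.abs) hQK
  obtain ⟨C₂, hC₂⟩ := h2 Q hQc (disjoint_left.2 fun x hx hxP => by
    have hx' : ε ≤ |f x| := hx
    rw [hf x hxP, abs_zero] at hx'
    linarith)
  have hbound : ∀ n, |∫ x, f x ∂m n| ≤ ε * (C₁ * (n + 1)) + |B| * C₂ := by
    intro n
    have hKi : Integrable ((tsupport f).indicator fun _ => ε) (m n) :=
      (integrable_indicator_iff hK.measurableSet).2 (integrableOn_const hK.measure_lt_top.ne)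
    have hQi : Integrable (Q.indicator fun _ => |B|) (m n) :=
      (integrable_indicator_iff hQc.measurableSet).2 (integrableOn_const hQc.measure_lt_top.ne)
    calc |∫ x, f x ∂m n| ≤ ∫ x, ((tsupport f).indicator (fun _ => ε) x +
          Q.indicator (fun _ => |B|) x) ∂m n := by
          refine norm_integral_le_of_norm_le (f := f) (hKi.add hQi) (Eventually.of_forall fun x => ?_)
          by_cases hxQ : x ∈ Q
          · rw [indicator_of_mem hxQ, indicator_of_mem (hQK hxQ)]
            linarith [hB x, le_abs_self B]
          · rw [indicator_of_notMem hxQ, add_zero]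
            by_cases hxK : x ∈ tsupport f
            · rw [indicator_of_mem hxK]
              exact (not_le.1 hxQ).le
            · rw [indicator_of_notMem hxK, image_eq_zero_of_notMem_tsupport hxK, norm_zero]
      _ = (m n).real (tsupport f) * ε + (m n).real Q * |B| := by
          rw [integral_add hKi hQi, integral_indicator_const _ hK.measurableSet,
            integral_indicator_const _ hQc.measurableSet, smul_eq_mul, smul_eq_mul]
      _ ≤ ε * (C₁ * (n + 1)) + |B| * C₂ := by
          rw [mul_comm _ ε, mul_comm _ |B|]
          exact add_le_add (mul_le_mul_of_nonneg_left (hC₁ n) hεpos.le)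
            (mul_le_mul_of_nonneg_left (hC₂ n) (abs_nonneg B))
  -- Chosen so that `δ / 4 * (n + 1) + |B| * C₂ < δ * (n - M)` for `n ≥ n₀`.
  obtain ⟨n₀, hn₀⟩ := exists_nat_gt ((δ / 4 + |B| * C₂ + δ * M) / (δ / 2))
  rw [div_lt_iff₀ (by positivity)] at hn₀
  refine ⟨max n₀ (M + 1), fun n hn => ?_⟩
  have hn1 : (n₀ : ℝ) ≤ n := Nat.cast_le.2 ((le_max_left _ _).trans hn)
  have hn2 : (M : ℝ) + 1 ≤ n := by exact_mod_cast (le_max_right _ _).trans hn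
  have hw : 0 < w n := lt_of_lt_of_le (by linarith) (hM n)
  rw [Real.dist_eq, sub_zero, abs_div, abs_of_pos hw, div_lt_iff₀ hw]
  refine (hbound n).trans_lt (lt_of_lt_of_le ?_ (mul_le_mul_of_nonneg_left (hM n) hδ.le))
  have h4 : ε * (C₁ * (n + 1)) ≤ δ / 4 * (n + 1) := by
    rw [← mul_assoc]
    exact mul_le_mul_of_nonneg_right hεC (by positivity)
  nlinarith

namespace HyperbolicStructure

variable {S : Type*} [TopologicalSpace S] {h : HyperbolicStructure S}

theorem continuous_smulGeod {g : GL (Fin 2) ℝ} (hg : g ∈ h.deck) :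
    Continuous (smulGeod hg : h.Geod → h.Geod) :=
  ((continuous_const_smul g).comp continuous_subtype_val).subtype_mk _

/-- The homeomorphism of the space of geodesics given by a deck transformation. -/
def homeoGeod {g : GL (Fin 2) ℝ} (hg : g ∈ h.deck) : h.Geod ≃ₜ h.Geod where
  toFun := smulGeod hg
  invFun := smulGeod (inv_mem hg)
  left_inv γ := Subtype.ext (inv_smul_smul g γ.1)
  right_inv γ := Subtype.ext (smul_inv_smul g γ.1)
  continuous_toFun := continuous_smulGeod hg
  continuous_invFun := continuous_smulGeod (inv_mem hg)

/-- The translate of a test function by a deck transformation. -/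
def translate {g : GL (Fin 2) ℝ} (hg : g ∈ h.deck) (f : CompactlySupportedContinuousMap h.Geod ℝ) :
    CompactlySupportedContinuousMap h.Geod ℝ :=
  ⟨⟨fun γ => f (smulGeod hg γ), f.continuous.comp (continuous_smulGeod hg)⟩,
    f.hasCompactSupport.comp_homeomorph (homeoGeod hg)⟩

theorem map_smulGeod {c : Measure h.Geod} (hc : c ∈ h.currents) {g : GL (Fin 2) ℝ}
    (hg : g ∈ h.deck) : c.map (smulGeod hg) = c := by
  ext A hA
  have hA' : MeasurableSet (Subtype.val '' A : Set Geodesic) :=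
    (MeasurableEmbedding.subtype_coe h.isClosed_geodesicSet.measurableSet).measurableSet_image' hA
  have h1 := hc.invariant g hg _ hA'
  rw [Measure.map_apply measurable_subtype_coe hA',
    Measure.map_apply measurable_subtype_coe (measurable_smul_geodesic g hA'),
    preimage_image_eq _ Subtype.val_injective] at h1
  rw [Measure.map_apply (continuous_smulGeod hg).measurable hA, ← h1]
  congr 1
  ext γ
  constructor
  · exact fun hγ => ⟨_, hγ, rfl⟩
  · rintro ⟨γ', hγ', he⟩
    rwa [mem_preimage, show smulGeod hg γ = γ' from Subtype.ext he.symm]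

theorem integral_translate (c : h.currents) {g : GL (Fin 2) ℝ} (hg : g ∈ h.deck)
    (f : CompactlySupportedContinuousMap h.Geod ℝ) :
    ∫ γ, translate hg f γ ∂(c : Measure h.Geod) = ∫ γ, f γ ∂(c : Measure h.Geod) := by
  conv_rhs => rw [← map_smulGeod c.2 hg]
  have hf : Continuous (f : h.Geod → ℝ) := f.continuous
  rw [integral_map (continuous_smulGeod hg).aemeasurable hf.aestronglyMeasurable]
  rfl

/-- Test functions are, up to translates of a bump function at `β`, functions which vanish on the
orbit of `β`. -/
theorem exists_decomposition [CompactSpace S] {β : h.Geod} (hβ : β ∈ h.boundaryLifts)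
    {ψ : CompactlySupportedContinuousMap h.Geod ℝ} (hψ : ψ β = 1)
    (hψ0 : ∀ γ ∈ h.boundaryLifts, γ ≠ β → ψ γ = 0) (f : CompactlySupportedContinuousMap h.Geod ℝ) :
    ∃ (f' : CompactlySupportedContinuousMap h.Geod ℝ) (A : ℝ),
      (∀ γ ∈ h.deckOrbit β, f' γ = 0) ∧ ∀ c : h.currents, ∫ γ, f γ ∂(c : Measure h.Geod) =
        ∫ γ, f' γ ∂(c : Measure h.Geod) + A * ∫ γ, ψ γ ∂(c : Measure h.Geod) := by
  classical
  have hloc : ∀ γ : h.Geod, ∃ N ∈ 𝓝 γ, (h.deckOrbit β ∩ N).Finite := fun γ => by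
    obtain ⟨N, hN, hfin⟩ := exists_nhds_finite_geod (s := h.boundaryLifts) (by
      rw [h.image_boundaryLifts]; exact h.isDiscreteFamily_bdry) γ
    exact ⟨N, hN, hfin.subset (inter_subset_inter_left _ (deckOrbit_subset_boundaryLifts hβ))⟩
  have hfin : (h.deckOrbit β ∩ tsupport f).Finite := by
    refine f.hasCompactSupport.isCompact.induction_on (p := fun s => (h.deckOrbit β ∩ s).Finite)
      (by simp) (fun s t hst ht => ht.subset (inter_subset_inter_right _ hst)) (fun s t hs ht => ?_)
      fun γ _ => ?_
    · rw [inter_union_distrib_left]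
      exact hs.union ht
    · obtain ⟨N, hN, hN'⟩ := hloc γ
      exact ⟨N, mem_nhdsWithin_of_mem_nhds hN, hN'⟩
  -- The condition is an implication so that `g` can be chosen as a total function; its values off
  -- the orbit play no role.
  have hex : ∀ γ : h.Geod, ∃ g : h.deck, γ ∈ h.deckOrbit β → g.1 • β.1 = γ.1 := fun γ => by
    by_cases hγ : γ ∈ h.deckOrbit β
    · obtain ⟨g, hg, hgγ⟩ := hγ
      exact ⟨⟨g, hg⟩, fun _ => hgγ⟩
    · exact ⟨1, fun h' => absurd h' hγ⟩
  choose g hg using hex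
  let φ : h.Geod → CompactlySupportedContinuousMap h.Geod ℝ := fun γ =>
    translate (inv_mem (g γ).2) ψ
  have hφ : ∀ γ ∈ h.deckOrbit β, ∀ γ' ∈ h.deckOrbit β, φ γ γ' = if γ' = γ then 1 else 0 := by
    intro γ hγ γ' hγ'
    change ψ (smulGeod (inv_mem (g γ).2) γ') = _
    split_ifs with he
    · subst he
      rw [show smulGeod (inv_mem (g γ').2) γ' = β from Subtype.ext (by
        change (g γ').1⁻¹ • γ'.1 = β.1
        rw [← hg γ' hγ', inv_smul_smul]), hψ]
    · refine hψ0 _ ((smulGeod_mem_boundaryLifts _).2 (deckOrbit_subset_boundaryLifts hβ hγ'))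
        fun e => he ?_
      have h1 : (g γ).1⁻¹ • γ'.1 = β.1 := congrArg Subtype.val e
      rw [inv_smul_eq_iff, hg γ hγ] at h1
      exact Subtype.ext h1
  -- At each of the finitely many orbit points in the support of `f`, the value of `f` is removed by
  -- a translate of `ψ`. Invariance of currents gives all these translates the integral of `ψ`.
  refine ⟨f - ∑ γ ∈ hfin.toFinset, f γ • φ γ, ∑ γ ∈ hfin.toFinset, f γ, fun γ' hγ' => ?_,
    fun c => ?_⟩
  · rw [CompactlySupportedContinuousMap.sub_apply, CompactlySupportedContinuousMap.sum_apply,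
      Finset.sum_congr rfl fun γ hγ => by
        rw [CompactlySupportedContinuousMap.smul_apply,
          hφ γ (hfin.mem_toFinset.1 hγ).1 γ' hγ', smul_eq_mul, mul_ite, mul_one, mul_zero],
      Finset.sum_ite_eq]
    split_ifs with hmem
    · exact sub_self _
    · rw [sub_zero]
      by_contra hne
      exact hmem (hfin.mem_toFinset.2 ⟨hγ', subset_tsupport _ hne⟩)
  · have hi : ∀ γ ∈ hfin.toFinset, Integrable (fun γ' => f γ • φ γ γ') (c : Measure h.Geod) :=
      fun γ _ => (integrable_currents c (φ γ)).smul (f γ)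
    have h1 : ∀ γ', (f - ∑ γ ∈ hfin.toFinset, f γ • φ γ) γ' =
        f γ' - ∑ γ ∈ hfin.toFinset, f γ • φ γ γ' := fun γ' => by
      rw [CompactlySupportedContinuousMap.sub_apply, CompactlySupportedContinuousMap.sum_apply]
      rfl
    simp_rw [h1]
    rw [integral_sub (integrable_currents c f) (integrable_finsetSum _ hi),
      integral_finsetSum _ hi, Finset.sum_mul]
    simp_rw [integral_smul, smul_eq_mul]
    rw [Finset.sum_congr rfl fun γ _ => by rw [integral_translate c (inv_mem (g γ).2) ψ]]
    ring

/-- Every boundary curve is a limit of internal currents. -/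
theorem exists_tendsto_curveMeasure [CompactSpace S] (β : h.BoundaryCurve) :
    ∃ u : ℕ → h.internalCurrents, ∀ f : CompactlySupportedContinuousMap h.Geod ℝ,
      Tendsto (fun n => ∫ γ, f γ ∂((u n : h.currents) : Measure h.Geod)) atTop
        (𝓝 (∫ γ, f γ ∂(h.curveMeasure β))) := by
  obtain ⟨β₀, hβ₀⟩ := β.exists_mem
  have hβL := β.subset_boundaryLifts hβ₀
  obtain ⟨γ, hdisc, hdisj, h1, h2, h3⟩ := exists_seq_geod (⟨β₀.1, hβL⟩ : h.bdry)
  obtain ⟨V, hV, hVβ⟩ := exists_nhds_bdry (⟨β₀.1, hβL⟩ : h.bdry)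
  obtain ⟨ψ, hψ1, hψV, hψ⟩ := exists_bump (continuous_subtype_val.continuousAt hV :
    Subtype.val ⁻¹' V ∈ 𝓝 β₀)
  have hψ0 : ∀ γ ∈ h.boundaryLifts, γ ≠ β₀ → ψ γ = 0 := fun γ hγ hne =>
    hψV γ fun hγV => hne (Subtype.ext (hVβ γ.1 hγV hγ))
  let m : ℕ → h.currents := fun n => ⟨_, ptMeasure_mem_currents (hdisc n)⟩
  have hm : ∀ n, IsFiniteMeasureOnCompacts (m n : Measure h.Geod) := fun n => by
    have := (m n).2.isLocallyFinite
    infer_instance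
  have hmreal : ∀ (n : ℕ) (Q : Set h.Geod), IsCompact Q →
      (m n : Measure h.Geod).real Q = (h.deckOrbit (γ n) ∩ Q).ncard := fun n Q hQ =>
    ptMeasure_real _ hQ.measurableSet
  set w : ℕ → ℝ := fun n => ∫ γ, ψ γ ∂(m n : Measure h.Geod) with hw
  have hw0 : ∀ n, 0 ≤ w n := fun n => integral_nonneg fun γ => (hψ γ).1
  have hwM : ∃ M : ℕ, ∀ n : ℕ, n - M ≤ w n := by
    -- The set where `ψ ≥ 1` is a compact neighbourhood of `β₀`, to which the linear lower bound for
    -- the count applies.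
    have hc : IsCompact {γ | 1 ≤ ψ γ} := ψ.hasCompactSupport.isCompact.of_isClosed_subset
      (isClosed_le continuous_const ψ.continuous) fun γ hγ => subset_tsupport _ fun h0 => by
        have hγ' : 1 ≤ ψ γ := hγ
        rw [h0] at hγ'
        linarith
    obtain ⟨M, hM⟩ := h3 {γ | 1 ≤ ψ γ} (hψ1.mono fun γ hγ => hγ.ge) hc
    refine ⟨M, fun n => ?_⟩
    have h4 := mul_meas_ge_le_integral_of_nonneg (Eventually.of_forall fun γ => (hψ γ).1)
      (integrable_currents (m n) ψ) 1
    rw [one_mul, hmreal n _ hc] at h4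
    have h5 : (n : ℝ) ≤ (h.deckOrbit (γ n) ∩ {γ | 1 ≤ ψ γ}).ncard + M := by exact_mod_cast hM n
    linarith
  have hint : ∀ n, m n ∈ h.internalCurrents := fun n γ' hγ' => by
    change ptMeasure (h.deckOrbit (γ n)) {γ'} = 0
    rw [ptMeasure_apply _ (measurableSet_singleton γ'),
      inter_singleton_eq_empty.2 (disjoint_right.1 (hdisj n) hγ')]
    simp
  -- Dividing by the integral `w n` of `ψ` turns the decomposition of `f` into an `o(1)` term plus
  -- exactly `A`. For the boundary curve the integral of `f` is also `A`, as `β₀` is the only lift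
  -- seen by `ψ`. The finitely many `n` for which `w n` may vanish are harmless.
  refine ⟨fun n => (w n).toNNReal⁻¹ • ⟨m n, hint n⟩, fun f => ?_⟩
  obtain ⟨f', A, hf', hA⟩ := exists_decomposition hβL hψ1.self_of_nhds hψ0 f
  have hlim := tendsto_integral_div hm (P := h.deckOrbit β₀) (w := w)
    (fun Q hQ => by
      obtain ⟨C, hC⟩ := h1 Q hQ
      exact ⟨C, fun n => by rw [hmreal n Q hQ]; exact_mod_cast hC n⟩)
    (fun Q hQ hd => by
      obtain ⟨C, hC⟩ := h2 Q hQ hd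
      exact ⟨C, fun n => by rw [hmreal n Q hQ]; exact_mod_cast hC n⟩) hwM f' hf'
  have hcurve : ∫ γ, f γ ∂(h.curveMeasure β) = A := by
    have hPc : h.curveMeasure β (h.deckOrbit β₀)ᶜ = 0 := by
      have hcl : IsClosed β.1 :=
        isClosed_of_locallyFinite (exists_nhds_finite_geod β.isDiscreteFamily)
      rw [← β.eq_deckOrbit hβ₀, curveMeasure_eq, ptMeasure_apply _ hcl.measurableSet.compl,
        inter_compl_self]
      simp
    have h5 := hA ⟨_, curveMeasure_mem_currents β⟩
    change ∫ γ, f γ ∂(h.curveMeasure β) = ∫ γ, f' γ ∂(h.curveMeasure β) +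
      A * ∫ γ, ψ γ ∂(h.curveMeasure β) at h5
    have h6 : ∫ γ, f' γ ∂(h.curveMeasure β) = 0 := by
      refine integral_eq_zero_of_ae (measure_mono_null (t := (h.deckOrbit β₀)ᶜ)
        (fun γ' hγ' hmem => ?_) hPc)
      exact hγ' (hf' γ' hmem)
    have h7 : ∫ γ, ψ γ ∂(h.curveMeasure β) = 1 := by
      have h8 : ψ =ᵐ[h.curveMeasure β] ({β₀} : Set h.Geod).indicator 1 := by
        refine measure_mono_null (t := (h.deckOrbit β₀)ᶜ) (fun γ' hγ' hmem => ?_) hPc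
        apply hγ'
        rw [← β.eq_deckOrbit hβ₀] at hmem
        by_cases he : γ' = β₀
        · rw [he]
          change ψ β₀ = _
          rw [hψ1.self_of_nhds, indicator_of_mem (mem_singleton β₀)]
          rfl
        · change ψ γ' = _
          rw [hψ0 γ' (β.subset_boundaryLifts hmem) he, indicator_of_notMem (mt mem_singleton_iff.1 he)]
      rw [integral_congr_ae h8, integral_indicator_one (measurableSet_singleton β₀),
        curveMeasure_eq, ptMeasure_real _ (measurableSet_singleton β₀),
        inter_singleton_of_mem hβ₀, ncard_singleton, Nat.cast_one]
    rw [h5, h6, h7, zero_add, mul_one]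
  rw [hcurve]
  have hpos : ∀ᶠ n in atTop, 0 < w n := by
    obtain ⟨M, hM⟩ := hwM
    filter_upwards [eventually_gt_atTop M] with n hn
    have : (M : ℝ) < n := Nat.cast_lt.2 hn
    exact lt_of_lt_of_le (by linarith) (hM n)
  have hlim' := hlim.add_const A
  rw [zero_add] at hlim'
  refine hlim'.congr' (hpos.mono fun n hn => ?_)
  change _ = ∫ γ, f γ ∂((w n).toNNReal⁻¹ • (m n : Measure h.Geod))
  rw [integral_smul_nnreal_measure, hA (m n), NNReal.smul_def, NNReal.coe_inv,
    Real.coe_toNNReal _ (hw0 n), smul_eq_mul]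
  change _ = (w n)⁻¹ * (_ + A * w n)
  field_simp

variable (h) in
theorem dense_internalCurrents [CompactSpace S] : Dense (h.internalCurrents : Set h.currents) :=
  dense_internalCurrents_of exists_tendsto_curveMeasure

end HyperbolicStructure

end GeodesicCurrents

end

theorem mainTheorem1 {S : Type*} [TopologicalSpace S] [CompactSpace S]
    (h : GeodesicCurrents.HyperbolicStructure S) :
    -- the boundary curves are geodesic currents
    (∀ β : h.BoundaryCurve, h.curveMeasure β ∈ h.currents) ∧
    -- every current is uniquely the sum of a boundary-supported and an internal current
    (∀ c : h.currents, ∃! p : h.boundaryCurrents × h.internalCurrents,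
      (p.1 : h.currents) + (p.2 : h.currents) = c) ∧
    -- the coefficients of the boundary curves are unique as well
    (∀ c : h.currents, ∃! p : (h.BoundaryCurve →₀ NNReal) × h.internalCurrents,
      p.1.sum (fun β u => u • h.curveMeasure β) +
        ((p.2 : h.currents) : MeasureTheory.Measure h.Geod) = c) ∧
    IsClosed (h.boundaryCurrents : Set h.currents) ∧
    Dense (h.internalCurrents : Set h.currents) ∧
    MeasurableSet[borel h.currents] (h.internalCurrents : Set h.currents) := by
  open GeodesicCurrents.HyperbolicStructure in
  exact ⟨curveMeasure_mem_currents, existsUnique_add, existsUnique_finsupp,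
    h.isClosed_boundaryCurrents, h.dense_internalCurrents, h.measurableSet_internalCurrents⟩
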